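/- Let $\mathbb F$ be the free group on a countable set $\mathcal A$, and let $X$ be a second-countable locally compact Hausdorff space. A partial action of $\mathbb F$ on $X$ consists of open sets $U_g\subseteq X$ and homeomorphisms $\varphi_g:U_{g^{-1}}\to U_g$ ($g\in\mathbb F$) such that $U_e=X$, $\varphi_e=\mathrm{id}_X$, and, for all $g,h\in\mathbb F$, $\varphi_h(U_{(gh)^{-1}}\cap U_{h^{-1}})=U_h\cap U_{g^{-1}}$ and $\varphi_{gh}(x)=\varphi_g(\varphi_h(x))$ for $x\in U_{h^{-1}}\cap U_{(gh)^{-1}}$. Suppose that the partial action is semi-saturated, i.e. $\varphi_{gh}=\varphi_g\circ\varphi_h$ as partially defined maps whenever $|gh|=|g|+|h|$ for the length of reduced words, and orthogonal, i.e. $U_a\cap U_b=\emptyset$ for all distinct generators $a,b\in\mathcal A$. Let $(X,\sigma)$ be the corresponding Deaconu–Renault system: $\operatorname{dom}(\sigma)=\bigsqcup_{a\in\mathcal A}U_a$ and $\sigma(x)=\varphi_{a^{-1}}(x)$ for $x\in U_a$. Let $$\Gamma(X,\sigma)=\{(x,n-m,y): n,m\in\mathbb N,\ x\in\operatorname{dom}(\sigma^n),\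 y\in\operatorname{dom}(\sigma^m),\ \sigma^n(x)=\sigma^m(y)\}$$ be its Deaconu–Renault groupoid, with the topology generated by the sets $Z(U,n,m,V)=\{(x,n-m,y): x\in U,\ y\in V,\ \sigma^n(x)=\sigma^m(y)\}$, where $U\subseteq\operatorname{dom}(\sigma^n)$ and $V\subseteq\operatorname{dom}(\sigma^m)$ are open sets on which $\sigma^n$, respectively $\sigma^m$, is a homeomorphism onto its image. Let $C^*(\Gamma(X,\sigma))$ be the full groupoid $C^*$-algebra, i.e. the completion of the convolution $*$-algebra $C_c(\Gamma(X,\sigma))$ in its largest $C^*$-seminorm. In it, $C_0(X)$ is the closure of the functions in $C_c(\Gamma(X,\sigma))$ that are supported in the unit space $\{(x,0,x):x\in X\}$. Let $\gamma^X:\mathbb T\to\operatorname{Aut}C^*(\Gamma(X,\sigma))$ be the action with $\gamma^X_z(f)(x,k,y)=z^kf(x,k,y)$ for $f\in C_c(\Gamma(X,\sigma))$. Let $C_0(X)\rtimes\mathbb F$ be the full partial crossed product, i.e. the completion in its largest $C^*$-seminorm of the $*$-algebra of finite sums $\sum_g f_g\delta_g$ with $f_g\in C_0(U_g)$, where $(f\delta_g)(f'\delta_h)=\big(f\cdot(f'\circ\varphi_{g^{-1}})\big)\delta_{gh}$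 (the coefficient being extended by $0$ off $U_g$) and $(f\delta_g)^*=(\overline f\circ\varphi_g)\,\delta_{g^{-1}}$ (the coefficient being extended by $0$ off $U_{g^{-1}}$). In it, $C_0(X)$ is identified with $\{f\delta_e:f\in C_0(X)\}$. There is a unique strongly continuous action $\rho^X:\mathbb T\to\operatorname{Aut}(C_0(X)\rtimes\mathbb F)$ such that $\rho^X_z(f\delta_a)=zf\delta_a$ for all $z\in\mathbb T$, $a\in\mathcal A$, $f\in C_0(U_a)$, and $\rho^X_z(f\delta_e)=f\delta_e$ for all $z\in\mathbb T$, $f\in C_0(X)$; it is given by $\rho^X_z(f\delta_g)=z^{\ell(g)}f\delta_g$ for $f\in C_0(U_g)$, where $\ell:\mathbb F\to\mathbb Z$ is the homomorphism that sends every generator to $1$. Moreover, there is a $*$-isomorphism $\Pi_X:C^*(\Gamma(X,\sigma))\to C_0(X)\rtimes\mathbb F$ such that $$\Pi_X(C_0(X))=C_0(X)\quad\text{and}\quad \Pi_X\circ\gamma^X_z=\rho^X_z\circ\Pi_X\quad\text{for all } z\in\mathbb T,$$ and also $\Pi_X^{-1}(C_0(X))=C_0(X)$ and $\gamma^X_z\circ\Pi_X^{-1}=\Pi_X^{-1}\circ\rho^X_z$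 for all $z\in\mathbb T$. -/

import Mathlib

open Set Topology
open scoped ZeroAtInfty

noncomputable section

/-! ### Enveloping C*-algebras -/

section Enveloping

universe u v

/-- A C*-seminorm on a complex *-algebra: a seminorm that is submultiplicative and satisfies
`p (a* a) = p a ^ 2`.  (Invariance under the involution is then automatic.) -/
structure CStarSeminorm (A : Type u) [NonUnitalRing A] [StarRing A] [Module ℂ A]
    extends Seminorm ℂ A where
  mul_le' : ∀ a b : A, toFun (a * b) ≤ toFun a * toFun b
  star_mul_self' : ∀ a : A, toFun (star a * a) = toFun a ^ 2

namespace CStarSeminorm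

variable {A : Type u} [NonUnitalRing A] [StarRing A] [Module ℂ A]

instance : CoeFun (CStarSeminorm A) (fun _ => A → ℝ) := ⟨fun p => p.toSeminorm⟩

theorem mul_le (p : CStarSeminorm A) (a b : A) : p (a * b) ≤ p a * p b := p.mul_le' a b

theorem star_mul_self (p : CStarSeminorm A) (a : A) : p (star a * a) = p a ^ 2 :=
  p.star_mul_self' a

theorem nonneg (p : CStarSeminorm A) (a : A) : 0 ≤ p a := apply_nonneg p.toSeminorm a

theorem star_eq (p : CStarSeminorm A) (a : A) : p (star a) = p a := by
  have key : ∀ b : A, p b ≤ p (star b) := by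
    intro b
    have h := p.mul_le (star b) b
    rw [p.star_mul_self] at h
    rcases (p.nonneg b).eq_or_lt with h0 | h0
    · rw [← h0]; exact p.nonneg _
    · nlinarith
  refine le_antisymm ?_ (key a)
  simpa using key (star a)

/-- A convenient bound: if `h` is self-adjoint, `u + u* = 2 h²` and `u* u = c² h²` then
`p h ≤ c`. -/
theorem le_of_unitary_trick [StarModule ℂ A] [IsScalarTower ℂ A A] [SMulCommClass ℂ A A]
    (p : CStarSeminorm A) {h u : A} {c : ℝ} (hc : 0 ≤ c)
    (hh : star h = h) (h1 : u + star u = (2 : ℂ) • (h * h))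
    (h2 : star u * u = ((c : ℂ) ^ 2) • (h * h)) : p h ≤ c := by
  have e1 : p (h * h) = p h ^ 2 := by rw [← p.star_mul_self, hh]
  have e2 : p u ^ 2 = (c * p h) ^ 2 := by
    rw [← p.star_mul_self, h2, map_smul_eq_mul, e1]
    simp [mul_pow]
  have e3 : p u = c * p h :=
    (pow_left_inj₀ (p.nonneg u) (mul_nonneg hc (p.nonneg h)) two_ne_zero).1 e2
  have e4 : 2 * p (h * h) ≤ p u + p (star u) := by
    have := map_add_le_add p.toSeminorm u (star u)
    rw [h1, map_smul_eq_mul] at this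
    simpa using this
  rw [p.star_eq, e1, e3] at e4
  rcases (p.nonneg h).eq_or_lt with h0 | h0
  · rw [← h0]; exact hc
  · nlinarith

/-- The algebra `A` seen as a seminormed algebra under the C*-seminorm `p`. -/
def Pre (_p : CStarSeminorm A) : Type u := A

section Pre

variable (p : CStarSeminorm A)

instance : NonUnitalRing p.Pre := inferInstanceAs (NonUnitalRing A)
instance : StarRing p.Pre := inferInstanceAs (StarRing A)
instance : Module ℂ p.Pre := inferInstanceAs (Module ℂ A)
instance [IsScalarTower ℂ A A] : IsScalarTower ℂ p.Pre p.Pre :=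
  inferInstanceAs (IsScalarTower ℂ A A)
instance [SMulCommClass ℂ A A] : SMulCommClass ℂ p.Pre p.Pre :=
  inferInstanceAs (SMulCommClass ℂ A A)
instance [StarModule ℂ A] : StarModule ℂ p.Pre := inferInstanceAs (StarModule ℂ A)

instance : SeminormedAddCommGroup p.Pre :=
  { AddGroupSeminorm.toSeminormedAddCommGroup
      (show AddGroupSeminorm p.Pre from p.toSeminorm.toAddGroupSeminorm),
    (inferInstance : NonUnitalRing p.Pre) with }

theorem norm_pre (a : p.Pre) : ‖a‖ = p a := rfl

instance : NonUnitalSeminormedRing p.Pre :=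
  { (inferInstance : SeminormedAddCommGroup p.Pre),
    (inferInstance : NonUnitalRing p.Pre) with
    norm_mul_le := p.mul_le }

instance : NormedSpace ℂ p.Pre where
  norm_smul_le c a := (map_smul_eq_mul p.toSeminorm c a).le

instance : NormedStarGroup p.Pre where
  norm_star_le a := (p.star_eq a).le

instance : UniformContinuousConstSMul ℂ p.Pre := inferInstance
end Pre

/-- The C*-algebra obtained from `A` by completion with respect to the C*-seminorm `p` (this
includes dividing out the null space of `p`). -/
def Completion (p : CStarSeminorm A) : Type u := UniformSpace.Completion p.Pre

namespace Completion

variable (p : CStarSeminorm A)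

instance : NormedAddCommGroup p.Completion :=
  inferInstanceAs (NormedAddCommGroup (UniformSpace.Completion p.Pre))
instance : NormedSpace ℂ p.Completion :=
  inferInstanceAs (NormedSpace ℂ (UniformSpace.Completion p.Pre))
instance : CompleteSpace p.Completion :=
  inferInstanceAs (CompleteSpace (UniformSpace.Completion p.Pre))

/-- The canonical map from `A` to its completion. -/
def of (a : A) : p.Completion := UniformSpace.Completion.coe' (α := p.Pre) a

theorem isDenseInducing_of : IsDenseInducing (fun a : p.Pre => of p a) :=
  UniformSpace.Completion.isDenseInducing_coe

theorem denseRange_of : DenseRange (of p) := (isDenseInducing_of p).dense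

theorem continuous_of : Continuous (fun a : p.Pre => of p a) := (isDenseInducing_of p).continuous

theorem norm_of (a : A) : ‖of p a‖ = p a := UniformSpace.Completion.norm_coe (E := p.Pre) a

theorem of_add (a b : A) : of p (a + b) = of p a + of p b :=
  UniformSpace.Completion.coe_add (α := p.Pre) a b

theorem of_zero : of p (0 : A) = 0 := UniformSpace.Completion.coe_zero (α := p.Pre)

theorem of_smul (c : ℂ) (a : A) : of p (c • a) = c • of p a :=
  UniformSpace.Completion.coe_smul (X := p.Pre) c a

/-- The canonical map as an additive homomorphism. -/
def ofHom : p.Pre →+ p.Completion where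
  toFun a := of p a
  map_zero' := of_zero p
  map_add' := of_add p

@[elab_as_elim]
theorem induction_on {P : p.Completion → Prop} (x : p.Completion) (hp : IsClosed {x | P x})
    (h : ∀ a : A, P (of p a)) : P x :=
  UniformSpace.Completion.induction_on (α := p.Pre) x hp h

theorem induction_on₂ {P : p.Completion → p.Completion → Prop} (x y : p.Completion)
    (hp : IsClosed {x : p.Completion × p.Completion | P x.1 x.2})
    (h : ∀ a b : A, P (of p a) (of p b)) : P x y :=
  UniformSpace.Completion.induction_on₂ (α := p.Pre) (β := p.Pre) x y hp h

theorem induction_on₃ {P : p.Completion → p.Completion → p.Completion → Prop}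
    (x y z : p.Completion)
    (hp : IsClosed {x : p.Completion × p.Completion × p.Completion | P x.1 x.2.1 x.2.2})
    (h : ∀ a b c : A, P (of p a) (of p b) (of p c)) : P x y z :=
  UniformSpace.Completion.induction_on₃ (α := p.Pre) (β := p.Pre) (γ := p.Pre) x y z hp h

/-- Multiplication, extended from `A` by continuity. -/
instance : Mul p.Completion :=
  ⟨fun x y => ((isDenseInducing_of p).prodMap (isDenseInducing_of p)).extend
    (fun q : p.Pre × p.Pre => of p (q.1 * q.2)) (x, y)⟩

theorem of_mul (a b : A) : of p (a * b) = of p a * of p b :=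
  (((isDenseInducing_of p).prodMap (isDenseInducing_of p)).extend_eq
      (f := fun q : p.Pre × p.Pre => of p (q.1 * q.2))
      ((continuous_of p).comp (@continuous_mul p.Pre _ _ _)) (a, b)).symm

instance : ContinuousMul p.Completion where
  continuous_mul := by
    let m := (AddMonoidHom.mul : p.Pre →+ p.Pre →+ p.Pre).compr₂ (ofHom p)
    have h : Continuous fun q : p.Pre × p.Pre => m q.1 q.2 :=
      (continuous_of p).comp (@continuous_mul p.Pre _ _ _)
    have di : IsDenseInducing (ofHom p) := isDenseInducing_of p
    exact (di.extend_Z_bilin di h :)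

/-- The involution, extended from `A` by continuity. -/
instance : Star p.Completion :=
  ⟨fun x => UniformSpace.Completion.map (α := p.Pre) (β := p.Pre) star x⟩

theorem uniformContinuous_star_pre : UniformContinuous (star : p.Pre → p.Pre) :=
  (AddMonoidHomClass.lipschitz_of_bound (starAddEquiv : p.Pre ≃+ p.Pre) 1 fun a => by
    rw [one_mul]; exact (p.star_eq a).le).uniformContinuous

theorem of_star (a : A) : of p (star a) = star (of p a) :=
  (UniformSpace.Completion.map_coe (α := p.Pre) (β := p.Pre)
    (uniformContinuous_star_pre p) a).symm

instance : ContinuousStar p.Completion where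
  continuous_star := UniformSpace.Completion.continuous_map (α := p.Pre) (β := p.Pre)

theorem zero_mul_aux (x : p.Completion) : 0 * x = 0 := by
  induction x using induction_on with
  | hp => exact isClosed_eq (by fun_prop) continuous_const
  | h a => rw [← of_zero, ← of_mul, zero_mul]

theorem mul_zero_aux (x : p.Completion) : x * 0 = 0 := by
  induction x using induction_on with
  | hp => exact isClosed_eq (by fun_prop) continuous_const
  | h a => rw [← of_zero, ← of_mul, mul_zero]

theorem mul_assoc_aux (x y z : p.Completion) : x * y * z = x * (y * z) :=
  induction_on₃ p (P := fun x y z => x * y * z = x * (y * z)) x y z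
    (isClosed_eq (by fun_prop) (by fun_prop))
    fun a b c => by simp only [← of_mul, mul_assoc]

theorem mul_add_aux (x y z : p.Completion) : x * (y + z) = x * y + x * z :=
  induction_on₃ p (P := fun x y z => x * (y + z) = x * y + x * z) x y z
    (isClosed_eq (by fun_prop) (by fun_prop))
    fun a b c => by simp only [← of_mul, ← of_add, mul_add]

theorem add_mul_aux (x y z : p.Completion) : (x + y) * z = x * z + y * z :=
  induction_on₃ p (P := fun x y z => (x + y) * z = x * z + y * z) x y z
    (isClosed_eq (by fun_prop) (by fun_prop))
    fun a b c => by simp only [← of_mul, ← of_add, add_mul]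

instance : NonUnitalNormedRing p.Completion where
  zero_mul := zero_mul_aux p
  mul_zero := mul_zero_aux p
  mul_assoc := mul_assoc_aux p
  left_distrib := mul_add_aux p
  right_distrib := add_mul_aux p
  dist_eq := NormedAddCommGroup.dist_eq
  norm_mul_le x y := induction_on₂ p (P := fun x y => ‖x * y‖ ≤ ‖x‖ * ‖y‖) x y
    (isClosed_le (by fun_prop) (by fun_prop))
    fun a b => by simpa only [← of_mul, norm_of] using p.mul_le a b

instance : StarRing p.Completion where
  star_involutive x := by
    induction x using induction_on with
    | hp => exact isClosed_eq (by fun_prop) continuous_id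
    | h a => simp only [← of_star, star_star]
  star_mul x y := induction_on₂ p (P := fun x y => star (x * y) = star y * star x) x y (isClosed_eq (by fun_prop) (by fun_prop))
    fun a b => by simp only [← of_mul, ← of_star, star_mul]
  star_add x y := induction_on₂ p (P := fun x y => star (x + y) = star x + star y) x y (isClosed_eq (by fun_prop) (by fun_prop))
    fun a b => by simp only [← of_add, ← of_star, star_add]

instance : CStarRing p.Completion where
  norm_mul_self_le x := by
    induction x using induction_on with
    | hp => exact isClosed_le (by fun_prop) (by fun_prop)
    | h a => rw [← of_star, ← of_mul, norm_of, norm_of, p.star_mul_self, sq]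

theorem continuous_smul_aux (c : ℂ) : Continuous (fun x : p.Completion => c • x) :=
  UniformContinuousConstSMul.uniformContinuous_const_smul c |>.continuous

theorem smul_mul_aux [IsScalarTower ℂ A A] (c : ℂ) (x y : p.Completion) :
    (c • x) * y = c • (x * y) :=
  induction_on₂ p (P := fun x y => (c • x) * y = c • (x * y)) x y
    (isClosed_eq (((continuous_smul_aux p c).comp continuous_fst).mul continuous_snd)
      ((continuous_smul_aux p c).comp continuous_mul))
    fun a b => by simp only [← of_mul, ← of_smul, smul_mul_assoc]

theorem mul_smul_aux [SMulCommClass ℂ A A] (c : ℂ) (x y : p.Completion) :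
    x * (c • y) = c • (x * y) :=
  induction_on₂ p (P := fun x y => x * (c • y) = c • (x * y)) x y
    (isClosed_eq (continuous_fst.mul ((continuous_smul_aux p c).comp continuous_snd))
      ((continuous_smul_aux p c).comp continuous_mul))
    fun a b => by simp only [← of_mul, ← of_smul, mul_smul_comm]

theorem star_smul_aux [StarModule ℂ A] (c : ℂ) (x : p.Completion) :
    star (c • x) = star c • star x := by
  induction x using induction_on with
  | hp => exact isClosed_eq (continuous_star.comp (continuous_smul_aux p c))
            ((continuous_smul_aux p (star c)).comp continuous_star)
  | h a => rw [← of_star, ← of_smul, ← of_smul, ← of_star, star_smul]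

instance [IsScalarTower ℂ A A] [SMulCommClass ℂ A A] [StarModule ℂ A] :
    NonUnitalCStarAlgebra p.Completion where
  smul_assoc := smul_mul_aux p
  smul_comm c x y := (mul_smul_aux p c x y).symm
  star_smul := star_smul_aux p

end Completion

end CStarSeminorm

/-- A *-algebra on which the supremum of all C*-seminorms is finite, i.e. one that has an
enveloping C*-algebra. -/
class HasCStarEnvelope (A : Type u) [NonUnitalRing A] [StarRing A] [Module ℂ A] : Prop where
  bddAbove : ∀ a : A, BddAbove (range fun p : CStarSeminorm A => p a)

variable (A : Type u) [NonUnitalRing A] [StarRing A] [Module ℂ A]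

instance : Zero (CStarSeminorm A) :=
  ⟨{ (0 : Seminorm ℂ A) with
      mul_le' := by intro a b; change (0 : ℝ) ≤ 0 * 0; simp
      star_mul_self' := by intro a; change (0 : ℝ) = 0 ^ 2; simp }⟩

instance : Nonempty (CStarSeminorm A) := ⟨0⟩

variable [HasCStarEnvelope A]

/-- The largest C*-seminorm on `A`: the supremum of all C*-seminorms. -/
def maxCStarSeminorm : CStarSeminorm A where
  toFun a := ⨆ p : CStarSeminorm A, p a
  map_zero' := by simp
  add_le' a b := ciSup_le fun p => (map_add_le_add p.toSeminorm a b).trans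
    (add_le_add (le_ciSup (HasCStarEnvelope.bddAbove a) p)
      (le_ciSup (HasCStarEnvelope.bddAbove b) p))
  neg' a := by simp
  smul' c a := by
    simp only [map_smul_eq_mul]
    exact (Real.mul_iSup_of_nonneg (norm_nonneg c) _).symm
  mul_le' a b := ciSup_le fun p => (p.mul_le a b).trans
    (mul_le_mul (le_ciSup (HasCStarEnvelope.bddAbove a) p)
      (le_ciSup (HasCStarEnvelope.bddAbove b) p) (p.nonneg b)
      (Real.iSup_nonneg fun p => p.nonneg a))
  star_mul_self' a := by
    refine le_antisymm (ciSup_le fun p => ?_) ?_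
    · rw [p.star_mul_self]
      exact pow_le_pow_left₀ (p.nonneg a) (le_ciSup (HasCStarEnvelope.bddAbove a) p) 2
    · have h0 : 0 ≤ ⨆ p : CStarSeminorm A, p (star a * a) :=
        Real.iSup_nonneg fun p => p.nonneg _
      refine (Real.le_sqrt (Real.iSup_nonneg fun p => p.nonneg a) h0).1 ?_
      refine ciSup_le fun p => Real.le_sqrt_of_sq_le ?_
      rw [← p.star_mul_self]
      exact le_ciSup (HasCStarEnvelope.bddAbove (star a * a)) p

/-- The enveloping C*-algebra of `A`: the completion of `A` in its largest C*-seminorm. -/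
abbrev EnvelopingCStarAlgebra : Type u := (maxCStarSeminorm A).Completion

namespace EnvelopingCStarAlgebra

variable {A}
variable {B : Type v} [NonUnitalRing B] [StarRing B] [Module ℂ B] [HasCStarEnvelope B]

/-- The canonical *-homomorphism from `A` to its enveloping C*-algebra. -/
def of : A →⋆ₙₐ[ℂ] EnvelopingCStarAlgebra A where
  toFun := CStarSeminorm.Completion.of _
  map_smul' := CStarSeminorm.Completion.of_smul _
  map_zero' := CStarSeminorm.Completion.of_zero _
  map_add' := CStarSeminorm.Completion.of_add _
  map_mul' := CStarSeminorm.Completion.of_mul _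
  map_star' := CStarSeminorm.Completion.of_star _

/-- The pull-back of a C*-seminorm under a *-homomorphism. -/
def _root_.CStarSeminorm.comap {A : Type u} [NonUnitalRing A] [StarRing A] [Module ℂ A]
    {B : Type v} [NonUnitalRing B] [StarRing B] [Module ℂ B]
    (φ : A →⋆ₙₐ[ℂ] B) (p : CStarSeminorm B) : CStarSeminorm A where
  toFun a := p (φ a)
  map_zero' := by simp
  add_le' a b := by rw [map_add]; exact map_add_le_add _ _ _
  neg' a := by simp
  smul' c a := by rw [map_smul, map_smul_eq_mul]
  mul_le' a b := by rw [map_mul]; exact p.mul_le _ _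
  star_mul_self' a := by rw [map_mul, map_star]; exact p.star_mul_self _

theorem maxCStarSeminorm_map_le (φ : A →⋆ₙₐ[ℂ] B) (a : A) :
    maxCStarSeminorm B (φ a) ≤ maxCStarSeminorm A a :=
  ciSup_le fun p => le_ciSup (HasCStarEnvelope.bddAbove a) (p.comap φ)

theorem continuous_map_aux (φ : A →⋆ₙₐ[ℂ] B) :
    UniformContinuous (α := (maxCStarSeminorm A).Pre) (β := (maxCStarSeminorm B).Pre)
      (fun a => φ a) := by
  let ψ : (maxCStarSeminorm A).Pre →+ (maxCStarSeminorm B).Pre :=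
    { toFun := fun a => φ a, map_zero' := map_zero φ, map_add' := map_add φ }
  exact (AddMonoidHomClass.lipschitz_of_bound ψ 1 fun a => by
    rw [one_mul]; exact maxCStarSeminorm_map_le φ a).uniformContinuous

/-- The underlying map of `map`. -/
def mapFun (φ : A →⋆ₙₐ[ℂ] B) : EnvelopingCStarAlgebra A → EnvelopingCStarAlgebra B :=
  UniformSpace.Completion.map (α := (maxCStarSeminorm A).Pre) (β := (maxCStarSeminorm B).Pre)
    (fun a => φ a)

theorem continuous_mapFun (φ : A →⋆ₙₐ[ℂ] B) : Continuous (mapFun φ) :=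
  UniformSpace.Completion.continuous_map (α := (maxCStarSeminorm A).Pre)
    (β := (maxCStarSeminorm B).Pre)

theorem mapFun_of (φ : A →⋆ₙₐ[ℂ] B) (a : A) :
    mapFun φ (CStarSeminorm.Completion.of _ a) = CStarSeminorm.Completion.of _ (φ a) :=
  UniformSpace.Completion.map_coe (α := (maxCStarSeminorm A).Pre)
    (β := (maxCStarSeminorm B).Pre) (continuous_map_aux φ) a

open CStarSeminorm.Completion in
/-- The *-homomorphism of enveloping C*-algebras induced by a *-homomorphism `φ`, that is the
extension of `φ` by continuity. -/
def map (φ : A →⋆ₙₐ[ℂ] B) : EnvelopingCStarAlgebra A →⋆ₙₐ[ℂ] EnvelopingCStarAlgebra B where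
  toFun := mapFun φ
  map_smul' c x := by
    induction x using induction_on with
    | hp => exact isClosed_eq ((continuous_mapFun φ).comp (continuous_smul_aux _ c))
              ((continuous_smul_aux _ c).comp (continuous_mapFun φ))
    | h a => rw [← of_smul, mapFun_of, mapFun_of, map_smul, of_smul]; rfl
  map_zero' := by rw [← of_zero, mapFun_of, map_zero, of_zero]
  map_add' x y := by
    have := continuous_mapFun φ
    exact induction_on₂ _ (P := fun x y => mapFun φ (x + y) = mapFun φ x + mapFun φ y) x y
      (isClosed_eq (by fun_prop) (by fun_prop))
      fun a b => by simp only [← of_add, mapFun_of, map_add]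
  map_mul' x y := by
    have := continuous_mapFun φ
    exact induction_on₂ _ (P := fun x y => mapFun φ (x * y) = mapFun φ x * mapFun φ y) x y
      (isClosed_eq (by fun_prop) (by fun_prop))
      fun a b => by simp only [← of_mul, mapFun_of, map_mul]
  map_star' x := by
    have := continuous_mapFun φ
    induction x using induction_on with
    | hp => exact isClosed_eq (by fun_prop) (by fun_prop)
    | h a => simp only [← of_star, mapFun_of, map_star]

theorem map_of (φ : A →⋆ₙₐ[ℂ] B) (a : A) : map φ (of a) = of (φ a) := mapFun_of φ a

theorem continuous_map (φ : A →⋆ₙₐ[ℂ] B) : Continuous (map φ) := continuous_mapFun φ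

theorem denseRange_of : DenseRange (of : A → EnvelopingCStarAlgebra A) :=
  CStarSeminorm.Completion.denseRange_of _

end EnvelopingCStarAlgebra

variable {A} in
/-- An action of a group `T` on `A` by *-automorphisms, given as a family `α` of *-homomorphisms
with `α 1 = id` and `α (s t) = α s ∘ α t`, extended to the enveloping C*-algebra. -/
def EnvelopingCStarAlgebra.extendAction {T : Type v} [Group T] (α : T → (A →⋆ₙₐ[ℂ] A))
    (h1 : ∀ a, α 1 a = a) (hmul : ∀ s t a, α (s * t) a = α s (α t a)) :
    T →* (EnvelopingCStarAlgebra A ≃⋆ₐ[ℂ] EnvelopingCStarAlgebra A) :=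
  have key1 : ∀ x, map (α 1) x = x := fun x => by
    have hc := continuous_map (α 1)
    refine CStarSeminorm.Completion.induction_on _ x (isClosed_eq hc continuous_id) fun a => ?_
    exact (map_of (α 1) a).trans (by rw [h1]; rfl)
  have key2 : ∀ s t x, map (α (s * t)) x = map (α s) (map (α t) x) := fun s t x => by
    refine CStarSeminorm.Completion.induction_on _ x
      (isClosed_eq (continuous_map _) ((continuous_map _).comp (continuous_map _))) fun a => ?_
    change map _ (of a) = map _ (map _ (of a))
    simp only [map_of, hmul]
  { toFun := fun t =>
      { toFun := map (α t)
        invFun := map (α t⁻¹)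
        left_inv := fun x => by rw [← key2, inv_mul_cancel, key1]
        right_inv := fun x => by rw [← key2, mul_inv_cancel, key1]
        map_mul' := map_mul _
        map_add' := map_add _
        map_star' := map_star _
        map_smul' := map_smul _ }
    map_one' := by ext x; exact key1 x
    map_mul' := fun s t => by ext x; exact key2 s t x }

theorem EnvelopingCStarAlgebra.extendAction_of {A : Type u} [NonUnitalRing A] [StarRing A] [Module ℂ A] [HasCStarEnvelope A]
    {T : Type v} [Group T] (α : T → (A →⋆ₙₐ[ℂ] A))
    (h1 : ∀ a, α 1 a = a) (hmul : ∀ s t a, α (s * t) a = α s (α t a)) (t : T) (a : A) :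
    extendAction α h1 hmul t (of a) = of (α t a) := map_of (α t) a

end Enveloping

/-! ### Deaconu-Renault systems and their groupoids -/

section DeaconuRenault

universe u v

/-- A Deaconu-Renault system on `X`: a local homeomorphism from an open subset `dom` of `X` onto
an (automatically open) subset of `X`.  It is given by a total function of which only the values
on `dom` are relevant. -/
structure DeaconuRenaultSystem (X : Type u) [TopologicalSpace X] where
  dom : Set X
  toFun : X → X
  isOpen_dom : IsOpen dom
  isLocalHomeomorphOn : IsLocalHomeomorphOn toFun dom

namespace DeaconuRenaultSystem

variable {X : Type u} [TopologicalSpace X] (S : DeaconuRenaultSystem X)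

/-- The domain of `σⁿ`. -/
def domIter : ℕ → Set X
  | 0 => univ
  | n + 1 => {x | x ∈ S.dom ∧ S.toFun x ∈ domIter n}

/-- `σⁿ`; only its values on `domIter n` are relevant. -/
def iter (n : ℕ) : X → X := S.toFun^[n]

theorem iter_add (n m : ℕ) (x : X) : S.iter (n + m) x = S.iter m (S.iter n x) := by
  rw [add_comm]; exact Function.iterate_add_apply S.toFun m n x

theorem mem_domIter_add {n m : ℕ} {x : X} :
    x ∈ S.domIter (n + m) ↔ x ∈ S.domIter n ∧ S.iter n x ∈ S.domIter m := by
  induction n generalizing x with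
  | zero => simp [domIter, iter]
  | succ n ih =>
    rw [show n + 1 + m = (n + m) + 1 by ring]
    simp only [domIter, mem_ofPred_eq, ih, and_assoc]
    rfl

theorem isLocalHomeomorphOn_iter (n : ℕ) : IsLocalHomeomorphOn (S.iter n) (S.domIter n) := by
  induction n with
  | zero => exact (Homeomorph.refl X).isLocalHomeomorph.isLocalHomeomorphOn
  | succ n ih =>
    have h1 : S.domIter (n + 1) ⊆ S.dom := fun x hx => hx.1
    have h2 : MapsTo S.toFun (S.domIter (n + 1)) (S.domIter n) := fun x hx => hx.2
    exact ih.comp (S.isLocalHomeomorphOn.mono h1) h2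

theorem isOpen_domIter (n : ℕ) : IsOpen (S.domIter n) := by
  induction n with
  | zero => exact isOpen_univ
  | succ n ih => exact S.isLocalHomeomorphOn.continuousOn.isOpen_inter_preimage S.isOpen_dom ih

/-- `x ∈ dom(σⁿ)`, `y ∈ dom(σᵐ)` and `σⁿ(x) = σᵐ(y)`. -/
def Rel (n m : ℕ) (x y : X) : Prop :=
  x ∈ S.domIter n ∧ y ∈ S.domIter m ∧ S.iter n x = S.iter m y

variable {S} in
theorem Rel.symm {n m : ℕ} {x y : X} (h : S.Rel n m x y) : S.Rel m n y x :=
  ⟨h.2.1, h.1, h.2.2.symm⟩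

variable {S} in
theorem Rel.trans {n m q : ℕ} {x y z : X} (h : S.Rel n m x y) (h' : S.Rel m q y z) :
    S.Rel n q x z := ⟨h.1, h'.2.1, h.2.2.trans h'.2.2⟩

variable {S} in
theorem Rel.add {n m : ℕ} {x y : X} (h : S.Rel n m x y) {j : ℕ} (hy : y ∈ S.domIter (m + j)) :
    S.Rel (n + j) (m + j) x y := by
  refine ⟨?_, hy, by rw [iter_add, iter_add, h.2.2]⟩
  rw [mem_domIter_add] at hy ⊢
  exact ⟨h.1, h.2.2 ▸ hy.2⟩

variable {S} in
/-- If `σⁿ x = σᵐ y` and `σᵖ y = σ^q z`, then `x` and `z` are related with exponents that depend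
only on `n, m, p, q`. -/
theorem Rel.comp {n m p q : ℕ} {x y z : X} (h : S.Rel n m x y) (h' : S.Rel p q y z) :
    S.Rel (n + (p - m)) (q + (m - p)) x z := by
  rcases le_total m p with hmp | hmp
  · obtain ⟨j, rfl⟩ := Nat.exists_eq_add_of_le hmp
    have := (h.add h'.1).trans h'
    simpa using this
  · obtain ⟨j, rfl⟩ := Nat.exists_eq_add_of_le hmp
    have := h.trans (h'.symm.add h.2.1).symm
    simpa using this

/-- The Deaconu-Renault groupoid, as a set: the triples `(x, n - m, y)` such that
`x ∈ dom(σⁿ)`, `y ∈ dom(σᵐ)` and `σⁿ(x) = σᵐ(y)`. -/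
def Groupoid : Type u :=
  {γ : X × ℤ × X // ∃ n m : ℕ, γ.2.1 = (n : ℤ) - m ∧ S.Rel n m γ.1 γ.2.2}

namespace Groupoid

variable {S}

/-- The range map `(x, k, y) ↦ x` (units are identified with points of `X`). -/
def r (γ : S.Groupoid) : X := γ.1.1

/-- The canonical cocycle `(x, k, y) ↦ k`. -/
def c (γ : S.Groupoid) : ℤ := γ.1.2.1

/-- The source map `(x, k, y) ↦ y`. -/
def s (γ : S.Groupoid) : X := γ.1.2.2

theorem ext {γ η : S.Groupoid} (hr : γ.r = η.r) (hc : γ.c = η.c) (hs : γ.s = η.s) : γ = η :=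
  Subtype.ext (Prod.ext hr (Prod.ext hc hs))

theorem exists_rel (γ : S.Groupoid) : ∃ n m : ℕ, γ.c = (n : ℤ) - m ∧ S.Rel n m γ.r γ.s := γ.2

/-- The inverse `(x, k, y)⁻¹ = (y, -k, x)`. -/
def inv (γ : S.Groupoid) : S.Groupoid :=
  ⟨(γ.s, -γ.c, γ.r), by
    obtain ⟨n, m, h, h'⟩ := γ.exists_rel
    exact ⟨m, n, by simp [h], h'.symm⟩⟩

/-- The product `(x, k, y) (y, l, z) = (x, k + l, z)`. -/
def mul (γ η : S.Groupoid) (h : γ.s = η.r) : S.Groupoid :=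
  ⟨(γ.r, γ.c + η.c, η.s), by
    obtain ⟨n, m, hc, hR⟩ := γ.exists_rel
    obtain ⟨p, q, hc', hR'⟩ := η.exists_rel
    rw [← h] at hR'
    exact ⟨n + (p - m), q + (m - p), by simp only [hc, hc']; omega, hR.comp hR'⟩⟩

@[simp] theorem r_inv (γ : S.Groupoid) : γ.inv.r = γ.s := rfl
@[simp] theorem s_inv (γ : S.Groupoid) : γ.inv.s = γ.r := rfl
@[simp] theorem c_inv (γ : S.Groupoid) : γ.inv.c = -γ.c := rfl
@[simp] theorem inv_inv (γ : S.Groupoid) : γ.inv.inv = γ := ext rfl (neg_neg _) rfl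
@[simp] theorem r_mul (γ η : S.Groupoid) (h : γ.s = η.r) : (γ.mul η h).r = γ.r := rfl
@[simp] theorem s_mul (γ η : S.Groupoid) (h : γ.s = η.r) : (γ.mul η h).s = η.s := rfl
@[simp] theorem c_mul (γ η : S.Groupoid) (h : γ.s = η.r) : (γ.mul η h).c = γ.c + η.c := rfl

/-- The unit `(x, 0, x)`. -/
def unit (x : X) : S.Groupoid := ⟨(x, 0, x), 0, 0, by simp, trivial, trivial, rfl⟩

/-- The unit space `{(x, 0, x)}`. -/
def units (S : DeaconuRenaultSystem X) : Set S.Groupoid := range unit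

theorem mem_units {γ : S.Groupoid} : γ ∈ units S ↔ γ.c = 0 ∧ γ.r = γ.s := by
  constructor
  · rintro ⟨x, rfl⟩; exact ⟨rfl, rfl⟩
  · rintro ⟨h, h'⟩; exact ⟨γ.r, ext rfl h.symm h'⟩

/-- The set `Z(U, n, m, V) = {(x, n - m, y) : x ∈ U, y ∈ V, σⁿ(x) = σᵐ(y)}`. -/
def Z (U : Set X) (n m : ℕ) (V : Set X) : Set S.Groupoid :=
  {γ | γ.r ∈ U ∧ γ.s ∈ V ∧ γ.c = (n : ℤ) - m ∧ S.iter n γ.r = S.iter m γ.s}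

/-- The topology of the Deaconu-Renault groupoid, generated by the sets `Z(U, n, m, V)`, where
`U ⊆ dom(σⁿ)` and `V ⊆ dom(σᵐ)` are open and `σⁿ|U`, `σᵐ|V` are homeomorphisms onto their
images. -/
instance : TopologicalSpace S.Groupoid :=
  TopologicalSpace.generateFrom
    {W | ∃ (U V : Set X) (n m : ℕ), IsOpen U ∧ IsOpen V ∧ U ⊆ S.domIter n ∧ V ⊆ S.domIter m ∧
      IsEmbedding (U.domRestrict (S.iter n)) ∧ IsEmbedding (V.domRestrict (S.iter m)) ∧
      W = Z U n m V}

theorem exists_small (n : ℕ) {x : X} (hx : x ∈ S.domIter n) {W : Set X} (hW : W ∈ 𝓝 x) :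
    ∃ U : Set X, IsOpen U ∧ x ∈ U ∧ U ⊆ W ∧ U ⊆ S.domIter n ∧
      IsEmbedding (U.domRestrict (S.iter n)) := by
  obtain ⟨e, hxe, he⟩ := S.isLocalHomeomorphOn_iter n x hx
  refine ⟨e.source ∩ (interior W ∩ S.domIter n),
    e.open_source.inter (isOpen_interior.inter (S.isOpen_domIter n)),
    ⟨hxe, mem_interior_iff_mem_nhds.2 hW, hx⟩, fun y hy => interior_subset hy.2.1,
    fun y hy => hy.2.2, ?_⟩
  rw [he]
  exact e.isOpenEmbedding_restrict.isEmbedding.comp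
    (IsEmbedding.inclusion (inter_subset_left))

theorem exists_nhds (γ : S.Groupoid) {n m : ℕ} (hc : γ.c = (n : ℤ) - m)
    (hR : S.Rel n m γ.r γ.s) {W W' : Set X} (hW : W ∈ 𝓝 γ.r) (hW' : W' ∈ 𝓝 γ.s) :
    ∃ N : Set S.Groupoid, IsOpen N ∧ γ ∈ N ∧ InjOn r N ∧
      ∀ η ∈ N, η.r ∈ W ∧ η.s ∈ W' ∧ η.c = (n : ℤ) - m ∧ S.Rel n m η.r η.s := by
  obtain ⟨U, hUo, hxU, hUW, hUd, hUe⟩ := exists_small n hR.1 hW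
  obtain ⟨V, hVo, hyV, hVW, hVd, hVe⟩ := exists_small m hR.2.1 hW'
  refine ⟨Z U n m V, TopologicalSpace.isOpen_generateFrom_of_mem
    ⟨U, V, n, m, hUo, hVo, hUd, hVd, hUe, hVe, rfl⟩, ⟨hxU, hyV, hc, hR.2.2⟩, ?_, ?_⟩
  · rintro a ⟨-, ha, hac, haR⟩ b ⟨-, hb, hbc, hbR⟩ hab
    refine ext hab (hac.trans hbc.symm) ?_
    have : (⟨a.s, ha⟩ : V) = ⟨b.s, hb⟩ := hVe.injective (by
      change S.iter m a.s = S.iter m b.s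
      rw [← haR, ← hbR, hab])
    exact congrArg Subtype.val this
  · rintro η ⟨h1, h2, h3, h4⟩
    exact ⟨hUW h1, hVW h2, h3, hUd h1, hVd h2, h4⟩

theorem continuous_r : Continuous (r : S.Groupoid → X) := by
  refine continuous_iff_continuousAt.2 fun γ W hW => ?_
  obtain ⟨n, m, hc, hR⟩ := γ.exists_rel
  obtain ⟨N, hN, hγ, -, h⟩ := exists_nhds γ hc hR hW Filter.univ_mem
  exact Filter.mem_map.2 (Filter.mem_of_superset (hN.mem_nhds hγ) fun η hη => (h η hη).1)

theorem continuous_s : Continuous (s : S.Groupoid → X) := by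
  refine continuous_iff_continuousAt.2 fun γ W hW => ?_
  obtain ⟨n, m, hc, hR⟩ := γ.exists_rel
  obtain ⟨N, hN, hγ, -, h⟩ := exists_nhds γ hc hR Filter.univ_mem hW
  exact Filter.mem_map.2 (Filter.mem_of_superset (hN.mem_nhds hγ) fun η hη => (h η hη).2.1)

theorem eventually_rel (γ : S.Groupoid) {n m : ℕ} (hc : γ.c = (n : ℤ) - m)
    (hR : S.Rel n m γ.r γ.s) : ∀ᶠ η in 𝓝 γ, η.c = (n : ℤ) - m ∧ S.Rel n m η.r η.s := by
  obtain ⟨N, hN, hγ, -, h⟩ := exists_nhds γ hc hR Filter.univ_mem Filter.univ_mem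
  exact Filter.mem_of_superset (hN.mem_nhds hγ) fun η hη => (h η hη).2.2

theorem continuous_c : Continuous (c : S.Groupoid → ℤ) := by
  refine continuous_iff_continuousAt.2 fun γ W hW => ?_
  obtain ⟨n, m, hc, hR⟩ := γ.exists_rel
  refine Filter.mem_map.2 (Filter.mem_of_superset (eventually_rel γ hc hR) fun η hη => ?_)
  rw [Set.mem_preimage, hη.1, ← hc]
  exact mem_of_mem_nhds hW

/-- A criterion for convergence in the Deaconu-Renault groupoid. -/
theorem tendsto_of {Y : Type v} {l : Filter Y} {f : Y → S.Groupoid} {γ : S.Groupoid} {n m : ℕ}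
    (hc : γ.c = (n : ℤ) - m) (hR : S.Rel n m γ.r γ.s)
    (hr : Filter.Tendsto (fun y => (f y).r) l (𝓝 γ.r))
    (hs : Filter.Tendsto (fun y => (f y).s) l (𝓝 γ.s))
    (hf : ∀ᶠ y in l, (f y).c = (n : ℤ) - m ∧ S.Rel n m (f y).r (f y).s) :
    Filter.Tendsto f l (𝓝 γ) := by
  rw [TopologicalSpace.tendsto_nhds_generateFrom_iff]
  rintro _ ⟨U, V, n', m', hU, hV, hUd, hVd, -, -, rfl⟩ ⟨hrU, hsV, hc', hR'⟩
  have hrU' := hr (hU.mem_nhds hrU)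
  have hsV' := hs (hV.mem_nhds hsV)
  have hnm : (n : ℤ) - m = (n' : ℤ) - m' := hc.symm.trans hc'
  rcases le_total n n' with h | h
  · obtain ⟨j, rfl⟩ := Nat.exists_eq_add_of_le h
    obtain rfl : m' = m + j := by omega
    filter_upwards [hrU', hsV', hf] with y h1 h2 h3
    refine ⟨h1, h2, h3.1.trans hnm, ?_⟩
    rw [iter_add, iter_add, h3.2.2.2]
  · obtain ⟨j, rfl⟩ := Nat.exists_eq_add_of_le h
    obtain rfl : m = m' + j := by omega
    have hd := (S.mem_domIter_add.1 hR.1).2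
    obtain ⟨e, hxe, he⟩ := S.isLocalHomeomorphOn_iter j _ hd
    have t1 := ((S.isLocalHomeomorphOn_iter n').continuousAt (hUd hrU)).tendsto.comp hr
    have t2 := ((S.isLocalHomeomorphOn_iter m').continuousAt (hVd hsV)).tendsto.comp hs
    rw [← hR'] at t2
    filter_upwards [hrU', hsV', hf, t1 (e.open_source.mem_nhds hxe),
      t2 (e.open_source.mem_nhds hxe)] with y h1 h2 h3 h4 h5
    refine ⟨h1, h2, h3.1.trans hnm, ?_⟩
    refine e.injOn h4 h5 ?_
    rw [← he]
    have := h3.2.2.2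
    rwa [iter_add, iter_add] at this

theorem tendsto_mul {Y : Type v} {l : Filter Y} {f g h : Y → S.Groupoid} {α β γ : S.Groupoid}
    (hf : Filter.Tendsto f l (𝓝 α)) (hg : Filter.Tendsto g l (𝓝 β)) (hαβ : α.s = β.r)
    (hγ : γ = α.mul β hαβ) (hh : ∀ᶠ y in l, ∃ e : (f y).s = (g y).r, h y = (f y).mul (g y) e) :
    Filter.Tendsto h l (𝓝 γ) := by
  subst hγ
  obtain ⟨n, m, hc, hR⟩ := α.exists_rel
  obtain ⟨p, q, hc', hR'⟩ := β.exists_rel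
  have key : ∀ {a b : S.Groupoid} (e : a.s = b.r), (a.c = (n : ℤ) - m ∧ S.Rel n m a.r a.s) →
      (b.c = (p : ℤ) - q ∧ S.Rel p q b.r b.s) →
      (a.mul b e).c = ((n + (p - m) : ℕ) : ℤ) - ((q + (m - p) : ℕ) : ℤ) ∧
        S.Rel (n + (p - m)) (q + (m - p)) (a.mul b e).r (a.mul b e).s := by
    rintro a b e ⟨h1, h2⟩ ⟨h3, h4⟩
    rw [← e] at h4
    exact ⟨by rw [c_mul, h1, h3]; omega, h2.comp h4⟩
  have k0 := key hαβ ⟨hc, hR⟩ ⟨hc', hR'⟩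
  refine tendsto_of k0.1 k0.2 ?_ ?_ ?_
  · refine ((continuous_r.tendsto α).comp hf).congr' ?_
    filter_upwards [hh] with y ⟨e, hy⟩
    rw [hy]; rfl
  · refine ((continuous_s.tendsto β).comp hg).congr' ?_
    filter_upwards [hh] with y ⟨e, hy⟩
    rw [hy]; rfl
  · filter_upwards [hh, hf (eventually_rel α hc hR), hg (eventually_rel β hc' hR')]
      with y ⟨e, hy⟩ h1 h2
    rw [hy]
    exact key e h1 h2

theorem continuous_inv : Continuous (inv : S.Groupoid → S.Groupoid) := by
  refine continuous_iff_continuousAt.2 fun γ => ?_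
  obtain ⟨n, m, hc, hR⟩ := γ.exists_rel
  refine tendsto_of (n := m) (m := n) (by rw [c_inv, hc]; ring) hR.symm
    (continuous_s.tendsto γ) (continuous_r.tendsto γ) ?_
  filter_upwards [eventually_rel γ hc hR] with η h
  exact ⟨by rw [c_inv, h.1]; ring, h.2.symm⟩

theorem isOpenMap_r : IsOpenMap (r : S.Groupoid → X) := by
  classical
  refine IsOpenMap.of_nhds_le fun γ => ?_
  obtain ⟨n, m, hc, hR⟩ := γ.exists_rel
  obtain ⟨e, hye, he⟩ := S.isLocalHomeomorphOn_iter m γ.s hR.2.1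
  let y : X → X := fun x => e.symm (S.iter n x)
  let b : X → S.Groupoid := fun x =>
    if h : S.Rel n m x (y x) then ⟨(x, (n : ℤ) - m, y x), n, m, rfl, h⟩ else γ
  have hbx : ∀ x (h : S.Rel n m x (y x)), b x = ⟨(x, (n : ℤ) - m, y x), n, m, rfl, h⟩ :=
    fun x h => dif_pos h
  have hn := ((S.isLocalHomeomorphOn_iter n).continuousAt hR.1)
  have hγe : S.iter n γ.r = e γ.s := by rw [hR.2.2, he]
  have hty : Filter.Tendsto y (𝓝 γ.r) (𝓝 γ.s) := by
    have h1 : Filter.Tendsto e.symm (𝓝 (S.iter n γ.r)) (𝓝 γ.s) := by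
      rw [hγe]
      have := e.symm.continuousAt (x := e γ.s) (e.map_source hye)
      rwa [ContinuousAt, e.left_inv hye] at this
    exact h1.comp hn
  have hev : ∀ᶠ x in 𝓝 γ.r, S.Rel n m x (y x) := by
    filter_upwards [(S.isOpen_domIter n).mem_nhds hR.1,
      hty ((S.isOpen_domIter m).mem_nhds hR.2.1),
      hn (e.open_target.mem_nhds (by rw [hγe]; exact e.map_source hye))] with x h1 h2 h3
    refine ⟨h1, h2, ?_⟩
    rw [he]
    exact (e.right_inv h3).symm
  have hb : Filter.Tendsto b (𝓝 γ.r) (𝓝 γ) := by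
    refine tendsto_of hc hR ?_ ?_ ?_
    · refine Filter.tendsto_id.congr' ?_
      filter_upwards [hev] with x hx
      rw [hbx x hx]; rfl
    · refine hty.congr' ?_
      filter_upwards [hev] with x hx
      rw [hbx x hx]; rfl
    · filter_upwards [hev] with x hx
      rw [hbx x hx]
      exact ⟨rfl, hx⟩
  intro W hW
  have := hb (Filter.mem_map.1 hW)
  filter_upwards [this, hev] with x hx hx'
  have hx2 : (b x).r ∈ W := hx
  rw [hbx x hx'] at hx2
  exact hx2

theorem isLocalHomeomorph_r : IsLocalHomeomorph (r : S.Groupoid → X) := by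
  rw [isLocalHomeomorph_iff_isOpenEmbedding_restrict]
  intro γ
  obtain ⟨n, m, hc, hR⟩ := γ.exists_rel
  obtain ⟨N, hN, hγ, hinj, -⟩ := exists_nhds γ hc hR Filter.univ_mem Filter.univ_mem
  exact ⟨N, hN.mem_nhds hγ, .of_continuous_injective_isOpenMap
    (continuous_r.comp continuous_subtype_val) (injOn_iff_injective.1 hinj)
    (isOpenMap_r.comp hN.isOpenMap_subtype_val)⟩

instance [T2Space X] : T2Space S.Groupoid :=
  T2Space.of_injective_continuous (f := fun γ : S.Groupoid => (γ.r, γ.c, γ.s))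
    (fun _ _ h => Subtype.ext h)
    (continuous_r.prodMk (continuous_c.prodMk continuous_s))

instance [LocallyCompactSpace X] : LocallyCompactSpace S.Groupoid := by
  let _ : ChartedSpace X S.Groupoid :=
    { atlas := univ
      chartAt := fun γ => (isLocalHomeomorph_r γ).choose
      mem_chart_source := fun γ => (isLocalHomeomorph_r γ).choose_spec.1
      chart_mem_atlas := fun _ => trivial }
  exact ChartedSpace.locallyCompactSpace X S.Groupoid

theorem isOpen_units : IsOpen (units S) := by
  rw [isOpen_iff_mem_nhds]
  intro γ hγ
  obtain ⟨h0, h1⟩ := mem_units.1 hγ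
  filter_upwards [eventually_rel γ (n := 0) (m := 0) (by simpa using h0) ⟨trivial, trivial, h1⟩]
    with η hη
  exact mem_units.2 ⟨by simpa using hη.1, hη.2.2.2⟩

end Groupoid
end DeaconuRenaultSystem
end DeaconuRenault

/-! ### The groupoid C*-algebra of a Deaconu-Renault system -/

section GroupoidAlgebra

universe u v

namespace DeaconuRenaultSystem

open Groupoid

variable {X : Type u} [TopologicalSpace X] (S : DeaconuRenaultSystem X)

/-- The continuous compactly supported functions on the groupoid. -/
def convSubmodule : Submodule ℂ (S.Groupoid → ℂ) where
  carrier := {f | Continuous f ∧ HasCompactSupport f}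
  add_mem' hf hg := ⟨hf.1.add hg.1, hf.2.add hg.2⟩
  zero_mem' := ⟨continuous_zero, HasCompactSupport.zero⟩
  smul_mem' c _ hf := ⟨hf.1.const_smul c, hf.2.smul_left (f := fun _ => c)⟩

/-- The space `C_c(Γ)` of continuous compactly supported complex functions on the groupoid
`Γ = Γ(X, σ)`; below it is made a *-algebra under convolution. -/
def ConvAlg : Type u := S.convSubmodule

namespace ConvAlg

variable {S}

instance : AddCommGroup S.ConvAlg := inferInstanceAs (AddCommGroup S.convSubmodule)
instance : Module ℂ S.ConvAlg := inferInstanceAs (Module ℂ S.convSubmodule)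

instance : FunLike S.ConvAlg S.Groupoid ℂ where
  coe f := f.1
  coe_injective _ _ h := Subtype.ext h

theorem continuous (f : S.ConvAlg) : Continuous f := f.2.1
theorem hasCompactSupport (f : S.ConvAlg) : HasCompactSupport f := f.2.2

/-- A continuous compactly supported function, as an element of `C_c(Γ)`. -/
def mk (f : S.Groupoid → ℂ) (h : Continuous f) (h' : HasCompactSupport f) : S.ConvAlg :=
  ⟨f, h, h'⟩

@[simp] theorem mk_apply (f : S.Groupoid → ℂ) (h : Continuous f) (h' : HasCompactSupport f)
    (γ : S.Groupoid) : mk f h h' γ = f γ := rfl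
@[simp] theorem add_apply (f g : S.ConvAlg) (γ : S.Groupoid) : (f + g) γ = f γ + g γ := rfl
@[simp] theorem zero_apply (γ : S.Groupoid) : (0 : S.ConvAlg) γ = 0 := rfl
@[simp] theorem smul_apply (c : ℂ) (f : S.ConvAlg) (γ : S.Groupoid) : (c • f) γ = c * f γ := rfl

@[ext] theorem ext {f g : S.ConvAlg} (h : ∀ γ, f γ = g γ) : f = g := DFunLike.ext _ _ h

/-- The elements `η` with the same range as `γ`. -/
abbrev Fibre (γ : S.Groupoid) : Type u := {η : S.Groupoid // η.r = γ.r}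

/-- The product `η⁻¹ γ`. -/
def ldiv (γ : S.Groupoid) (η : Fibre γ) : S.Groupoid := η.1.inv.mul γ η.2

/-- The convolution product: `(f * g)(γ) = ∑ f(η) g(η⁻¹ γ)`, the sum over all `η` with
`r(η) = r(γ)`. -/
def convFun (f g : S.Groupoid → ℂ) (γ : S.Groupoid) : ℂ :=
  ∑ᶠ η : Fibre γ, f η.1 * g (ldiv γ η)

theorem finite_fibre (f : S.ConvAlg) (x : X) : {η : S.Groupoid | η.r = x ∧ f η ≠ 0}.Finite := by
  have key : (tsupport f ∩ {η | η.r = x}).Finite := by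
    refine f.hasCompactSupport.isCompact.induction_on (p := fun s => (s ∩ {η | η.r = x}).Finite)
      (by simp) (fun s t hst ht => ht.subset (inter_subset_inter_left _ hst))
      (fun s t hs ht => by rw [union_inter_distrib_right]; exact hs.union ht) fun η _ => ?_
    obtain ⟨e, he, her⟩ := isLocalHomeomorph_r η
    refine ⟨e.source, mem_nhdsWithin_of_mem_nhds (e.open_source.mem_nhds he), ?_⟩
    refine Set.Subsingleton.finite ?_
    rintro a ⟨ha, hax⟩ b ⟨hb, hbx⟩
    refine e.injOn ha hb ?_
    rw [← her]
    exact hax.trans hbx.symm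
  exact key.subset fun η hη => ⟨subset_tsupport _ hη.2, hη.1⟩

theorem finite_support (f : S.ConvAlg) (g : S.Groupoid → ℂ) (γ : S.Groupoid) :
    (Function.support fun η : Fibre γ => f η.1 * g (ldiv γ η)).Finite := by
  refine Set.Finite.subset ((finite_fibre f γ.r).preimage
    (Subtype.val_injective.injOn (s := univ) |>.mono (subset_univ _))) ?_
  intro η hη
  exact ⟨η.2, left_ne_zero_of_mul hη⟩

theorem convFun_add_left (f f' : S.ConvAlg) (g : S.Groupoid → ℂ) :
    convFun (f + f') g = convFun f g + convFun f' g := by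
  funext γ
  change _ = convFun f g γ + convFun f' g γ
  simp only [convFun, add_apply, add_mul]
  exact finsum_add_distrib (finite_support f g γ) (finite_support f' g γ)

theorem convFun_add_right (f : S.ConvAlg) (g g' : S.Groupoid → ℂ) :
    convFun f (g + g') = convFun f g + convFun f g' := by
  funext γ
  change _ = convFun f g γ + convFun f g' γ
  simp only [convFun, Pi.add_apply, mul_add]
  exact finsum_add_distrib (finite_support f g γ) (finite_support f g' γ)

/-- `f` is supported in an open set on which the range map is a homeomorphism. -/
def IsSmall (f : S.ConvAlg) : Prop :=
  ∃ e : OpenPartialHomeomorph S.Groupoid X, (r : S.Groupoid → X) = e ∧ tsupport f ⊆ e.source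

theorem IsSmall.eq {f : S.ConvAlg} (hf : IsSmall f) {α β : S.Groupoid} (hα : f α ≠ 0)
    (hβ : f β ≠ 0) (h : α.r = β.r) : α = β := by
  obtain ⟨e, he, hs⟩ := hf
  refine e.injOn (hs (subset_tsupport _ hα)) (hs (subset_tsupport _ hβ)) ?_
  rw [← he]; exact h

theorem convFun_small {f : S.ConvAlg} {e : OpenPartialHomeomorph S.Groupoid X}
    (he : (r : S.Groupoid → X) = e) (hs : tsupport f ⊆ e.source) (g : S.Groupoid → ℂ)
    {γ : S.Groupoid} (η : Fibre γ) (hη : η.1 ∈ e.source) :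
    convFun f g γ = f η.1 * g (ldiv γ η) := by
  refine finsum_eq_single _ η fun ζ hζ => ?_
  have : f ζ.1 = 0 := by
    by_contra h0
    refine hζ (Subtype.ext (e.injOn (hs (subset_tsupport _ h0)) hη ?_))
    rw [← he]
    exact ζ.2.trans η.2.symm
  rw [this, zero_mul]

theorem convFun_eq_zero {f g : S.Groupoid → ℂ} {γ : S.Groupoid}
    (h : ∀ η : S.Groupoid, η.r = γ.r → f η = 0) : convFun f g γ = 0 := by
  refine finsum_eq_zero_of_forall_eq_zero fun η => ?_
  rw [h η.1 η.2, zero_mul]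

/-- The involution `f*(γ) = conj (f(γ⁻¹))` on `C_c(Γ)`. -/
instance : Star S.ConvAlg :=
  ⟨fun f => mk (fun γ => star (f γ.inv)) (continuous_star.comp (f.continuous.comp Groupoid.continuous_inv))
    (by
      have h : HasCompactSupport (fun γ : S.Groupoid => f γ.inv) :=
        f.hasCompactSupport.comp_homeomorph
          { toFun := inv, invFun := inv, left_inv := Groupoid.inv_inv, right_inv := Groupoid.inv_inv
            continuous_toFun := Groupoid.continuous_inv
            continuous_invFun := Groupoid.continuous_inv }
      exact h.comp_left (g := star) (star_zero ℂ))⟩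

theorem star_apply (f : S.ConvAlg) (γ : S.Groupoid) : star f γ = star (f γ.inv) := rfl

theorem continuous_convFun_small [T2Space X] {f : S.ConvAlg} (hf : IsSmall f) (g : S.ConvAlg) :
    Continuous (convFun f g) := by
  classical
  obtain ⟨e, he, hs⟩ := hf
  have hre : ∀ γ : S.Groupoid, γ.r ∈ e.target → (e.symm γ.r).r = γ.r := fun γ hγ => by
    rw [congrFun he]; exact e.right_inv hγ
  refine continuous_iff_continuousAt.2 fun γ => ?_
  by_cases hγ : γ.r ∈ e.target
  · let D : S.Groupoid → S.Groupoid := fun ξ =>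
      if h : ξ.r ∈ e.target then ldiv ξ ⟨e.symm ξ.r, hre ξ h⟩ else γ
    have hD : ∀ ξ (h : ξ.r ∈ e.target), D ξ = ldiv ξ ⟨e.symm ξ.r, hre ξ h⟩ :=
      fun ξ h => dif_pos h
    have hev : ∀ᶠ ξ in 𝓝 γ, ξ.r ∈ e.target :=
      continuous_r.continuousAt (e.open_target.mem_nhds hγ)
    have hsec : Filter.Tendsto (fun ξ : S.Groupoid => e.symm ξ.r) (𝓝 γ) (𝓝 (e.symm γ.r)) :=
      (e.symm.continuousAt (x := γ.r) hγ).tendsto.comp (continuous_r.tendsto γ)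
    have hDt : Filter.Tendsto D (𝓝 γ) (𝓝 (D γ)) := by
      refine tendsto_mul (α := (e.symm γ.r).inv) (β := γ)
        ((Groupoid.continuous_inv.tendsto _).comp hsec) Filter.tendsto_id (hre γ hγ) (hD γ hγ) ?_
      filter_upwards [hev] with ξ hξ
      exact ⟨hre ξ hξ, hD ξ hξ⟩
    have hval : ∀ ξ : S.Groupoid, ξ.r ∈ e.target →
        convFun f g ξ = f (e.symm ξ.r) * g (D ξ) := fun ξ hξ => by
      rw [hD ξ hξ]
      exact convFun_small he hs g ⟨e.symm ξ.r, hre ξ hξ⟩ (e.map_target hξ)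
    rw [ContinuousAt, hval γ hγ]
    refine Filter.Tendsto.congr' (f₁ := fun ξ => f (e.symm ξ.r) * g (D ξ)) ?_
      (((f.continuous.tendsto _).comp hsec).mul ((g.continuous.tendsto _).comp hDt))
    filter_upwards [hev] with ξ hξ
    exact (hval ξ hξ).symm
  · have hK : IsClosed (r '' tsupport f) :=
      (f.hasCompactSupport.isCompact.image continuous_r).isClosed
    have hnot : γ.r ∉ r '' tsupport f := by
      rintro ⟨η, hη, hη'⟩
      refine hγ (hη' ▸ ?_)
      rw [he]
      exact e.map_source (hs hη)
    have hev : ∀ᶠ ξ in 𝓝 γ, ξ.r ∉ r '' tsupport f :=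
      continuous_r.continuousAt (hK.isOpen_compl.mem_nhds hnot)
    have hz : ∀ ξ : S.Groupoid, ξ.r ∉ r '' tsupport f → convFun f g ξ = 0 := fun ξ hξ =>
      convFun_eq_zero fun η hη => by
        by_contra h0
        exact hξ ⟨η, subset_tsupport _ h0, hη⟩
    rw [ContinuousAt, hz γ hnot]
    refine tendsto_const_nhds.congr' ?_
    filter_upwards [hev] with ξ hξ
    exact (hz ξ hξ).symm

theorem hasCompactSupport_convFun [T2Space X] (f g : S.ConvAlg) : HasCompactSupport (convFun f g) := by
  let C := {p : S.Groupoid × S.Groupoid // p.1.s = p.2.r}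
  have hC : IsClosed {p : S.Groupoid × S.Groupoid | p.1.s = p.2.r} :=
    isClosed_eq (continuous_s.comp continuous_fst) (continuous_r.comp continuous_snd)
  let M : C → S.Groupoid := fun p => p.1.1.mul p.1.2 p.2
  have hM : Continuous M := by
    refine continuous_iff_continuousAt.2 fun p => ?_
    exact tendsto_mul ((continuous_fst.comp continuous_subtype_val).tendsto p)
      ((continuous_snd.comp continuous_subtype_val).tendsto p) p.2 rfl
      (Filter.Eventually.of_forall fun q => ⟨q.2, rfl⟩)
  have hK : IsCompact ((Subtype.val : C → _) ⁻¹' (tsupport f ×ˢ tsupport g)) :=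
    hC.isClosedEmbedding_subtypeVal.isCompact_preimage
      (f.hasCompactSupport.isCompact.prod g.hasCompactSupport.isCompact)
  refine HasCompactSupport.intro (hK.image hM) fun γ hγ => ?_
  refine finsum_eq_zero_of_forall_eq_zero fun η => ?_
  by_contra h0
  refine hγ ⟨⟨(η.1, ldiv γ η), rfl⟩, ⟨subset_tsupport _ (left_ne_zero_of_mul h0),
    subset_tsupport _ (right_ne_zero_of_mul h0)⟩, ?_⟩
  refine Groupoid.ext η.2 ?_ rfl
  change η.1.c + (-η.1.c + γ.c) = γ.c
  ring

variable [T2Space X] [LocallyCompactSpace X]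

/-- Every element of `C_c(Γ)` is a finite sum of elements that are supported in an open set on
which the range map is a homeomorphism. -/
theorem induction_small {P : S.ConvAlg → Prop} (h0 : P 0)
    (hadd : ∀ f g, P f → P g → P (f + g)) (hs : ∀ f, IsSmall f → P f) (f : S.ConvAlg) : P f := by
  choose e he her using fun η : S.Groupoid => isLocalHomeomorph_r η
  obtain ⟨t, ht⟩ := f.hasCompactSupport.isCompact.elim_finite_subcover
    (fun η => (e η).source) (fun η => (e η).open_source)
    fun η _ => mem_iUnion.2 ⟨η, he η⟩
  let q := t.equivFin
  obtain ⟨φ, hφ, hφ1, -, -⟩ := exists_continuous_sum_one_of_isOpen_isCompact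
    (s := fun i => (e (q.symm i).1).source) (fun i => (e _).open_source)
    f.hasCompactSupport.isCompact (fun η hη => by
      obtain ⟨ζ, hζ, hη⟩ := mem_iUnion₂.1 (ht hη)
      exact mem_iUnion.2 ⟨q ⟨ζ, hζ⟩, by simpa using hη⟩)
  let F : Fin t.card → S.ConvAlg := fun i =>
    mk (fun γ => (φ i γ : ℂ) * f γ)
      ((Complex.continuous_ofReal.comp (φ i).continuous).mul f.continuous)
      (f.hasCompactSupport.mul_left)
  have hF : f = ∑ i, F i := by
    ext γ
    have hsum : (∑ i, F i) γ = ∑ i, F i γ := by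
      induction (Finset.univ : Finset (Fin t.card)) using Finset.cons_induction with
      | empty => rfl
      | cons a s ha ih => rw [Finset.sum_cons, Finset.sum_cons, add_apply, ih]
    rw [hsum]
    simp only [F, mk_apply]
    rw [← Finset.sum_mul]
    by_cases hγ : f γ = 0
    · simp [hγ]
    · have := hφ1 (subset_tsupport _ hγ)
      simp only [Finset.sum_apply, Pi.one_apply] at this
      rw [← Complex.ofReal_sum, this]
      simp
  have hPF : ∀ i, P (F i) := fun i => hs _ ⟨e (q.symm i).1, her _,
    (closure_mono fun γ hγ => by
      have : φ i γ ≠ 0 := fun h => hγ (by simp [F, h])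
      exact this).trans (hφ i)⟩
  rw [hF]
  exact Finset.sum_induction F P hadd h0 fun i _ => hPF i

theorem continuous_convFun (f g : S.ConvAlg) : Continuous (convFun f g) := by
  induction f using induction_small with
  | h0 =>
    have : convFun (0 : S.ConvAlg) g = 0 := by
      funext γ; exact convFun_eq_zero fun _ _ => rfl
    rw [this]; exact continuous_zero
  | hadd f f' h h' =>
    have : convFun (⇑(f + f')) g = convFun f g + convFun f' g := convFun_add_left f f' g
    rw [this]; exact h.add h'
  | hs f hf => exact continuous_convFun_small hf g

/-- The convolution product on `C_c(Γ)`. -/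
instance : Mul S.ConvAlg :=
  ⟨fun f g => mk (convFun f g) (continuous_convFun f g) (hasCompactSupport_convFun f g)⟩

theorem mul_apply (f g : S.ConvAlg) (γ : S.Groupoid) :
    (f * g) γ = ∑ᶠ η : Fibre γ, f η.1 * g (ldiv γ η) := rfl

theorem zero_mul_aux (f : S.ConvAlg) : 0 * f = 0 := by
  ext γ; exact convFun_eq_zero fun _ _ => rfl

theorem add_mul_aux (f g h : S.ConvAlg) : (f + g) * h = f * h + g * h := by
  ext γ; exact congrFun (convFun_add_left f g h) γ

theorem mul_add_aux (f g h : S.ConvAlg) : f * (g + h) = f * g + f * h := by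
  ext γ; exact congrFun (convFun_add_right f g h) γ

/-- Translation by `η` identifies the fibre of `η⁻¹ γ` with that of `γ`. -/
def fibreEquiv (γ : S.Groupoid) (η : Fibre γ) : Fibre (ldiv γ η) ≃ Fibre γ where
  toFun ζ := ⟨η.1.mul ζ.1 ζ.2.symm, η.2⟩
  invFun ξ := ⟨η.1.inv.mul ξ.1 (η.2.trans ξ.2.symm), rfl⟩
  left_inv ζ := Subtype.ext (Groupoid.ext ζ.2.symm
    (show -η.1.c + (η.1.c + ζ.1.c) = ζ.1.c by ring) rfl)
  right_inv ξ := Subtype.ext (Groupoid.ext (η.2.trans ξ.2.symm)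
    (show η.1.c + (-η.1.c + ξ.1.c) = ξ.1.c by ring) rfl)

theorem mul_assoc_aux (f g h : S.ConvAlg) : f * g * h = f * (g * h) := by
  induction f using induction_small with
  | h0 => simp only [zero_mul_aux]
  | hadd f f' h1 h2 => simp only [add_mul_aux, h1, h2]
  | hs f hf =>
    obtain ⟨e, he, hs⟩ := hf
    ext γ
    by_cases hγ : ∃ η : Fibre γ, η.1 ∈ e.source
    · obtain ⟨η, hη⟩ := hγ
      have e1 : (f * (g * h)) γ = f η.1 * (g * h) (ldiv γ η) := convFun_small he hs _ η hη
      have e2 : ∀ ξ : Fibre γ, (f * g) ξ.1 = f η.1 * g (ldiv ξ.1 ⟨η.1, η.2.trans ξ.2.symm⟩) :=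
        fun ξ => convFun_small he hs _ ⟨η.1, η.2.trans ξ.2.symm⟩ hη
      rw [e1, mul_apply, mul_apply]
      simp only [e2, mul_assoc]
      rw [← mul_finsum]
      · congr 1
        refine (finsum_eq_of_bijective (fibreEquiv γ η) (fibreEquiv γ η).bijective fun ζ => ?_).symm
        have a1 : ldiv ((fibreEquiv γ η) ζ).1 ⟨η.1, η.2.trans ((fibreEquiv γ η) ζ).2.symm⟩ = ζ.1 :=
          Groupoid.ext ζ.2.symm (show -η.1.c + (η.1.c + ζ.1.c) = ζ.1.c by ring) rfl
        have a2 : ldiv γ ((fibreEquiv γ η) ζ) = ldiv (ldiv γ η) ζ :=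
          Groupoid.ext rfl
            (show -(η.1.c + ζ.1.c) + γ.c = -ζ.1.c + (-η.1.c + γ.c) by ring) rfl
        rw [a1, a2]
    · have hz : ∀ η : S.Groupoid, η.r = γ.r → f η = 0 := fun η hη => by
        by_contra h0
        exact hγ ⟨⟨η, hη⟩, hs (subset_tsupport _ h0)⟩
      have e1 : (f * (g * h)) γ = 0 := convFun_eq_zero hz
      rw [e1]
      refine convFun_eq_zero fun η hη => convFun_eq_zero fun ξ hξ => hz ξ (hξ.trans hη)

instance : NonUnitalRing S.ConvAlg :=
  { (inferInstance : AddCommGroup S.ConvAlg), (inferInstance : Mul S.ConvAlg) with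
    zero_mul := zero_mul_aux
    mul_zero := fun f => by
      ext γ
      rw [mul_apply]
      simp
    mul_assoc := mul_assoc_aux
    left_distrib := mul_add_aux
    right_distrib := add_mul_aux }

/-- The bijection `ζ ↦ γ⁻¹ ζ` of the fibre of `γ` with that of `γ⁻¹`. -/
def fibreInvEquiv (γ : S.Groupoid) : Fibre γ ≃ Fibre γ.inv where
  toFun ζ := ⟨γ.inv.mul ζ.1 ζ.2.symm, rfl⟩
  invFun ξ := ⟨γ.mul ξ.1 ξ.2.symm, rfl⟩
  left_inv ζ := Subtype.ext (Groupoid.ext ζ.2.symm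
    (show γ.c + (-γ.c + ζ.1.c) = ζ.1.c by ring) rfl)
  right_inv ξ := Subtype.ext (Groupoid.ext ξ.2.symm
    (show -γ.c + (γ.c + ξ.1.c) = ξ.1.c by ring) rfl)

instance : StarRing S.ConvAlg where
  star_involutive f := by ext γ; simp [star_apply]
  star_add f g := by ext γ; simp [star_apply]
  star_mul f g := by
    ext γ
    rw [star_apply, mul_apply, mul_apply]
    have hst : star (∑ᶠ η : Fibre γ.inv, f η.1 * g (ldiv γ.inv η)) =
        ∑ᶠ η : Fibre γ.inv, star (f η.1 * g (ldiv γ.inv η)) :=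
      (starAddEquiv : ℂ ≃+ ℂ).toAddMonoidHom.map_finsum (finite_support f g γ.inv)
    rw [hst]
    refine (finsum_eq_of_bijective (fibreInvEquiv γ) (fibreInvEquiv γ).bijective fun ζ => ?_).symm
    have a1 : ldiv γ.inv (fibreInvEquiv γ ζ) = ζ.1.inv :=
      Groupoid.ext rfl (show -(-γ.c + ζ.1.c) + -γ.c = -ζ.1.c by ring) ζ.2.symm
    have a2 : (ldiv γ ζ).inv = (fibreInvEquiv γ ζ).1 :=
      Groupoid.ext rfl (show -(-ζ.1.c + γ.c) = -γ.c + ζ.1.c by ring) rfl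
    rw [a1, star_apply, star_apply, a2, star_mul']
    ring

instance : StarModule ℂ S.ConvAlg where
  star_smul c f := by ext γ; simp [star_apply]

instance : IsScalarTower ℂ S.ConvAlg S.ConvAlg where
  smul_assoc c f g := by
    ext γ
    simp only [smul_eq_mul, smul_apply, mul_apply, mul_assoc]
    exact (mul_finsum _ _).symm

instance : SMulCommClass ℂ S.ConvAlg S.ConvAlg where
  smul_comm c f g := by
    ext γ
    simp only [smul_eq_mul, smul_apply, mul_apply, mul_left_comm _ c]
    exact mul_finsum _ _

theorem mul_apply_of_units {a b : S.ConvAlg} (ha : ∀ γ, γ ∉ units S → a γ = 0)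
    (hb : ∀ γ, γ ∉ units S → b γ = 0) (γ : S.Groupoid) : (a * b) γ = a γ * b γ := by
  rw [mul_apply, finsum_eq_single _ (⟨unit γ.r, rfl⟩ : Fibre γ)]
  · have h1 : ldiv γ ⟨unit γ.r, rfl⟩ = γ := Groupoid.ext rfl (show -0 + γ.c = γ.c by ring) rfl
    rw [h1]
    by_cases hγ : γ ∈ units S
    · obtain ⟨x, rfl⟩ := hγ; rfl
    · rw [hb γ hγ, mul_zero, mul_zero]
  · intro η hη
    rw [ha η.1, zero_mul]
    rintro ⟨x, hx⟩
    have hxr : x = γ.r := by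
      have := η.2
      rw [← hx] at this
      exact this
    exact hη (Subtype.ext (hx.symm.trans (congrArg Groupoid.unit hxr)))

theorem star_mul_self_apply_of_small {f : S.ConvAlg} (hf : IsSmall f) (γ : S.Groupoid)
    (hγ : γ ∉ units S) : (star f * f) γ = 0 := by
  rw [mul_apply]
  refine finsum_eq_zero_of_forall_eq_zero fun η => ?_
  by_contra h0
  have h1 : f η.1.inv ≠ 0 := fun h => left_ne_zero_of_mul h0 (by rw [star_apply, h, star_zero])
  have h2 := hf.eq h1 (right_ne_zero_of_mul h0) rfl
  refine hγ (mem_units.2 ⟨?_, ?_⟩)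
  · have : -η.1.c = -η.1.c + γ.c := congrArg c h2
    linarith
  · have : η.1.r = γ.s := congrArg s h2
    rw [← this, η.2]

theorem bddAbove_of_small {f : S.ConvAlg} (hf : IsSmall f) :
    BddAbove (range fun p : CStarSeminorm S.ConvAlg => p f) := by
  set h : S.ConvAlg := star f * f with hh
  have hstar : star h = h := by rw [hh, star_mul, star_star]
  have hu : ∀ γ, γ ∉ units S → h γ = 0 := star_mul_self_apply_of_small hf
  have hreal : ∀ γ, star (h γ) = h γ := fun γ => by
    by_cases hγ : γ ∈ units S
    · obtain ⟨x, rfl⟩ := hγ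
      have : star h (unit x) = h (unit x) := by rw [hstar]
      rw [star_apply] at this
      exact this
    · rw [hu γ hγ, star_zero]
  obtain ⟨C, hC⟩ := h.hasCompactSupport.exists_bound_of_continuous h.continuous
  set c : ℝ := max C 0
  have hc : ∀ γ, ‖h γ‖ ≤ c := fun γ => (hC γ).trans (le_max_left _ _)
  have hc0 : 0 ≤ c := le_max_right _ _
  let w : S.Groupoid → ℝ := fun γ => Real.sqrt (c ^ 2 - ‖h γ‖ ^ 2)
  have hw : Continuous w := by
    have := h.continuous
    exact Real.continuous_sqrt.comp (by fun_prop)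
  let u : S.ConvAlg := mk (fun γ => h γ * (h γ + Complex.I * (w γ : ℂ)))
    (h.continuous.mul (h.continuous.add
      (continuous_const.mul (Complex.continuous_ofReal.comp hw)))) h.hasCompactSupport.mul_right
  have hu' : ∀ γ, γ ∉ units S → u γ = 0 := fun γ hγ => by simp [u, hu γ hγ]
  have hsu : ∀ γ, star u γ = h γ * (h γ - Complex.I * (w γ : ℂ)) := fun γ => by
    by_cases hγ : γ ∈ units S
    · obtain ⟨x, rfl⟩ := hγ
      change star (u (unit x)) = _
      simp only [u, mk_apply, star_mul', star_add, hreal]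
      simp only [RCLike.star_def, Complex.conj_I, Complex.conj_ofReal]
      ring
    · have : γ.inv ∉ units S := fun h' => hγ <| by
        obtain ⟨h1, h2⟩ := mem_units.1 h'
        exact mem_units.2 ⟨by simpa using h1, h2.symm⟩
      rw [star_apply, hu' _ this, hu γ hγ, star_zero, zero_mul]
  have hsu' : ∀ γ, γ ∉ units S → star u γ = 0 := fun γ hγ => by rw [hsu, hu γ hγ, zero_mul]
  have hw2 : ∀ γ, (w γ : ℂ) ^ 2 = (c : ℂ) ^ 2 - h γ ^ 2 := fun γ => by
    have e1 : w γ ^ 2 = c ^ 2 - ‖h γ‖ ^ 2 := Real.sq_sqrt (by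
      have := pow_le_pow_left₀ (norm_nonneg _) (hc γ) 2
      linarith)
    have e2 : ((‖h γ‖ : ℝ) : ℂ) ^ 2 = h γ ^ 2 := by
      have := RCLike.mul_conj (K := ℂ) (h γ)
      rw [← RCLike.star_def, hreal] at this
      rw [sq (h γ), this]; rfl
    rw [← e2, ← Complex.ofReal_pow, e1]
    push_cast
    ring
  have key : ∀ p : CStarSeminorm S.ConvAlg, p h ≤ c := fun p => by
    refine p.le_of_unitary_trick (u := u) hc0 hstar ?_ ?_
    · ext γ
      rw [add_apply, hsu, smul_apply, mul_apply_of_units hu hu]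
      simp only [u, mk_apply]
      ring
    · ext γ
      rw [mul_apply_of_units hsu' hu', hsu, smul_apply, mul_apply_of_units hu hu]
      simp only [u, mk_apply]
      linear_combination (-(h γ) ^ 2 * (w γ : ℂ) ^ 2) * Complex.I_sq + (h γ) ^ 2 * hw2 γ
  refine ⟨Real.sqrt c, ?_⟩
  rintro _ ⟨p, rfl⟩
  refine Real.le_sqrt_of_sq_le ?_
  rw [← p.star_mul_self]
  exact key p

instance : HasCStarEnvelope S.ConvAlg where
  bddAbove f := by
    induction f using induction_small with
    | h0 => exact ⟨0, by rintro _ ⟨p, rfl⟩; simp⟩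
    | hadd f g hf hg =>
      obtain ⟨a, ha⟩ := hf
      obtain ⟨b, hb⟩ := hg
      refine ⟨a + b, ?_⟩
      rintro _ ⟨p, rfl⟩
      exact (map_add_le_add p.toSeminorm f g).trans
        (add_le_add (ha ⟨p, rfl⟩) (hb ⟨p, rfl⟩))
    | hs f hf => exact bddAbove_of_small hf

/-- The *-homomorphism `γ_z` of `C_c(Γ)` given by `γ_z(f)(x, k, y) = z ^ k f(x, k, y)`. -/
def gaugeHom (z : Circle) : S.ConvAlg →⋆ₙₐ[ℂ] S.ConvAlg where
  toFun f := mk (fun γ => ((z ^ γ.c : Circle) : ℂ) * f γ)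
    (((continuous_of_discreteTopology (f := fun k : ℤ => ((z ^ k : Circle) : ℂ))).comp
      continuous_c).mul f.continuous) f.hasCompactSupport.mul_left
  map_smul' a f := by ext γ; simp only [mk_apply, smul_apply, MonoidHom.id_apply]; ring
  map_zero' := by ext γ; simp
  map_add' f g := by ext γ; simp only [mk_apply, add_apply]; ring
  map_mul' f g := by
    ext γ
    simp only [mk_apply, mul_apply, mul_finsum]
    refine finsum_congr fun η => ?_
    have h1 : γ.c = η.1.c + (ldiv γ η).c := show γ.c = η.1.c + (-η.1.c + γ.c) by ring
    rw [h1, zpow_add, Circle.coe_mul]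
    ring
  map_star' f := by
    ext γ
    simp only [mk_apply, star_apply, star_mul', c_inv, zpow_neg]
    congr 1
    rw [Circle.coe_inv_eq_conj]
    simp

theorem gaugeHom_apply (z : Circle) (f : S.ConvAlg) (γ : S.Groupoid) :
    gaugeHom z f γ = ((z ^ γ.c : Circle) : ℂ) * f γ := rfl

end ConvAlg

variable [T2Space X] [LocallyCompactSpace X]

/-- The (full) groupoid C*-algebra `C*(Γ(X, σ))`: the completion of the convolution algebra
`C_c(Γ(X, σ))` in its largest C*-seminorm. -/
abbrev GroupoidCStarAlgebra : Type u := EnvelopingCStarAlgebra S.ConvAlg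

/-- The copy of `C₀(X)` in `C*(Γ(X, σ))`: the closure of the functions in `C_c(Γ(X, σ))` that are
supported in the (open) unit space `{(x, 0, x)}`, which is identified with `X`. -/
def diagonal : Set S.GroupoidCStarAlgebra :=
  closure (EnvelopingCStarAlgebra.of '' {f : S.ConvAlg | ∀ γ, γ ∉ units S → f γ = 0})

/-- The canonical gauge action `γ` of the circle on `C*(Γ(X, σ))`, determined by
`γ_z(f)(x, k, y) = z ^ k f(x, k, y)` for `f ∈ C_c(Γ(X, σ))`. -/
def gaugeAction : Circle →* (S.GroupoidCStarAlgebra ≃⋆ₐ[ℂ] S.GroupoidCStarAlgebra) :=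
  EnvelopingCStarAlgebra.extendAction ConvAlg.gaugeHom
    (fun f => by ext γ; simp [ConvAlg.gaugeHom_apply])
    (fun z w f => by ext γ; simp [ConvAlg.gaugeHom_apply, mul_zpow, mul_assoc])

theorem gaugeAction_of (z : Circle) (f : S.ConvAlg) :
    S.gaugeAction z (EnvelopingCStarAlgebra.of f) =
      EnvelopingCStarAlgebra.of (ConvAlg.gaugeHom z f) :=
  EnvelopingCStarAlgebra.extendAction_of _ _ _ z f

end DeaconuRenaultSystem
end GroupoidAlgebra

/-! ### Partial actions and their crossed products -/

section PartialActions

universe u v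

/-- A partial action of a group `G` on a topological space `X`: open sets `U g` and homeomorphisms
`φ g : U g⁻¹ → U g`, subject to the usual conditions.  (The values of `φ g` off `U g⁻¹` are
irrelevant.) -/
structure PartialAction (G : Type u) [Group G] (X : Type v) [TopologicalSpace X] where
  U : G → Set X
  φ : G → OpenPartialHomeomorph X X
  source_eq : ∀ g, (φ g).source = U g⁻¹
  target_eq : ∀ g, (φ g).target = U g
  U_one : U 1 = univ
  one_apply : ∀ x, φ 1 x = x
  image_inter : ∀ g₁ g₂, φ g₂ '' (U (g₁ * g₂)⁻¹ ∩ U g₂⁻¹) = U g₂ ∩ U g₁⁻¹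
  mul_apply : ∀ g₁ g₂ x, x ∈ U g₂⁻¹ ∩ U (g₁ * g₂)⁻¹ → φ (g₁ * g₂) x = φ g₁ (φ g₂ x)

/-- The functions in `C₀(U)`, for an open subset `U` of `X`, extended by zero to `X`: the
continuous functions on `X` that vanish at infinity and off `U`. -/
def C0On {X : Type v} [TopologicalSpace X] (U : Set X) : Submodule ℂ (X → ℂ) where
  carrier := {f | Continuous f ∧ Filter.Tendsto f (Filter.cocompact X) (𝓝 0) ∧ ∀ x, x ∉ U → f x = 0}
  add_mem' hf hg := ⟨hf.1.add hg.1, by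
    have := hf.2.1.add hg.2.1
    rwa [add_zero] at this, fun x hx => by
    simp [hf.2.2 x hx, hg.2.2 x hx]⟩
  zero_mem' := ⟨continuous_zero, tendsto_const_nhds, fun _ _ => rfl⟩
  smul_mem' c f hf := ⟨hf.1.const_smul c, by
    have := hf.2.1.const_smul c
    rwa [smul_zero] at this, fun x hx => by
    simp [hf.2.2 x hx]⟩

namespace C0On

variable {X : Type v} [TopologicalSpace X] {U : Set X}

theorem exists_bound {f : X → ℂ} (hf : f ∈ C0On U) : ∃ c : ℝ, 0 ≤ c ∧ ∀ x, ‖f x‖ ≤ c := by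
  let F : C₀(X, ℂ) := ⟨⟨f, hf.1⟩, hf.2.1⟩
  refine ⟨‖F.toBCF‖, norm_nonneg _, fun x => F.toBCF.norm_coe_le_norm x⟩

theorem of_norm_le {f a : X → ℂ} {B : ℝ} (ha : a ∈ C0On U) (hle : ∀ x, ‖f x‖ ≤ ‖a x‖ * B)
    (hU : IsOpen U) (hc : ContinuousOn f U) : f ∈ C0On U := by
  have hz : ∀ x, x ∉ U → f x = 0 := fun x hx => by
    have := hle x
    rw [ha.2.2 x hx, norm_zero, zero_mul] at this
    exact norm_le_zero_iff.1 this
  refine ⟨continuous_iff_continuousAt.2 fun x => ?_, ?_, hz⟩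
  · by_cases hx : x ∈ U
    · exact hc.continuousAt (hU.mem_nhds hx)
    · rw [ContinuousAt, hz x hx]
      refine squeeze_zero_norm hle ?_
      have : Filter.Tendsto (fun x => ‖a x‖ * B) (𝓝 x) (𝓝 (‖a x‖ * B)) :=
        (ha.1.norm.mul continuous_const).tendsto x
      rwa [ha.2.2 x hx, norm_zero, zero_mul] at this
  · refine squeeze_zero_norm hle ?_
    simpa using ha.2.1.norm.mul_const B

theorem of_isCompact [T2Space X] {f : X → ℂ} (hU : IsOpen U) (hc : ContinuousOn f U)
    (hz : ∀ x, x ∉ U → f x = 0) (hK : ∀ ε > 0, IsCompact {x | ε ≤ ‖f x‖}) : f ∈ C0On U := by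
  refine ⟨continuous_iff_continuousAt.2 fun x => ?_, ?_, hz⟩
  · by_cases hx : x ∈ U
    · exact hc.continuousAt (hU.mem_nhds hx)
    · rw [ContinuousAt, hz x hx, Metric.tendsto_nhds]
      intro ε hε
      have : x ∈ {x | ε ≤ ‖f x‖}ᶜ := by
        intro h
        have h' : ε ≤ ‖f x‖ := h
        rw [hz x hx, norm_zero] at h'
        linarith
      filter_upwards [(hK ε hε).isClosed.isOpen_compl.mem_nhds this] with y hy
      rw [dist_zero_right]
      exact not_le.1 hy
  · rw [Metric.tendsto_nhds]
    intro ε hε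
    filter_upwards [(hK ε hε).compl_mem_cocompact] with y hy
    rw [dist_zero_right]
    exact not_le.1 hy

theorem isCompact_le {f : X → ℂ} (hf : f ∈ C0On U) {ε : ℝ} (hε : 0 < ε) :
    IsCompact {x | ε ≤ ‖f x‖} := by
  have h1 : {x | ε ≤ ‖f x‖}ᶜ ∈ Filter.cocompact X := by
    filter_upwards [Metric.tendsto_nhds.1 hf.2.1 ε hε] with x hx
    rw [dist_zero_right] at hx
    exact not_le.2 hx
  obtain ⟨K, hK, hsub⟩ := Filter.mem_cocompact.1 h1
  exact hK.of_isClosed_subset (isClosed_le continuous_const hf.1.norm)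
    (compl_subset_compl.1 hsub)

end C0On

namespace PartialAction

variable {G : Type u} [Group G] {X : Type v} [TopologicalSpace X] (P : PartialAction G X)

theorem isOpen_U (g : G) : IsOpen (P.U g) := P.target_eq g ▸ (P.φ g).open_target

theorem map_mem {g : G} {x : X} (hx : x ∈ P.U g⁻¹) : P.φ g x ∈ P.U g := by
  rw [← P.target_eq]
  exact (P.φ g).map_source (by rwa [P.source_eq])

theorem map_mem' {g : G} {x : X} (hx : x ∈ P.U g) : P.φ g⁻¹ x ∈ P.U g⁻¹ :=
  P.map_mem (by rwa [inv_inv])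

theorem mem_comp {g h : G} {x : X} (hx : x ∈ P.U g⁻¹) (hx' : P.φ g x ∈ P.U h⁻¹) :
    x ∈ P.U (h * g)⁻¹ := by
  have : P.φ g x ∈ P.φ g '' (P.U (h * g)⁻¹ ∩ P.U g⁻¹) := by
    rw [P.image_inter]; exact ⟨P.map_mem hx, hx'⟩
  obtain ⟨y, hy, hyx⟩ := this
  have := (P.φ g).injOn (by rw [P.source_eq]; exact hy.2) (by rwa [P.source_eq]) hyx
  exact this ▸ hy.1

theorem comp_apply {g h : G} {x : X} (hx : x ∈ P.U g⁻¹) (hx' : P.φ g x ∈ P.U h⁻¹) :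
    P.φ (h * g) x = P.φ h (P.φ g x) := P.mul_apply h g x ⟨hx, P.mem_comp hx hx'⟩

theorem mem_one (x : X) : x ∈ P.U 1 := by rw [P.U_one]; trivial

theorem inv_apply {g : G} {x : X} (hx : x ∈ P.U g⁻¹) : P.φ g⁻¹ (P.φ g x) = x := by
  rw [← P.mul_apply g⁻¹ g x ⟨hx, by rw [inv_mul_cancel, inv_one]; exact P.mem_one x⟩,
    inv_mul_cancel, P.one_apply]

theorem apply_inv {g : G} {x : X} (hx : x ∈ P.U g) : P.φ g (P.φ g⁻¹ x) = x := by
  have := P.inv_apply (g := g⁻¹) (x := x) (by rwa [inv_inv])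
  rwa [inv_inv] at this

theorem continuousOn (g : G) : ContinuousOn (P.φ g⁻¹) (P.U g) := by
  have := (P.φ g⁻¹).continuousOn
  rwa [P.source_eq, inv_inv] at this

/-- The finitely supported families `(f_g)` with `f_g ∈ C₀(U_g)`. -/
def crossedSubmodule : Submodule ℂ (G → X → ℂ) where
  carrier := {F | {g | F g ≠ 0}.Finite ∧ ∀ g, F g ∈ C0On (P.U g)}
  add_mem' {F H} hF hH := ⟨(hF.1.union hH.1).subset fun g hg => by
      by_contra h
      simp only [mem_union, mem_ofPred_eq, not_or, not_not] at h
      exact hg (by simp [h.1, h.2]), fun g => (C0On (P.U g)).add_mem (hF.2 g) (hH.2 g)⟩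
  zero_mem' := ⟨by simp, fun g => (C0On (P.U g)).zero_mem⟩
  smul_mem' c F hF := ⟨hF.1.subset fun g hg h => hg (by simp [h]),
    fun g => (C0On (P.U g)).smul_mem c (hF.2 g)⟩

/-- The algebraic partial crossed product: the space `⨁_g C₀(U_g) δ_g` of finite sums
`∑ f_g δ_g`, `f_g ∈ C₀(U_g)`; below it is made a *-algebra. -/
def AlgCrossed : Type (max u v) := P.crossedSubmodule

namespace AlgCrossed

variable {P}

instance : AddCommGroup P.AlgCrossed := inferInstanceAs (AddCommGroup P.crossedSubmodule)
instance : Module ℂ P.AlgCrossed := inferInstanceAs (Module ℂ P.crossedSubmodule)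

instance : FunLike P.AlgCrossed G (X → ℂ) where
  coe f := f.1
  coe_injective _ _ h := Subtype.ext h

theorem finite (F : P.AlgCrossed) : {g | F g ≠ 0}.Finite := F.2.1
theorem mem (F : P.AlgCrossed) (g : G) : F g ∈ C0On (P.U g) := F.2.2 g
theorem eq_zero (F : P.AlgCrossed) {g : G} {x : X} (hx : x ∉ P.U g) : F g x = 0 :=
  (F.mem g).2.2 x hx

/-- A finitely supported family, as an element of the algebraic crossed product. -/
def mk (F : G → X → ℂ) (h : {g | F g ≠ 0}.Finite) (h' : ∀ g, F g ∈ C0On (P.U g)) : P.AlgCrossed :=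
  ⟨F, h, h'⟩

@[simp] theorem mk_apply (F : G → X → ℂ) (h : {g | F g ≠ 0}.Finite)
    (h' : ∀ g, F g ∈ C0On (P.U g)) (g : G) : mk F h h' g = F g := rfl
@[simp] theorem add_apply (F H : P.AlgCrossed) (g : G) (x : X) :
    (F + H) g x = F g x + H g x := rfl
@[simp] theorem zero_apply (g : G) (x : X) : (0 : P.AlgCrossed) g x = 0 := rfl
@[simp] theorem smul_apply (c : ℂ) (F : P.AlgCrossed) (g : G) (x : X) :
    (c • F) g x = c * F g x := rfl

@[ext] theorem ext {F H : P.AlgCrossed} (h : ∀ g x, F g x = H g x) : F = H :=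
  DFunLike.ext _ _ fun g => funext fun x => h g x

open Classical in
/-- The element `f δ_g`, for `f ∈ C₀(U_g)`. -/
def delta (g : G) (f : C0On (P.U g)) : P.AlgCrossed :=
  mk (Pi.single g f.1) ((finite_singleton g).subset fun h hh => by
      by_contra hne
      exact hh (Pi.single_eq_of_ne hne _))
    (fun h => by
      rcases eq_or_ne h g with rfl | hne
      · rw [Pi.single_eq_same]; exact f.2
      · rw [Pi.single_eq_of_ne hne]; exact Submodule.zero_mem _)

theorem delta_same (g : G) (f : C0On (P.U g)) : delta g f g = f.1 := by simp [delta]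

theorem delta_of_ne {g h : G} (f : C0On (P.U g)) (hne : h ≠ g) : delta g f h = 0 := by
  simp [delta, hne]

theorem induction_delta {Q : P.AlgCrossed → Prop} (h0 : Q 0)
    (hadd : ∀ F H, Q F → Q H → Q (F + H)) (hd : ∀ g f, Q (delta g f)) (F : P.AlgCrossed) :
    Q F := by
  classical
  have key : F = ∑ g ∈ F.finite.toFinset, delta g ⟨F g, F.mem g⟩ := by
    ext h x
    have hsum : ∀ s : Finset G, (∑ g ∈ s, delta g ⟨F g, F.mem g⟩ : P.AlgCrossed) h x =
        ∑ g ∈ s, delta g ⟨F g, F.mem g⟩ h x := fun s => by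
      induction s using Finset.cons_induction with
      | empty => rfl
      | cons a s ha ih => rw [Finset.sum_cons, Finset.sum_cons, add_apply, ih]
    rw [hsum, Finset.sum_eq_single h]
    · rw [delta_same]
    · intro g _ hg
      rw [delta_of_ne _ hg.symm]; rfl
    · intro hh
      have : F h = 0 := by simpa using hh
      rw [delta_same]
      exact congrFun this x
  rw [key]
  exact Finset.sum_induction _ Q hadd h0 fun g _ => hd g _

/-- The product `(a δ_h) (b δ_k) = φ_h(φ_{h⁻¹}(a) b) δ_{hk}`, extended bilinearly. Since
`φ_h(φ_{h⁻¹}(a) b)` is the function `x ↦ a(x) b(h⁻¹.x)` on `U_h` and `0` off `U_h`, this is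
`(F H)_g(x) = ∑_h F_h(x) H_{h⁻¹ g}(h⁻¹.x)`, where the terms with `x ∉ U_h` vanish. -/
def mulFun (F H : G → X → ℂ) (g : G) (x : X) : ℂ :=
  ∑ᶠ h : G, F h x * H (h⁻¹ * g) (P.φ h⁻¹ x)

theorem finite_support (F : P.AlgCrossed) (K : G → ℂ) (x : X) :
    (Function.support fun h : G => F h x * K h).Finite :=
  F.finite.subset fun h hh h' => hh (by simp [h'])

theorem term_mem (F H : P.AlgCrossed) (h k : G) :
    (fun x => F h x * H k (P.φ h⁻¹ x)) ∈ C0On (P.U (h * k)) := by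
  obtain ⟨B, -, hB⟩ := C0On.exists_bound (H.mem k)
  have h1 : (fun x => F h x * H k (P.φ h⁻¹ x)) ∈ C0On (P.U h) := by
    refine C0On.of_norm_le (B := B) (F.mem h) (fun x => ?_) (P.isOpen_U h) ?_
    · rw [norm_mul]
      exact mul_le_mul_of_nonneg_left (hB _) (norm_nonneg _)
    · exact (F.mem h).1.continuousOn.mul ((H.mem k).1.comp_continuousOn (P.continuousOn h))
  refine ⟨h1.1, h1.2.1, fun x hx => ?_⟩
  by_contra hne
  have hxh : x ∈ P.U h := by
    by_contra h'; exact left_ne_zero_of_mul hne (F.eq_zero h')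
  have hxk : P.φ h⁻¹ x ∈ P.U k := by
    by_contra h'; exact right_ne_zero_of_mul hne (H.eq_zero h')
  refine hx ?_
  have := P.mem_comp (g := h⁻¹) (h := k⁻¹) (x := x) (by rwa [inv_inv]) (by rwa [inv_inv])
  simpa using this

theorem mulFun_eq_sum (F H : P.AlgCrossed) (g : G) :
    mulFun (P := P) F H g =
      ∑ h ∈ F.finite.toFinset, fun x => F h x * H (h⁻¹ * g) (P.φ h⁻¹ x) := by
  funext x
  rw [Finset.sum_apply]
  refine finsum_eq_sum_of_support_subset _ fun h hh => ?_
  simp only [Set.Finite.coe_toFinset, mem_ofPred_eq]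
  intro h'
  exact hh (by simp [h'])

theorem mulFun_mem (F H : P.AlgCrossed) (g : G) : mulFun (P := P) F H g ∈ C0On (P.U g) := by
  rw [mulFun_eq_sum]
  refine Submodule.sum_mem _ fun h _ => ?_
  have := term_mem F H h (h⁻¹ * g)
  rwa [mul_inv_cancel_left] at this

theorem mulFun_finite (F H : P.AlgCrossed) : {g | mulFun (P := P) F H g ≠ 0}.Finite := by
  refine (F.finite.image2 (· * ·) H.finite).subset fun g hg => ?_
  by_contra hn
  refine hg (funext fun x => finsum_eq_zero_of_forall_eq_zero fun h => ?_)
  by_contra h0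
  refine hn ⟨h, fun h' => left_ne_zero_of_mul h0 (by simp [h']), h⁻¹ * g,
    fun h' => right_ne_zero_of_mul h0 (by simp [h']), by simp⟩

instance : Mul P.AlgCrossed :=
  ⟨fun F H => mk (mulFun (P := P) F H) (mulFun_finite F H) (mulFun_mem F H)⟩

theorem mul_apply (F H : P.AlgCrossed) (g : G) (x : X) :
    (F * H) g x = ∑ᶠ h : G, F h x * H (h⁻¹ * g) (P.φ h⁻¹ x) := rfl

theorem delta_mul_apply (k : G) (f : C0On (P.U k)) (H : P.AlgCrossed) (g : G) (x : X) :
    (delta k f * H) g x = f.1 x * H (k⁻¹ * g) (P.φ k⁻¹ x) := by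
  rw [mul_apply, finsum_eq_single _ k, delta_same]
  intro h hne
  rw [delta_of_ne f hne, Pi.zero_apply, zero_mul]

theorem zero_mul_aux (F : P.AlgCrossed) : 0 * F = 0 := by
  ext g x
  rw [mul_apply]; simp

theorem add_mul_aux (F H K : P.AlgCrossed) : (F + H) * K = F * K + H * K := by
  ext g x
  simp only [mul_apply, add_apply, add_mul]
  exact finsum_add_distrib (finite_support F _ x) (finite_support H _ x)

theorem mul_add_aux (F H K : P.AlgCrossed) : F * (H + K) = F * H + F * K := by
  ext g x
  simp only [mul_apply, add_apply, mul_add]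
  exact finsum_add_distrib (finite_support F _ x) (finite_support F _ x)

theorem mul_assoc_aux (F H K : P.AlgCrossed) : F * H * K = F * (H * K) := by
  induction F using induction_delta with
  | h0 => simp only [zero_mul_aux]
  | hadd F F' h1 h2 => simp only [add_mul_aux, h1, h2]
  | hd k f =>
    ext g x
    rw [delta_mul_apply, mul_apply, mul_apply, mul_finsum]
    refine (finsum_eq_of_bijective (fun l => k * l) (Group.mulLeft_bijective k) fun l => ?_).symm
    rw [delta_mul_apply, inv_mul_cancel_left, mul_inv_rev, mul_assoc, mul_assoc]
    by_cases h1 : x ∈ P.U k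
    · by_cases h2 : P.φ k⁻¹ x ∈ P.U l
      · rw [P.comp_apply (g := k⁻¹) (h := l⁻¹) (by rwa [inv_inv]) (by rwa [inv_inv])]
      · rw [H.eq_zero h2]; simp
    · rw [f.2.2.2 x h1]; simp

instance : NonUnitalRing P.AlgCrossed :=
  { (inferInstance : AddCommGroup P.AlgCrossed), (inferInstance : Mul P.AlgCrossed) with
    zero_mul := zero_mul_aux
    mul_zero := fun F => by
      ext g x
      rw [mul_apply]; simp
    mul_assoc := mul_assoc_aux
    left_distrib := mul_add_aux
    right_distrib := add_mul_aux }

instance : IsScalarTower ℂ P.AlgCrossed P.AlgCrossed where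
  smul_assoc c F H := by
    ext g x
    simp only [smul_eq_mul, smul_apply, mul_apply, mul_assoc]
    exact (mul_finsum _ _).symm

instance : SMulCommClass ℂ P.AlgCrossed P.AlgCrossed where
  smul_comm c F H := by
    ext g x
    simp only [smul_eq_mul, smul_apply, mul_apply, mul_left_comm _ c]
    exact mul_finsum _ _

theorem mul_apply_of_one {a b : P.AlgCrossed} (ha : ∀ g, g ≠ 1 → a g = 0) (g : G) (x : X) :
    (a * b) g x = a 1 x * b g x := by
  rw [mul_apply, finsum_eq_single _ 1]
  · rw [inv_one, one_mul, P.one_apply]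
  · intro h hne
    rw [ha h hne, Pi.zero_apply, zero_mul]

open Classical in
/-- The involution `(a δ_g)* = φ_{g⁻¹}(conj a) δ_{g⁻¹}`, that is
`(F*)_g(x) = conj (F_{g⁻¹}(g⁻¹.x))` for `x ∈ U_g`. -/
def starFun (F : G → X → ℂ) (g : G) (x : X) : ℂ :=
  if x ∈ P.U g then star (F g⁻¹ (P.φ g⁻¹ x)) else 0

theorem starFun_mem [T2Space X] (F : P.AlgCrossed) (g : G) :
    starFun (P := P) F g ∈ C0On (P.U g) := by
  have hin : ∀ x ∈ P.U g, starFun (P := P) F g x = star (F g⁻¹ (P.φ g⁻¹ x)) := fun x hx => if_pos hx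
  have hout : ∀ x, x ∉ P.U g → starFun (P := P) F g x = 0 := fun x hx => if_neg hx
  refine C0On.of_isCompact (P.isOpen_U g) ?_ hout fun ε hε => ?_
  · refine ContinuousOn.congr ?_ hin
    exact continuous_star.comp_continuousOn
      ((F.mem g⁻¹).1.comp_continuousOn (P.continuousOn g))
  · have hK := C0On.isCompact_le (F.mem g⁻¹) hε
    have hsub : {x | ε ≤ ‖F g⁻¹ x‖} ⊆ P.U g⁻¹ := fun x hx => by
      by_contra h
      have hx' : ε ≤ ‖F g⁻¹ x‖ := hx
      rw [F.eq_zero h, norm_zero] at hx'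
      linarith
    have hcont : ContinuousOn (P.φ g) (P.U g⁻¹) := by
      have := (P.φ g).continuousOn
      rwa [P.source_eq] at this
    have := hK.image_of_continuousOn (hcont.mono hsub)
    convert this using 1
    ext x
    constructor
    · intro hx
      have hx' : ε ≤ ‖starFun (P := P) F g x‖ := hx
      by_cases hxU : x ∈ P.U g
      · rw [hin x hxU, norm_star] at hx'
        exact ⟨P.φ g⁻¹ x, hx', P.apply_inv hxU⟩
      · rw [hout x hxU, norm_zero] at hx'
        linarith
    · rintro ⟨y, hy, rfl⟩
      change ε ≤ ‖starFun (P := P) F g (P.φ g y)‖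
      rw [hin _ (P.map_mem (hsub hy)), norm_star, P.inv_apply (hsub hy)]
      exact hy

theorem starFun_finite (F : P.AlgCrossed) : {g | starFun (P := P) F g ≠ 0}.Finite := by
  refine (F.finite.image (·⁻¹)).subset fun g hg => ⟨g⁻¹, fun h => hg ?_, inv_inv g⟩
  funext x
  simp [starFun, h]

instance [T2Space X] : Star P.AlgCrossed :=
  ⟨fun F => mk (starFun (P := P) F) (starFun_finite F) (starFun_mem F)⟩

variable [T2Space X]

theorem star_apply_of_mem (F : P.AlgCrossed) {g : G} {x : X} (hx : x ∈ P.U g) :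
    star F g x = star (F g⁻¹ (P.φ g⁻¹ x)) := if_pos hx

theorem star_star_aux (F : P.AlgCrossed) : star (star F) = F := by
  ext g x
  by_cases hx : x ∈ P.U g
  · rw [star_apply_of_mem _ hx, star_apply_of_mem _ (P.map_mem' hx), star_star, inv_inv,
      P.apply_inv hx]
  · rw [eq_zero _ hx, eq_zero _ hx]

theorem star_add_aux (F H : P.AlgCrossed) : star (F + H) = star F + star H := by
  ext g x
  by_cases hx : x ∈ P.U g
  · simp only [add_apply, star_apply_of_mem _ hx, star_add]
  · rw [eq_zero _ hx, eq_zero _ hx]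

open Classical in
theorem star_mul_aux (F H : P.AlgCrossed) : star (F * H) = star H * star F := by
  ext g x
  have hL : star (F * H) g x =
      ∑ᶠ h : G, if x ∈ P.U g then
        star (F h (P.φ g⁻¹ x) * H (h⁻¹ * g⁻¹) (P.φ h⁻¹ (P.φ g⁻¹ x))) else 0 := by
    by_cases hx : x ∈ P.U g
    · rw [star_apply_of_mem _ hx, mul_apply]
      simp only [if_pos hx]
      exact (starAddEquiv : ℂ ≃+ ℂ).toAddMonoidHom.map_finsum (finite_support F _ _)
    · simp [hx, eq_zero _ hx]
  rw [hL, mul_apply]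
  refine finsum_eq_of_bijective (fun h => g * h) (Group.mulLeft_bijective g) fun h => ?_
  have e0 : (g * h)⁻¹ * g = h⁻¹ := by group
  have e1 : h⁻¹ * g⁻¹ = (g * h)⁻¹ := by group
  rw [e0, e1]
  by_cases hR : x ∈ P.U (g * h) ∧ P.φ (g * h)⁻¹ x ∈ P.U h⁻¹
  · obtain ⟨h1, h2⟩ := hR
    have e2 : h * (g * h)⁻¹ = g⁻¹ := by group
    have h3 := P.mem_comp (g := (g * h)⁻¹) (h := h) (x := x) (by rwa [inv_inv]) h2
    have h4 := P.comp_apply (g := (g * h)⁻¹) (h := h) (x := x) (by rwa [inv_inv]) h2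
    rw [e2, inv_inv] at h3
    rw [e2] at h4
    rw [if_pos h3, star_apply_of_mem _ h1, star_apply_of_mem _ h2, inv_inv, ← h4, star_mul,
      h4, P.inv_apply h2]
  · have hRz : star H (g * h) x * star F h⁻¹ (P.φ (g * h)⁻¹ x) = 0 := by
      by_cases h1 : x ∈ P.U (g * h)
      · have h2 : P.φ (g * h)⁻¹ x ∉ P.U h⁻¹ := fun h2 => hR ⟨h1, h2⟩
        rw [eq_zero (star F) h2, mul_zero]
      · rw [eq_zero (star H) h1, zero_mul]
    rw [hRz]
    split_ifs with hx
    · by_cases h1 : P.φ g⁻¹ x ∈ P.U h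
      · exfalso
        have h3 := P.mem_comp (g := g⁻¹) (h := h⁻¹) (x := x) (by rwa [inv_inv]) (by rwa [inv_inv])
        have h4 := P.comp_apply (g := g⁻¹) (h := h⁻¹) (x := x) (by rwa [inv_inv])
          (by rwa [inv_inv])
        rw [e1, inv_inv] at h3
        rw [e1] at h4
        exact hR ⟨h3, h4 ▸ P.map_mem' h1⟩
      · rw [eq_zero F h1, zero_mul, star_zero]
    · rfl

instance : StarRing P.AlgCrossed where
  star_involutive := star_star_aux
  star_add := star_add_aux
  star_mul := star_mul_aux

instance : StarModule ℂ P.AlgCrossed where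
  star_smul c F := by
    ext g x
    by_cases hx : x ∈ P.U g
    · simp only [smul_apply, star_apply_of_mem _ hx, star_mul']
    · rw [eq_zero _ hx, eq_zero _ hx]

theorem star_apply_one (a : P.AlgCrossed) (x : X) : star a 1 x = star (a 1 x) := by
  rw [star_apply_of_mem _ (P.mem_one x), inv_one, P.one_apply]

theorem star_mul_self_delta (k : G) (f : C0On (P.U k)) (g : G) (hg : g ≠ 1) :
    (star (delta k f) * delta k f) g = 0 := by
  funext x
  rw [mul_apply]
  refine finsum_eq_zero_of_forall_eq_zero fun h => ?_
  by_cases h1 : h⁻¹ = k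
  · by_cases h2 : h⁻¹ * g = k
    · exact absurd (by rw [h1] at h2; simpa using h2) hg
    · rw [delta_of_ne f h2, Pi.zero_apply, mul_zero]
  · have : star (delta k f) h x = 0 := by
      by_cases hx : x ∈ P.U h
      · rw [star_apply_of_mem _ hx, delta_of_ne f h1, Pi.zero_apply, star_zero]
      · exact eq_zero _ hx
    rw [this, zero_mul]

theorem bddAbove_delta (k : G) (f : C0On (P.U k)) :
    BddAbove (range fun p : CStarSeminorm P.AlgCrossed => p (delta k f)) := by
  classical
  set h : P.AlgCrossed := star (delta k f) * delta k f with hh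
  have hstar : star h = h := by rw [hh, star_mul, star_star]
  have hu : ∀ g, g ≠ 1 → h g = 0 := star_mul_self_delta k f
  have hreal : ∀ x, star (h 1 x) = h 1 x := fun x => by
    rw [← star_apply_one, hstar]
  obtain ⟨c, hc0, hc⟩ := C0On.exists_bound (h.mem 1)
  let w : X → ℝ := fun x => Real.sqrt (c ^ 2 - ‖h 1 x‖ ^ 2)
  have hcont := (h.mem 1).1
  have hw : Continuous w := Real.continuous_sqrt.comp (by fun_prop)
  have hwc : ∀ x, w x ≤ c := fun x => by
    refine (Real.sqrt_le_sqrt (y := c ^ 2) ?_).trans (Real.sqrt_sq hc0).le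
    have := sq_nonneg ‖h 1 x‖
    linarith
  let u1 : C0On (P.U 1) := ⟨fun x => h 1 x * (h 1 x + Complex.I * (w x : ℂ)), by
    refine C0On.of_norm_le (B := c + c) (h.mem 1) (fun x => ?_) (P.isOpen_U 1) ?_
    · rw [norm_mul]
      refine mul_le_mul_of_nonneg_left ?_ (norm_nonneg _)
      refine (norm_add_le _ _).trans (add_le_add (hc x) ?_)
      rw [norm_mul, Complex.norm_I, one_mul, Complex.norm_real, Real.norm_of_nonneg
        (Real.sqrt_nonneg _)]
      exact hwc x
    · exact (hcont.mul (hcont.add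
        (continuous_const.mul (Complex.continuous_ofReal.comp hw)))).continuousOn⟩
  let u : P.AlgCrossed := delta 1 u1
  have hu1 : ∀ x, u 1 x = h 1 x * (h 1 x + Complex.I * (w x : ℂ)) := fun x => by
    simp only [u, delta_same, u1]
  have hu' : ∀ g, g ≠ 1 → u g = 0 := fun g hg => delta_of_ne u1 hg
  have hsu : ∀ x, star u 1 x = h 1 x * (h 1 x - Complex.I * (w x : ℂ)) := fun x => by
    rw [star_apply_one, hu1]
    simp only [star_mul', star_add, hreal]
    simp only [RCLike.star_def, Complex.conj_I, Complex.conj_ofReal]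
    ring
  have hsu' : ∀ g, g ≠ 1 → star u g = 0 := fun g hg => by
    funext x
    by_cases hx : x ∈ P.U g
    · rw [star_apply_of_mem _ hx, hu' _ (inv_ne_one.2 hg), Pi.zero_apply, star_zero]; rfl
    · exact eq_zero _ hx
  have hw2 : ∀ x, (w x : ℂ) ^ 2 = (c : ℂ) ^ 2 - h 1 x ^ 2 := fun x => by
    have e1 : w x ^ 2 = c ^ 2 - ‖h 1 x‖ ^ 2 := Real.sq_sqrt (by
      have := pow_le_pow_left₀ (norm_nonneg _) (hc x) 2
      linarith)
    have e2 : ((‖h 1 x‖ : ℝ) : ℂ) ^ 2 = h 1 x ^ 2 := by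
      have := RCLike.mul_conj (K := ℂ) (h 1 x)
      rw [← RCLike.star_def, hreal] at this
      rw [sq (h 1 x), this]; rfl
    rw [← e2, ← Complex.ofReal_pow, e1]
    push_cast
    ring
  have key : ∀ p : CStarSeminorm P.AlgCrossed, p h ≤ c := fun p => by
    refine p.le_of_unitary_trick (u := u) hc0 hstar ?_ ?_
    · ext g x
      rw [add_apply, smul_apply, mul_apply_of_one hu]
      by_cases hg : g = 1
      · subst hg
        rw [hsu, hu1]
        ring
      · rw [hu' g hg, hsu' g hg, hu g hg]; simp
    · ext g x
      rw [smul_apply, mul_apply_of_one hu, mul_apply_of_one hsu']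
      by_cases hg : g = 1
      · subst hg
        rw [hsu, hu1]
        linear_combination (-(h 1 x) ^ 2 * (w x : ℂ) ^ 2) * Complex.I_sq + (h 1 x) ^ 2 * hw2 x
      · rw [hu' g hg, hu g hg]; simp
  refine ⟨Real.sqrt c, ?_⟩
  rintro _ ⟨p, rfl⟩
  refine Real.le_sqrt_of_sq_le ?_
  rw [← p.star_mul_self]
  exact key p

instance : HasCStarEnvelope P.AlgCrossed where
  bddAbove F := by
    induction F using induction_delta with
    | h0 => exact ⟨0, by rintro _ ⟨p, rfl⟩; simp⟩
    | hadd F H hF hH =>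
      obtain ⟨a, ha⟩ := hF
      obtain ⟨b, hb⟩ := hH
      refine ⟨a + b, ?_⟩
      rintro _ ⟨p, rfl⟩
      exact (map_add_le_add p.toSeminorm F H).trans
        (add_le_add (ha ⟨p, rfl⟩) (hb ⟨p, rfl⟩))
    | hd g f => exact bddAbove_delta g f

/-- For a homomorphism `ℓ : G → ℤ` and `z` in the circle, the *-homomorphism of the algebraic
crossed product given by `f δ_g ↦ z ^ ℓ(g) f δ_g`. -/
def dualHom (ℓ : G →* Multiplicative ℤ) (z : Circle) : P.AlgCrossed →⋆ₙₐ[ℂ] P.AlgCrossed where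
  toFun F := mk (fun g => ((z ^ (ℓ g).toAdd : Circle) : ℂ) • F g)
    (F.finite.subset fun g hg h => hg (by simp [h]))
    (fun g => Submodule.smul_mem _ _ (F.mem g))
  map_smul' a F := by
    ext g x
    simp only [mk_apply, smul_apply, MonoidHom.id_apply, Pi.smul_apply, smul_eq_mul]; ring
  map_zero' := by ext g x; simp
  map_add' F H := by
    ext g x
    simp only [mk_apply, add_apply, Pi.smul_apply, smul_eq_mul]; ring
  map_mul' F H := by
    ext g x
    simp only [mk_apply, mul_apply, Pi.smul_apply, smul_eq_mul, mul_finsum]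
    refine finsum_congr fun h => ?_
    have h1 : (ℓ g).toAdd = (ℓ h).toAdd + (ℓ (h⁻¹ * g)).toAdd := by
      rw [← toAdd_mul, ← map_mul, mul_inv_cancel_left]
    rw [h1, zpow_add, Circle.coe_mul]
    ring
  map_star' F := by
    ext g x
    by_cases hx : x ∈ P.U g
    · simp only [mk_apply, star_apply_of_mem _ hx, Pi.smul_apply, smul_eq_mul, star_mul', map_inv,
        toAdd_inv, zpow_neg]
      congr 1
      rw [Circle.coe_inv_eq_conj]
      simp
    · rw [eq_zero _ hx, eq_zero _ hx]

theorem dualHom_apply (ℓ : G →* Multiplicative ℤ) (z : Circle) (F : P.AlgCrossed) (g : G) (x : X) :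
    dualHom ℓ z F g x = ((z ^ (ℓ g).toAdd : Circle) : ℂ) * F g x := rfl

end AlgCrossed

variable [T2Space X]

/-- The (full) partial crossed product `C₀(X) ⋊ G`: the completion of the algebraic crossed product
in its largest C*-seminorm. -/
abbrev CrossedProduct : Type (max u v) := EnvelopingCStarAlgebra P.AlgCrossed

/-- The element `f δ_g` of `C₀(X) ⋊ G`, for `f ∈ C₀(U_g)`. -/
def delta (g : G) (f : C0On (P.U g)) : P.CrossedProduct :=
  EnvelopingCStarAlgebra.of (AlgCrossed.delta g f)

/-- The copy `C₀(X) δ_e` of `C₀(X)` in `C₀(X) ⋊ G`. -/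
def diagonal : Set P.CrossedProduct := range (P.delta 1)

end PartialAction

/-! ### Partial actions of free groups -/

namespace PartialAction

variable {A : Type u} {X : Type v} [TopologicalSpace X] (P : PartialAction (FreeGroup A) X)

open Classical in
/-- A partial action of a free group is semi-saturated if `φ_{gh} = φ_g ∘ φ_h`, as partially defined
maps, whenever `|gh| = |g| + |h|` for the length of reduced words. -/
def IsSemisaturated : Prop :=
  ∀ g h : FreeGroup A, (g * h).norm = g.norm + h.norm →
    P.φ (g * h) ≈ (P.φ h).trans (P.φ g)

/-- A partial action of a free group is orthogonal if the sets `U_a` of the generators `a` are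
pairwise disjoint. -/
def IsOrthogonal : Prop :=
  ∀ a b : A, a ≠ b → P.U (FreeGroup.of a) ∩ P.U (FreeGroup.of b) = ∅

open Classical in
/-- The map `σ` with `σ(x) = a⁻¹.x` for `x ∈ U_a`, `a` a generator (and `σ(x) = x` if there is no
such `a`). -/
def sigma (x : X) : X :=
  if h : ∃ a : A, x ∈ P.U (FreeGroup.of a) then P.φ (FreeGroup.of h.choose)⁻¹ x else x

variable {P} in
theorem IsOrthogonal.sigma_eq (ho : P.IsOrthogonal) {a : A} {x : X}
    (hx : x ∈ P.U (FreeGroup.of a)) : P.sigma x = P.φ (FreeGroup.of a)⁻¹ x := by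
  have h : ∃ a : A, x ∈ P.U (FreeGroup.of a) := ⟨a, hx⟩
  have e : h.choose = a := by
    by_contra hne
    have : x ∈ P.U (FreeGroup.of h.choose) ∩ P.U (FreeGroup.of a) := ⟨h.choose_spec, hx⟩
    rw [ho _ _ hne] at this
    exact this
  rw [sigma, dif_pos h, e]

/-- The Deaconu-Renault system of an orthogonal partial action of a free group: `σ` is defined on
the (disjoint) union of the sets `U_a`, `a` a generator, by `σ(x) = a⁻¹.x` for `x ∈ U_a`. -/
def toDeaconuRenault (ho : P.IsOrthogonal) : DeaconuRenaultSystem X where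
  dom := ⋃ a : A, P.U (FreeGroup.of a)
  toFun := P.sigma
  isOpen_dom := isOpen_iUnion fun _ => P.isOpen_U _
  isLocalHomeomorphOn := IsLocalHomeomorphOn.mk _ _ fun x hx => by
    obtain ⟨a, ha⟩ := mem_iUnion.1 hx
    refine ⟨P.φ (FreeGroup.of a)⁻¹, by rwa [P.source_eq, inv_inv], fun y hy => ?_⟩
    rw [P.source_eq, inv_inv] at hy
    exact ho.sigma_eq hy

/-- The homomorphism `𝔽 → ℤ` that sends every generator to `1`. -/
def lengthHom (A : Type u) : FreeGroup A →* Multiplicative ℤ :=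
  FreeGroup.lift fun _ => Multiplicative.ofAdd 1

variable [T2Space X]

/-- The action `ρ` of the circle on `C₀(X) ⋊ 𝔽`, determined by `ρ_z(f δ_g) = z ^ ℓ(g) f δ_g`, where
`ℓ : 𝔽 → ℤ` is the homomorphism that sends every generator to `1`. -/
def circleAction : Circle →* (P.CrossedProduct ≃⋆ₐ[ℂ] P.CrossedProduct) :=
  EnvelopingCStarAlgebra.extendAction (AlgCrossed.dualHom (lengthHom A))
    (fun F => by ext g x; simp [AlgCrossed.dualHom_apply])
    (fun z w F => by ext g x; simp [AlgCrossed.dualHom_apply, mul_zpow, mul_assoc])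

theorem circleAction_of (z : Circle) (F : P.AlgCrossed) :
    P.circleAction z (EnvelopingCStarAlgebra.of F) =
      EnvelopingCStarAlgebra.of (AlgCrossed.dualHom (lengthHom A) z F) :=
  EnvelopingCStarAlgebra.extendAction_of _ _ _ z F

/-- The defining properties of the circle action on `C₀(X) ⋊ 𝔽`: it is strongly continuous,
`ρ_z(f δ_a) = z f δ_a` for every generator `a` and `f ∈ C₀(U_a)`, and `ρ_z(f δ_e) = f δ_e` for
`f ∈ C₀(X)`. -/
structure IsCircleAction (ρ : Circle →* (P.CrossedProduct ≃⋆ₐ[ℂ] P.CrossedProduct)) : Prop where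
  continuous : ∀ b : P.CrossedProduct, Continuous fun z => ρ z b
  generator : ∀ (z : Circle) (a : A) (f : C0On (P.U (FreeGroup.of a))),
    ρ z (P.delta (FreeGroup.of a) f) = (z : ℂ) • P.delta (FreeGroup.of a) f
  one : ∀ (z : Circle) (f : C0On (P.U 1)), ρ z (P.delta 1 f) = P.delta 1 f

end PartialAction
end PartialActions

end

/-!
The crossed product is described by the transformation groupoid `{(x, g) : x ∈ U_g}` of the partial
action, and the point is that this groupoid is the Deaconu-Renault groupoid: the map
`(x, g) ↦ (x, ℓ(g), g⁻¹.x)` is a bijection that is compatible with the multiplication.  Induction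
along reduced words (`FreeGroup.induction_reduced`) and semi-saturation show that
`(x, ℓ(g), g⁻¹.x)` is in the groupoid, with exponents of `σ` that depend only on `g`
(`IsSemisaturated.exists_rel`), and that `g = αβ⁻¹` for positive words `α`, `β` that are itineraries
of `x` and of `g⁻¹.x` under `σ`.  By orthogonality a point has only one itinerary of a given length,
so that a group element of length `0` fixing a point is trivial (`IsSemisaturated.eq_one`); this
gives injectivity (`arrow_injective`).  The degree `(x, ℓ(g), g⁻¹.x) ↦ g` is locally constant.

Taking coefficients along the sections `x ↦ (x, ℓ(g), g⁻¹.x)` embeds `C_c(Γ)` into the algebraic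
crossed product (`toCrossed`), with image the families of functions with compact supports in the
sets `U_g`.  This image is dense for the `ℓ¹`-norm `∑_g ‖f_g‖_∞`, and every C*-seminorm, on
`C_c(Γ)` as well as on the algebraic crossed product, is bounded by the `ℓ¹`-norm
(`seminorm_le_of_eq_delta`).  Therefore the canonical homomorphism `C_c(Γ) → C*(Γ)` extends to
the algebraic crossed product, the two largest C*-seminorms agree on `C_c(Γ)`
(`norm_of_toCrossed`), and the induced map of enveloping C*-algebras is an isometry with dense range.

The diagonal of `C*(Γ)` is a closure, whereas that of the crossed product is `C₀(X) δ_e` itself.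
That the latter is closed follows from the representation of the crossed product on `ℓ²(X)`
(`koopmanHom`), in which `C₀(X)` acts isometrically by multiplication.

Finally, an action `ρ` that has the prescribed values on the generators is determined on every
`f δ_g` by induction along reduced words, because `f δ_{gh}` factors as `(f δ_g) (f' δ_h)` if `f` has
compact support and there is no cancellation in `gh` (`IsSemisaturated.isHomogeneousAt_mul`).
-/

noncomputable section

universe u v

/-! ### Partial actions of free groups and itineraries -/

namespace FreeGroup

open Classical in
/-- Induction along reduced words: every element of a free group is obtained from `1` by
multiplying on the left by generators and inverses of generators, the length growing by `1` in each
step. -/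
theorem induction_reduced {A : Type u} {Q : FreeGroup A → Prop} (h1 : Q 1)
    (hof : ∀ a h, (of a * h).norm = (of a).norm + h.norm → Q h → Q (of a * h))
    (hinv : ∀ a h, ((of a)⁻¹ * h).norm = ((of a)⁻¹).norm + h.norm → Q h → Q ((of a)⁻¹ * h))
    (g : FreeGroup A) : Q g := by
  have norm_mk : ∀ L : List (A × Bool), IsReduced L → (mk L).norm = L.length := fun L hL => by
    rw [norm, toWord_mk, hL.reduce_eq]
  have key : ∀ L : List (A × Bool), IsReduced L → Q (mk L) := by
    intro L
    induction L with
    | nil => exact fun _ => h1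
    | cons p L ih =>
      intro hL
      obtain ⟨a, b⟩ := p
      have hL' : IsReduced L := hL.infix (List.suffix_cons _ _).isInfix
      have e : (mk ((a, b) :: L)).norm = 1 + (mk L).norm := by
        rw [norm_mk _ hL, norm_mk _ hL', List.length_cons, add_comm]
      cases b
      · have h : mk ((a, false) :: L) = (of a)⁻¹ * mk L := by
          rw [of, inv_mk, mul_mk]; rfl
        rw [h] at e ⊢
        exact hinv a _ (by rw [e, norm_inv_eq, norm_of]) (ih hL')
      · have h : mk ((a, true) :: L) = of a * mk L := by
          rw [of, mul_mk]; rfl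
        rw [h] at e ⊢
        exact hof a _ (by rw [e, norm_of]) (ih hL')
  rw [← mk_toWord (x := g)]
  exact key _ isReduced_toWord

end FreeGroup

namespace PartialAction

variable {A : Type u} {X : Type v} [TopologicalSpace X] {P : PartialAction (FreeGroup A) X}

section General

variable {G : Type u} [Group G] {P : PartialAction G X}

theorem mem_mul {g h : G} {x : X} (hx : x ∈ P.U g) (hx' : P.φ g⁻¹ x ∈ P.U h) :
    x ∈ P.U (g * h) := by
  have := P.mem_comp (g := g⁻¹) (h := h⁻¹) (x := x) (by rwa [inv_inv]) (by rwa [inv_inv])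
  rwa [← mul_inv_rev, inv_inv] at this

theorem mul_inv_apply {g h : G} {x : X} (hx : x ∈ P.U g) (hx' : P.φ g⁻¹ x ∈ P.U h) :
    P.φ (g * h)⁻¹ x = P.φ h⁻¹ (P.φ g⁻¹ x) := by
  rw [mul_inv_rev]
  exact P.comp_apply (by rwa [inv_inv]) (by rwa [inv_inv])

theorem mem_inv_mul {g h : G} {x : X} (hx : x ∈ P.U g) (hx' : x ∈ P.U h) :
    P.φ g⁻¹ x ∈ P.U (g⁻¹ * h) :=
  mem_mul (P.map_mem' hx) (by rwa [inv_inv, P.apply_inv hx])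

theorem inv_mul_inv_apply {g h : G} {x : X} (hx : x ∈ P.U g) (hx' : x ∈ P.U h) :
    P.φ (g⁻¹ * h)⁻¹ (P.φ g⁻¹ x) = P.φ h⁻¹ x := by
  rw [mul_inv_apply (P.map_mem' hx) (by rwa [inv_inv, P.apply_inv hx]), inv_inv, P.apply_inv hx]

end General

open Classical in
/-- In a semi-saturated partial action, `U_{gh}` consists of points that are moved back by `g` and
then by `h`, if there is no cancellation in the product `gh`. -/
theorem IsSemisaturated.mem (hss : P.IsSemisaturated) {g h : FreeGroup A}
    (hn : (g * h).norm = g.norm + h.norm) {x : X} (hx : x ∈ P.U (g * h)) :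
    x ∈ P.U g ∧ P.φ g⁻¹ x ∈ P.U h := by
  have h1 := hss h⁻¹ g⁻¹ (by
    rw [← mul_inv_rev, FreeGroup.norm_inv_eq, FreeGroup.norm_inv_eq, FreeGroup.norm_inv_eq, hn,
      add_comm])
  have h2 := h1.source_eq
  rw [← mul_inv_rev, P.source_eq, inv_inv, OpenPartialHomeomorph.trans_source, P.source_eq,
    P.source_eq, inv_inv, inv_inv] at h2
  rw [h2] at hx
  exact hx

theorem lengthHom_of (a : A) : (lengthHom A (FreeGroup.of a)).toAdd = 1 := by
  simp [lengthHom]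

theorem mem_dom_iff (ho : P.IsOrthogonal) {x : X} :
    x ∈ (P.toDeaconuRenault ho).dom ↔ ∃ a, x ∈ P.U (FreeGroup.of a) := mem_iUnion

theorem rel_of (ho : P.IsOrthogonal) {a : A} {x : X} (hx : x ∈ P.U (FreeGroup.of a)) :
    (P.toDeaconuRenault ho).Rel 1 0 x (P.φ (FreeGroup.of a)⁻¹ x) :=
  ⟨⟨(mem_dom_iff ho).2 ⟨a, hx⟩, trivial⟩, trivial, ho.sigma_eq hx⟩

/-- The points `x` and `g⁻¹.x` have a common forward image under `σ`; the exponents depend only on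
`g`, and this uniformity is what makes the sections `x ↦ (x, ℓ(g), g⁻¹.x)` of the groupoid
continuous. -/
theorem IsSemisaturated.exists_rel (hss : P.IsSemisaturated) (ho : P.IsOrthogonal)
    (g : FreeGroup A) : ∃ n m : ℕ, (lengthHom A g).toAdd = (n : ℤ) - m ∧
      ∀ x ∈ P.U g, (P.toDeaconuRenault ho).Rel n m x (P.φ g⁻¹ x) := by
  induction g using FreeGroup.induction_reduced with
  | h1 =>
    exact ⟨0, 0, by simp, fun x _ => ⟨trivial, trivial, by rw [inv_one, P.one_apply]⟩⟩
  | hof a h hn ih =>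
    obtain ⟨p, q, hl, hR⟩ := ih
    refine ⟨1 + (p - 0), q + (0 - p), ?_, fun x hx => ?_⟩
    · rw [map_mul, toAdd_mul, lengthHom_of, hl]; omega
    · obtain ⟨hx1, hx2⟩ := hss.mem hn hx
      rw [mul_inv_apply hx1 hx2]
      exact (rel_of ho hx1).comp (hR _ hx2)
  | hinv a h hn ih =>
    obtain ⟨p, q, hl, hR⟩ := ih
    refine ⟨0 + (p - 1), q + (1 - p), ?_, fun x hx => ?_⟩
    · rw [map_mul, toAdd_mul, map_inv, toAdd_inv, lengthHom_of, hl]; omega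
    · obtain ⟨hx1, hx2⟩ := hss.mem hn hx
      rw [mul_inv_apply hx1 hx2]
      refine DeaconuRenaultSystem.Rel.comp ?_ (hR _ hx2)
      have h1 := rel_of ho (P.map_mem hx1)
      rw [P.inv_apply hx1] at h1
      rw [inv_inv]
      exact h1.symm

/-- The positive element of the free group spelled by a list of generators. -/
def word (l : List A) : FreeGroup A := (l.map FreeGroup.of).prod

variable (P) in
/-- `l` is the itinerary of the first `|l|` steps of `x` under `σ`: `x` lies in `U_a` for the first
letter `a` of `l`, `σ(x)` lies in `U_b` for the second letter `b`, and so on. -/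
def IsItinerary : List A → X → Prop
  | [], _ => True
  | a :: l, x => x ∈ P.U (FreeGroup.of a) ∧ IsItinerary l (P.φ (FreeGroup.of a)⁻¹ x)

theorem word_cons (a : A) (l : List A) : word (a :: l) = FreeGroup.of a * word l := by
  simp [word]

theorem toAdd_lengthHom_word (l : List A) : (lengthHom A (word l)).toAdd = l.length := by
  induction l with
  | nil => simp [word]
  | cons a l ih => rw [word_cons, map_mul, toAdd_mul, lengthHom_of, ih, List.length_cons]; simp; ring

theorem IsItinerary.mem {l : List A} {x : X} (h : P.IsItinerary l x) : x ∈ P.U (word l) := by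
  induction l generalizing x with
  | nil => exact P.mem_one x
  | cons a l ih => rw [word_cons]; exact mem_mul h.1 (ih h.2)

theorem IsItinerary.iter_eq (ho : P.IsOrthogonal) {l : List A} {x : X} (h : P.IsItinerary l x) :
    (P.toDeaconuRenault ho).iter l.length x = P.φ (word l)⁻¹ x := by
  induction l generalizing x with
  | nil => exact (by simp [word, P.one_apply, DeaconuRenaultSystem.iter])
  | cons a l ih =>
    rw [word_cons, mul_inv_apply h.1 h.2.mem, ← ih h.2, List.length_cons, add_comm,
      DeaconuRenaultSystem.iter_add]
    exact congrArg _ (ho.sigma_eq h.1)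

theorem IsItinerary.append {l l' : List A} {x : X} (h : P.IsItinerary l x)
    (h' : P.IsItinerary l' (P.φ (word l)⁻¹ x)) : P.IsItinerary (l ++ l') x := by
  induction l generalizing x with
  | nil => simpa [word, P.one_apply] using h'
  | cons a l ih =>
    rw [word_cons, mul_inv_apply h.1 h.2.mem] at h'
    exact ⟨h.1, ih h.2 h'⟩

theorem IsOrthogonal.eq (ho : P.IsOrthogonal) {a b : A} {x : X} (ha : x ∈ P.U (FreeGroup.of a))
    (hb : x ∈ P.U (FreeGroup.of b)) : a = b := by
  by_contra hne
  have : x ∈ P.U (FreeGroup.of a) ∩ P.U (FreeGroup.of b) := ⟨ha, hb⟩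
  rw [ho a b hne] at this
  exact this

/-- By orthogonality, a point has at most one itinerary of a given length. -/
theorem IsItinerary.eq_of_length (ho : P.IsOrthogonal) {l l' : List A} {x : X}
    (h : P.IsItinerary l x) (h' : P.IsItinerary l' x) (hl : l.length = l'.length) : l = l' := by
  induction l generalizing l' x with
  | nil => exact (List.length_eq_zero_iff.1 hl.symm).symm
  | cons a l ih =>
    cases l' with
    | nil => simp at hl
    | cons b l' =>
      obtain rfl := ho.eq h.1 h'.1
      rw [ih h.2 h'.2 (by simpa using hl)]

theorem exists_isItinerary (ho : P.IsOrthogonal) {n : ℕ} {x : X}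
    (hx : x ∈ (P.toDeaconuRenault ho).domIter n) :
    ∃ l : List A, l.length = n ∧ P.IsItinerary l x := by
  induction n generalizing x with
  | zero => exact ⟨[], rfl, trivial⟩
  | succ n ih =>
    obtain ⟨a, ha⟩ := (mem_dom_iff ho).1 hx.1
    obtain ⟨l, hl, h⟩ := ih hx.2
    exact ⟨a :: l, by simp [hl], ha, (ho.sigma_eq ha) ▸ h⟩

/-- If `g⁻¹` is defined at `x` then `g = αβ⁻¹` for positive words `α`, `β` that are itineraries of
`x` and of `g⁻¹.x`. -/
theorem IsSemisaturated.exists_isItinerary (hss : P.IsSemisaturated) (ho : P.IsOrthogonal)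
    {g : FreeGroup A} {x : X} (hx : x ∈ P.U g) : ∃ c d : List A, g = word c * (word d)⁻¹ ∧
      P.IsItinerary c x ∧ P.IsItinerary d (P.φ g⁻¹ x) := by
  induction g using FreeGroup.induction_reduced generalizing x with
  | h1 => exact ⟨[], [], by simp [word], trivial, trivial⟩
  | hof a h hn ih =>
    obtain ⟨hx1, hx2⟩ := hss.mem hn hx
    obtain ⟨c, d, hg, hc, hd⟩ := ih hx2
    refine ⟨a :: c, d, by rw [word_cons, hg, mul_assoc], ⟨hx1, hc⟩, ?_⟩
    rwa [mul_inv_apply hx1 hx2]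
  | hinv a h hn ih =>
    obtain ⟨hx1, hx2⟩ := hss.mem hn hx
    obtain ⟨c, d, hg, hc, hd⟩ := ih hx2
    have hu := P.map_mem hx1
    have hux := P.inv_apply hx1
    rw [inv_inv] at hx2 hc hd
    rw [mul_inv_apply hx1 (by rwa [inv_inv]), inv_inv]
    -- If `c` is nonempty, it starts with `a` by orthogonality, and `a⁻¹` cancels its first letter.
    cases c with
    | nil =>
      have hwd : (word d)⁻¹ = h := by rw [hg]; simp [word]
      refine ⟨[], d ++ [a], by simp [hg, word], trivial, hd.append ?_⟩
      have h2 : P.φ (word d)⁻¹ (P.φ h⁻¹ (P.φ (FreeGroup.of a) x)) = P.φ (FreeGroup.of a) x := by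
        rw [hwd]; exact P.apply_inv hx2
      rw [h2]
      exact ⟨hu, trivial⟩
    | cons b c =>
      obtain rfl := ho.eq hu hc.1
      refine ⟨c, d, by rw [hg, word_cons]; group, ?_, hd⟩
      have := hc.2
      rwa [hux] at this

/-- The partial action is free on points up to length: an element of length `0` (for `ℓ`) that
fixes a point is trivial. -/
theorem IsSemisaturated.eq_one (hss : P.IsSemisaturated) (ho : P.IsOrthogonal)
    {g : FreeGroup A} {x : X} (hx : x ∈ P.U g) (hg : P.φ g⁻¹ x = x)
    (hl : (lengthHom A g).toAdd = 0) : g = 1 := by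
  obtain ⟨c, d, rfl, hc, hd⟩ := hss.exists_isItinerary ho hx
  rw [hg] at hd
  rw [map_mul, toAdd_mul, map_inv, toAdd_inv, toAdd_lengthHom_word, toAdd_lengthHom_word] at hl
  rw [hc.eq_of_length ho hd (by omega), mul_inv_cancel]

end PartialAction

/-! ### The groupoid of the partial action -/

namespace PartialAction

open DeaconuRenaultSystem Groupoid

variable {A : Type u} {X : Type v} [TopologicalSpace X] {P : PartialAction (FreeGroup A) X}
  (hss : P.IsSemisaturated) (ho : P.IsOrthogonal)

/-- The element `(x, ℓ(g), g⁻¹.x)` of the Deaconu-Renault groupoid, for `x ∈ U_g`. -/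
def arrow (g : FreeGroup A) (x : X) (hx : x ∈ P.U g) : (P.toDeaconuRenault ho).Groupoid :=
  ⟨(x, (lengthHom A g).toAdd, P.φ g⁻¹ x), by
    obtain ⟨n, m, hl, hR⟩ := hss.exists_rel ho g
    exact ⟨n, m, hl, hR x hx⟩⟩

variable {hss ho}

@[simp] theorem r_arrow {g : FreeGroup A} {x : X} (hx : x ∈ P.U g) :
    (arrow hss ho g x hx).r = x := rfl
@[simp] theorem s_arrow {g : FreeGroup A} {x : X} (hx : x ∈ P.U g) :
    (arrow hss ho g x hx).s = P.φ g⁻¹ x := rfl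
@[simp] theorem c_arrow {g : FreeGroup A} {x : X} (hx : x ∈ P.U g) :
    (arrow hss ho g x hx).c = (lengthHom A g).toAdd := rfl

theorem arrow_congr {g h : FreeGroup A} {x y : X} (hx : x ∈ P.U g) (hy : y ∈ P.U h) (e : g = h)
    (e' : x = y) : arrow hss ho g x hx = arrow hss ho h y hy := by
  subst e e'; rfl

theorem inv_arrow {g : FreeGroup A} {x : X} (hx : x ∈ P.U g) :
    (arrow hss ho g x hx).inv = arrow hss ho g⁻¹ (P.φ g⁻¹ x) (P.map_mem' hx) :=
  Groupoid.ext rfl (by simp) (by simp [P.apply_inv hx])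

theorem inv_mul_arrow {g h : FreeGroup A} {x : X} (hx : x ∈ P.U g) (hx' : x ∈ P.U h)
    (e : (arrow hss ho g x hx).inv.s = (arrow hss ho h x hx').r) :
    (arrow hss ho g x hx).inv.mul (arrow hss ho h x hx') e =
      arrow hss ho (g⁻¹ * h) (P.φ g⁻¹ x) (mem_inv_mul hx hx') :=
  Groupoid.ext rfl (by simp) (by simpa using! (inv_mul_inv_apply hx hx').symm)

/-- Different elements of the free group give different arrows: the comparison of two arrows with
the same range and source is an arrow of length `0` from a point to itself. -/
theorem arrow_injective {g h : FreeGroup A} {x y : X} {hx : x ∈ P.U g} {hy : y ∈ P.U h}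
    (e : arrow hss ho g x hx = arrow hss ho h y hy) : g = h := by
  obtain rfl : x = y := congrArg Groupoid.r e
  have hc : (lengthHom A g).toAdd = (lengthHom A h).toAdd := congrArg Groupoid.c e
  have hs : P.φ g⁻¹ x = P.φ h⁻¹ x := congrArg Groupoid.s e
  have := hss.eq_one ho (mem_inv_mul hx hy) (by rw [inv_mul_inv_apply hx hy, hs])
    (by rw [map_mul, toAdd_mul, map_inv, toAdd_inv, hc]; ring)
  exact (inv_mul_eq_one.1 this)

/-- Every element of the groupoid is an arrow: if `σⁿ(x) = σᵐ(y)`, take `g = αβ⁻¹` for the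
itineraries `α` and `β` of lengths `n` and `m` of `x` and `y`. -/
theorem exists_arrow (γ : (P.toDeaconuRenault ho).Groupoid) :
    ∃ (g : FreeGroup A) (hx : γ.r ∈ P.U g), arrow hss ho g γ.r hx = γ := by
  obtain ⟨n, m, hc, h1, h2, h3⟩ := γ.exists_rel
  obtain ⟨c, rfl, hc'⟩ := exists_isItinerary ho h1
  obtain ⟨d, rfl, hd'⟩ := exists_isItinerary ho h2
  rw [hc'.iter_eq, hd'.iter_eq] at h3
  have h4 : P.φ (word c)⁻¹ γ.r ∈ P.U (word d)⁻¹ := h3 ▸ P.map_mem' hd'.mem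
  refine ⟨word c * (word d)⁻¹, mem_mul hc'.mem h4, Groupoid.ext rfl ?_ ?_⟩
  · simp [toAdd_lengthHom_word, hc, sub_eq_add_neg]
  · rw [s_arrow, mul_inv_apply hc'.mem h4, h3, _root_.inv_inv, P.apply_inv hd'.mem]

variable (hss) in
/-- The element `g` of the free group such that `γ = (x, ℓ(g), g⁻¹.x)`. -/
def deg (γ : (P.toDeaconuRenault ho).Groupoid) : FreeGroup A := (exists_arrow (hss := hss) γ).choose

theorem mem_deg (γ : (P.toDeaconuRenault ho).Groupoid) : γ.r ∈ P.U (deg hss γ) :=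
  (exists_arrow γ).choose_spec.choose

theorem arrow_deg (γ : (P.toDeaconuRenault ho).Groupoid) :
    arrow hss ho (deg hss γ) γ.r (mem_deg γ) = γ := (exists_arrow γ).choose_spec.choose_spec

theorem deg_arrow {g : FreeGroup A} {x : X} (hx : x ∈ P.U g) :
    deg hss (arrow hss ho g x hx) = g := arrow_injective (arrow_deg _)

theorem arrow_of_deg {g : FreeGroup A} {γ : (P.toDeaconuRenault ho).Groupoid}
    (h : deg hss γ = g) : ∃ hx : γ.r ∈ P.U g, arrow hss ho g γ.r hx = γ := by
  subst h; exact ⟨mem_deg γ, arrow_deg γ⟩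

theorem continuous_arrow (g : FreeGroup A) :
    Continuous fun x : P.U g => arrow hss ho g x.1 x.2 := by
  obtain ⟨n, m, hl, hR⟩ := hss.exists_rel ho g
  refine continuous_iff_continuousAt.2 fun x => tendsto_of hl (hR x.1 x.2) ?_ ?_ ?_
  · exact continuous_subtype_val.tendsto x
  · exact (P.continuousOn g).domRestrict.tendsto x
  · exact Filter.Eventually.of_forall fun y => ⟨hl, hR y.1 y.2⟩

/-- The sections `x ↦ (x, ℓ(g), g⁻¹.x)` are open, as they invert the local homeomorphism `r`. -/
theorem isLocallyConstant_deg :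
    IsLocallyConstant (deg hss : (P.toDeaconuRenault ho).Groupoid → FreeGroup A) := by
  refine (IsLocallyConstant.iff_eventually_eq _).2 fun γ => ?_
  obtain ⟨n, m, hc, hR⟩ := γ.exists_rel
  obtain ⟨N, hN, hγ, hinj, -⟩ := exists_nhds γ hc hR Filter.univ_mem Filter.univ_mem
  have h1 : ∀ᶠ x : P.U (deg hss γ) in 𝓝 ⟨γ.r, mem_deg γ⟩, arrow hss ho _ x.1 x.2 ∈ N :=
    (continuous_arrow (deg hss γ)).continuousAt (hN.mem_nhds (by rwa [arrow_deg]))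
  rw [(P.isOpen_U _).isOpenEmbedding_subtypeVal.isInducing.nhds_eq_comap,
    Filter.eventually_comap] at h1
  filter_upwards [hN.mem_nhds hγ, continuous_r.continuousAt h1,
    continuous_r.continuousAt ((P.isOpen_U _).mem_nhds (mem_deg (hss := hss) γ))] with η h2 h3 h4
  have h5 : arrow hss ho _ η.r h4 = η := hinj (h3 ⟨η.r, h4⟩ rfl) h2 rfl
  rw [← h5, deg_arrow]

theorem mem_units_iff_deg {γ : (P.toDeaconuRenault ho).Groupoid} :
    γ ∈ units (P.toDeaconuRenault ho) ↔ deg hss γ = 1 := by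
  constructor
  · rintro ⟨x, rfl⟩
    refine arrow_injective (hy := P.mem_one x) ((arrow_deg _).trans (Groupoid.ext rfl ?_ ?_))
    · rw [c_arrow, map_one]; rfl
    · rw [s_arrow, inv_one, P.one_apply]; rfl
  · intro h
    obtain ⟨hx, e⟩ := arrow_of_deg h
    rw [← e]
    exact mem_units.2 ⟨by simp, by simp [P.one_apply]⟩

end PartialAction

/-! ### The convolution algebra inside the algebraic crossed product -/

namespace PartialAction

open DeaconuRenaultSystem Groupoid ConvAlg

variable {A : Type u} {X : Type v} [TopologicalSpace X] {P : PartialAction (FreeGroup A) X}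
  (hss : P.IsSemisaturated) (ho : P.IsOrthogonal)

open Classical in
/-- The coefficients of `f` along the sections of the groupoid: `f_g(x) = f(x, ℓ(g), g⁻¹.x)` for
`x ∈ U_g`, and `0` off `U_g`. -/
def coeff (f : (P.toDeaconuRenault ho).Groupoid → ℂ) (g : FreeGroup A) (x : X) : ℂ :=
  if hx : x ∈ P.U g then f (arrow hss ho g x hx) else 0

variable {hss ho}

theorem coeff_of_mem (f : (P.toDeaconuRenault ho).Groupoid → ℂ) {g : FreeGroup A} {x : X}
    (hx : x ∈ P.U g) : coeff hss ho f g x = f (arrow hss ho g x hx) := dif_pos hx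

theorem coeff_of_notMem (f : (P.toDeaconuRenault ho).Groupoid → ℂ) {g : FreeGroup A} {x : X}
    (hx : x ∉ P.U g) : coeff hss ho f g x = 0 := dif_neg hx

theorem coeff_deg (f : (P.toDeaconuRenault ho).Groupoid → ℂ)
    (γ : (P.toDeaconuRenault ho).Groupoid) : coeff hss ho f (deg hss γ) γ.r = f γ := by
  rw [coeff_of_mem f (mem_deg γ), arrow_deg]

theorem exists_eq_of_coeff_ne_zero {f : (P.toDeaconuRenault ho).Groupoid → ℂ} {g : FreeGroup A}
    {x : X} (h : coeff hss ho f g x ≠ 0) : ∃ hx : x ∈ P.U g,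
      coeff hss ho f g x = f (arrow hss ho g x hx) := by
  by_cases hx : x ∈ P.U g
  · exact ⟨hx, coeff_of_mem f hx⟩
  · exact absurd (coeff_of_notMem f hx) h

/-- The superlevel sets of the coefficients of a compactly supported function are compact, because
the functions on the groupoid of a given degree live on a clopen set. -/
theorem isCompact_coeff (f : (P.toDeaconuRenault ho).ConvAlg) (g : FreeGroup A) {ε : ℝ}
    (hε : 0 < ε) : IsCompact {x | ε ≤ ‖coeff hss ho f g x‖} := by
  have hK : IsCompact ({γ | ε ≤ ‖f γ‖} ∩ deg hss ⁻¹' {g}) := by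
    refine f.hasCompactSupport.isCompact.of_isClosed_subset
      ((isClosed_le continuous_const f.continuous.norm).inter
        (isLocallyConstant_deg.isClosed_fiber g)) fun γ hγ => subset_tsupport _ fun h => ?_
    have h1 : ε ≤ ‖f γ‖ := hγ.1
    rw [h, norm_zero] at h1
    linarith
  convert hK.image continuous_r using 1
  ext x
  constructor
  · intro hx
    have hx' : ε ≤ ‖coeff hss ho f g x‖ := hx
    obtain ⟨hxg, e⟩ := exists_eq_of_coeff_ne_zero (norm_pos_iff.1 (hε.trans_le hx'))
    exact ⟨arrow hss ho g x hxg, ⟨by rwa [e] at hx', deg_arrow hxg⟩, rfl⟩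
  · rintro ⟨γ, ⟨h1, h2⟩, rfl⟩
    obtain rfl : deg hss γ = g := h2
    change ε ≤ ‖coeff hss ho f (deg hss γ) γ.r‖
    rwa [coeff_deg]

theorem coeff_mem [T2Space X] (f : (P.toDeaconuRenault ho).ConvAlg) (g : FreeGroup A) :
    coeff hss ho f g ∈ C0On (P.U g) := by
  refine C0On.of_isCompact (P.isOpen_U g) ?_ (fun x hx => coeff_of_notMem _ hx)
    fun ε hε => isCompact_coeff f g hε
  rw [continuousOn_iff_continuous_domRestrict]
  exact (f.continuous.comp (continuous_arrow g)).congr fun x => (coeff_of_mem f x.2).symm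

theorem coeff_finite (f : (P.toDeaconuRenault ho).ConvAlg) :
    {g | coeff hss ho f g ≠ 0}.Finite := by
  have hK : (deg hss '' tsupport f).Finite := by
    let _ : TopologicalSpace (FreeGroup A) := ⊥
    have : DiscreteTopology (FreeGroup A) := ⟨rfl⟩
    exact (f.hasCompactSupport.isCompact.image isLocallyConstant_deg.continuous).finite_of_discrete
  refine hK.subset fun g hg => ?_
  obtain ⟨x, hx⟩ := Function.ne_iff.1 hg
  obtain ⟨hxg, e⟩ := exists_eq_of_coeff_ne_zero hx
  exact ⟨_, subset_tsupport _ (e ▸ hx : f (arrow hss ho g x hxg) ≠ 0), deg_arrow hxg⟩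

/-- The arrows with range `x` are indexed by the `h` with `x ∈ U_h`, which turns the convolution sum
into the sum that defines the product of the crossed product. -/
theorem coeff_mul [T2Space X] [LocallyCompactSpace X] (f f' : (P.toDeaconuRenault ho).ConvAlg)
    {g : FreeGroup A} {x : X} (hx : x ∈ P.U g) : coeff hss ho (⇑(f * f')) g x =
      ∑ᶠ h : FreeGroup A, coeff hss ho f h x * coeff hss ho f' (h⁻¹ * g) (P.φ h⁻¹ x) := by
  rw [coeff_of_mem _ hx, ConvAlg.mul_apply]
  have hinj : Function.Injective
      fun η : Fibre (arrow hss ho g x hx) => deg hss η.1 := fun η ζ h => by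
    refine Subtype.ext ?_
    rw [← arrow_deg (hss := hss) η.1, ← arrow_deg (hss := hss) ζ.1]
    exact arrow_congr _ _ h (η.2.trans ζ.2.symm)
  have hterm : ∀ η : Fibre (arrow hss ho g x hx), f η.1 * f' (ldiv _ η) =
      coeff hss ho f (deg hss η.1) x *
        coeff hss ho f' ((deg hss η.1)⁻¹ * g) (P.φ (deg hss η.1)⁻¹ x) := by
    rintro ⟨η, hη⟩
    obtain ⟨h, y, hh, rfl⟩ : ∃ h y hy, arrow hss ho h y hy = η := ⟨_, _, _, arrow_deg η⟩
    obtain rfl : y = x := hη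
    rw [deg_arrow, coeff_of_mem f hh, coeff_of_mem f' (mem_inv_mul hh hx)]
    exact congrArg (fun ζ => f (arrow hss ho h y hh) * f' ζ) (inv_mul_arrow hh hx rfl)
  simp only [hterm]
  rw [← finsum_mem_range (f := fun h => coeff hss ho f h x *
    coeff hss ho f' (h⁻¹ * g) (P.φ h⁻¹ x)) hinj, finsum_mem_def]
  refine finsum_congr fun h => ?_
  by_cases hh : h ∈ range fun η : Fibre (arrow hss ho g x hx) => deg hss η.1
  · rw [indicator_of_mem hh]
  · rw [indicator_of_notMem hh]
    by_contra h0
    obtain ⟨hxh, -⟩ := exists_eq_of_coeff_ne_zero (left_ne_zero_of_mul (Ne.symm h0))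
    exact hh ⟨⟨arrow hss ho h x hxh, rfl⟩, deg_arrow hxh⟩

variable (hss ho) in
/-- The embedding of `C_c(Γ)` into the algebraic crossed product, `f ↦ ∑_g f_g δ_g` with
`f_g(x) = f(x, ℓ(g), g⁻¹.x)`. -/
def toCrossed [T2Space X] [LocallyCompactSpace X] :
    (P.toDeaconuRenault ho).ConvAlg →⋆ₙₐ[ℂ] P.AlgCrossed where
  toFun f := AlgCrossed.mk (coeff hss ho f) (coeff_finite f) (coeff_mem f)
  map_smul' a f := by
    ext g x
    by_cases hx : x ∈ P.U g
    · simp [coeff_of_mem _ hx]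
    · simp [coeff_of_notMem _ hx]
  map_zero' := by
    ext g x
    by_cases hx : x ∈ P.U g
    · simp [coeff_of_mem _ hx]
    · simp [coeff_of_notMem _ hx]
  map_add' f f' := by
    ext g x
    by_cases hx : x ∈ P.U g
    · simp [coeff_of_mem _ hx]
    · simp [coeff_of_notMem _ hx]
  map_mul' f f' := by
    ext g x
    by_cases hx : x ∈ P.U g
    · exact coeff_mul f f' hx
    · rw [AlgCrossed.eq_zero _ hx, AlgCrossed.eq_zero _ hx]
  map_star' f := by
    ext g x
    by_cases hx : x ∈ P.U g
    · rw [AlgCrossed.star_apply_of_mem _ hx, AlgCrossed.mk_apply, AlgCrossed.mk_apply,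
        coeff_of_mem _ hx, coeff_of_mem _ (P.map_mem' hx), ConvAlg.star_apply, inv_arrow]
    · rw [AlgCrossed.eq_zero _ hx, AlgCrossed.eq_zero _ hx]

variable [T2Space X] [LocallyCompactSpace X]

theorem toCrossed_apply (f : (P.toDeaconuRenault ho).ConvAlg) (g : FreeGroup A) (x : X) :
    toCrossed hss ho f g x = coeff hss ho f g x := rfl

theorem toCrossed_deg (f : (P.toDeaconuRenault ho).ConvAlg)
    (γ : (P.toDeaconuRenault ho).Groupoid) : toCrossed hss ho f (deg hss γ) γ.r = f γ :=
  coeff_deg f γ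

theorem toCrossed_injective : Function.Injective (toCrossed hss ho) := fun f f' h => by
  ext γ
  rw [← toCrossed_deg (hss := hss) f, h, toCrossed_deg]

/-- A continuous function with compact support in `U_g` is the `g`-th coefficient of an element of
`C_c(Γ)`, whose other coefficients vanish. -/
theorem exists_toCrossed_eq_delta {g : FreeGroup A} (k : C0On (P.U g))
    {K : Set X} (hK : IsCompact K) (hKU : K ⊆ P.U g) (hk : ∀ x, x ∉ K → k.1 x = 0) :
    ∃ f, toCrossed hss ho f = AlgCrossed.delta g k := by
  classical
  let F : (P.toDeaconuRenault ho).Groupoid → ℂ := fun γ => if deg hss γ = g then k.1 γ.r else 0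
  have hF : Continuous F := by
    refine continuous_iff_continuousAt.2 fun γ => ?_
    have hev := (IsLocallyConstant.iff_eventually_eq _).1 (isLocallyConstant_deg (hss := hss)) γ
    by_cases hγ : deg hss γ = g
    · refine ((k.2.1.comp continuous_r).continuousAt (x := γ)).congr ?_
      filter_upwards [hev] with η hη
      simp [F, hη, hγ]
    · refine (continuousAt_const (y := (0 : ℂ))).congr ?_
      filter_upwards [hev] with η hη
      simp [F, hη, hγ]
  have hFK : HasCompactSupport F := by
    have h1 : IsCompact ((fun x : P.U g => arrow hss ho g x.1 x.2) '' (Subtype.val ⁻¹' K)) :=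
      ((Topology.IsInducing.subtypeVal.isCompact_preimage_iff (by simpa using hKU)).2 hK).image
        (continuous_arrow g)
    refine HasCompactSupport.intro h1 fun γ hγ => ?_
    by_contra h0
    have hd : deg hss γ = g := by
      by_contra h; exact h0 (if_neg h)
    obtain ⟨hx, e⟩ := arrow_of_deg hd
    refine hγ ⟨⟨γ.r, hx⟩, ?_, e⟩
    by_contra h
    exact h0 (by simp only [F, hd, if_true]; exact hk _ h)
  refine ⟨ConvAlg.mk F hF hFK, ?_⟩
  ext h x
  rw [toCrossed_apply]
  by_cases hx : x ∈ P.U h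
  · rw [coeff_of_mem _ hx, ConvAlg.mk_apply]
    by_cases hg : h = g
    · subst hg; simp [F, deg_arrow, AlgCrossed.delta_same]
    · simp [F, deg_arrow, hg, AlgCrossed.delta_of_ne k hg]
  · rw [coeff_of_notMem _ hx, AlgCrossed.eq_zero _ hx]

end PartialAction

/-! ### Bounds for C*-seminorms on the homogeneous components -/

namespace PartialAction

variable {G : Type u} [Group G] {X : Type v} [TopologicalSpace X] [T2Space X]
  {P : PartialAction G X} {B : Type*} [NonUnitalRing B] [StarRing B] [Module ℂ B] [StarModule ℂ B]
  [IsScalarTower ℂ B B] [SMulCommClass ℂ B B]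

/-- The elements of `B` that `Φ` maps to functions `f δ_e` form a module over the bounded continuous
functions.  Here `Φ` embeds a *-algebra `B` in the algebraic crossed product. -/
def IsDiagonalModule (Φ : B →⋆ₙₐ[ℂ] P.AlgCrossed) : Prop :=
  ∀ b : B, (∀ g, g ≠ 1 → Φ b g = 0) → ∀ w : X → ℂ, Continuous w → (∃ C, ∀ x, ‖w x‖ ≤ C) →
    ∃ u : B, (∀ g, g ≠ 1 → Φ u g = 0) ∧ ∀ x, Φ u 1 x = Φ b 1 x * w x

/-- On self-adjoint elements of the diagonal every C*-seminorm is at most the supremum norm: for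
`|h| ≤ c` the function `h ± i √(c² - h²)` has modulus `c`. -/
theorem seminorm_le_of_isSelfAdjoint {Φ : B →⋆ₙₐ[ℂ] P.AlgCrossed}
    (hΦ : Function.Injective Φ) (hmod : IsDiagonalModule Φ) (p : CStarSeminorm B) {h : B}
    (hstar : star h = h) (hu : ∀ g, g ≠ 1 → Φ h g = 0) {c : ℝ} (hc0 : 0 ≤ c)
    (hc : ∀ x, ‖Φ h 1 x‖ ≤ c) : p h ≤ c := by
  have hreal : ∀ x, star (Φ h 1 x) = Φ h 1 x := fun x => by
    rw [← AlgCrossed.star_apply_one, ← map_star, hstar]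
  let w : X → ℝ := fun x => Real.sqrt (c ^ 2 - ‖Φ h 1 x‖ ^ 2)
  have hcont := ((Φ h).mem 1).1
  have hw : Continuous w := Real.continuous_sqrt.comp (by fun_prop)
  have hwc : ∀ x, w x ≤ c := fun x => by
    refine (Real.sqrt_le_sqrt (y := c ^ 2) ?_).trans (Real.sqrt_sq hc0).le
    have := sq_nonneg ‖Φ h 1 x‖
    linarith
  obtain ⟨u, hu', hu1⟩ := hmod h hu (fun x => Φ h 1 x + Complex.I * (w x : ℂ))
    (hcont.add (continuous_const.mul (Complex.continuous_ofReal.comp hw)))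
    ⟨c + c, fun x => by
      refine (norm_add_le _ _).trans (add_le_add (hc x) ?_)
      rw [norm_mul, Complex.norm_I, one_mul, Complex.norm_real, Real.norm_of_nonneg
        (Real.sqrt_nonneg _)]
      exact hwc x⟩
  have hsu : ∀ x, star (Φ u) 1 x = Φ h 1 x * (Φ h 1 x - Complex.I * (w x : ℂ)) := fun x => by
    rw [AlgCrossed.star_apply_one, hu1]
    simp only [star_mul', star_add, hreal]
    simp only [RCLike.star_def, Complex.conj_I, Complex.conj_ofReal]
    ring
  have hsu' : ∀ g, g ≠ 1 → star (Φ u) g = 0 := fun g hg => by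
    funext x
    by_cases hx : x ∈ P.U g
    · rw [AlgCrossed.star_apply_of_mem _ hx, hu' _ (inv_ne_one.2 hg), Pi.zero_apply, star_zero]; rfl
    · exact AlgCrossed.eq_zero _ hx
  have hw2 : ∀ x, (w x : ℂ) ^ 2 = (c : ℂ) ^ 2 - Φ h 1 x ^ 2 := fun x => by
    have e1 : w x ^ 2 = c ^ 2 - ‖Φ h 1 x‖ ^ 2 := Real.sq_sqrt (by
      have := pow_le_pow_left₀ (norm_nonneg _) (hc x) 2
      linarith)
    have e2 : ((‖Φ h 1 x‖ : ℝ) : ℂ) ^ 2 = Φ h 1 x ^ 2 := by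
      have := RCLike.mul_conj (K := ℂ) (Φ h 1 x)
      rw [← RCLike.star_def, hreal] at this
      rw [sq (Φ h 1 x), this]; rfl
    rw [← e2, ← Complex.ofReal_pow, e1]
    push_cast
    ring
  refine p.le_of_unitary_trick (u := u) hc0 hstar (hΦ ?_) (hΦ ?_)
  · rw [map_add, map_star, map_smul, map_mul]
    ext g x
    rw [AlgCrossed.add_apply, AlgCrossed.smul_apply, AlgCrossed.mul_apply_of_one hu]
    by_cases hg : g = 1
    · subst hg
      rw [hsu, hu1]
      ring
    · rw [hu' g hg, hsu' g hg, hu g hg]; simp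
  · rw [map_mul, map_star, map_smul, map_mul]
    ext g x
    rw [AlgCrossed.smul_apply, AlgCrossed.mul_apply_of_one hu, AlgCrossed.mul_apply_of_one hsu']
    by_cases hg : g = 1
    · subst hg
      rw [hsu, hu1]
      linear_combination
        (-(Φ h 1 x) ^ 2 * (w x : ℂ) ^ 2) * Complex.I_sq + (Φ h 1 x) ^ 2 * hw2 x
    · rw [hu' g hg, hu g hg]; simp

/-- On a homogeneous component every C*-seminorm is at most the supremum norm, by the C*-identity
and the case of the diagonal. -/
theorem seminorm_le_of_eq_delta {Φ : B →⋆ₙₐ[ℂ] P.AlgCrossed}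
    (hΦ : Function.Injective Φ) (hmod : IsDiagonalModule Φ) (p : CStarSeminorm B) {b : B}
    {k : G} {f : C0On (P.U k)} (hb : Φ b = AlgCrossed.delta k f) {c : ℝ} (hc0 : 0 ≤ c)
    (hc : ∀ x, ‖f.1 x‖ ≤ c) : p b ≤ c := by
  refine (sq_le_sq₀ (p.nonneg b) hc0).1 ?_
  have e : Φ (star b * b) = star (AlgCrossed.delta k f) * AlgCrossed.delta k f := by
    rw [map_mul, map_star, hb]
  rw [← p.star_mul_self]
  refine seminorm_le_of_isSelfAdjoint hΦ hmod p (by rw [star_mul, star_star])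
    (fun g hg => by rw [e, AlgCrossed.star_mul_self_delta k f g hg]) (sq_nonneg c) fun x => ?_
  rw [e, AlgCrossed.mul_apply, finsum_eq_single _ k⁻¹]
  · have h2 : ‖star (AlgCrossed.delta k f) k⁻¹ x‖ ≤ c := by
      by_cases hx : x ∈ P.U k⁻¹
      · rw [AlgCrossed.star_apply_of_mem _ hx, norm_star, inv_inv, AlgCrossed.delta_same]
        exact hc _
      · rw [AlgCrossed.eq_zero _ hx, norm_zero]
        exact hc0
    rw [norm_mul, sq, inv_inv, mul_one, AlgCrossed.delta_same]
    exact mul_le_mul h2 (hc _) (norm_nonneg _) hc0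
  · intro h hne
    have : AlgCrossed.delta k f (h⁻¹ * 1) = 0 :=
      AlgCrossed.delta_of_ne f fun h' => hne (by rw [← h', mul_one, inv_inv])
    rw [this, Pi.zero_apply, mul_zero]

theorem isDiagonalModule_id : IsDiagonalModule (NonUnitalStarAlgHom.id ℂ P.AlgCrossed) := by
  intro b _ w hw ⟨C, hC⟩
  let k : C0On (P.U 1) := ⟨fun x => b 1 x * w x, C0On.of_norm_le (B := C) (b.mem 1)
    (fun x => by rw [norm_mul]; exact mul_le_mul_of_nonneg_left (hC x) (norm_nonneg _))
    (P.isOpen_U 1) (((b.mem 1).1.mul hw).continuousOn)⟩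
  exact ⟨AlgCrossed.delta 1 k, fun g hg => AlgCrossed.delta_of_ne k hg, fun x => by
    simp [AlgCrossed.delta_same, k]⟩

theorem norm_delta_le {k : G} (f : C0On (P.U k)) {c : ℝ} (hc0 : 0 ≤ c)
    (hc : ∀ x, ‖f.1 x‖ ≤ c) : ‖P.delta k f‖ ≤ c :=
  (CStarSeminorm.Completion.norm_of _ _).trans_le
    (seminorm_le_of_eq_delta (Φ := NonUnitalStarAlgHom.id ℂ P.AlgCrossed)
      (fun _ _ h => h) isDiagonalModule_id _ rfl hc0 hc)

end PartialAction

namespace PartialAction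

open DeaconuRenaultSystem Groupoid

variable {A : Type u} {X : Type v} [TopologicalSpace X] [T2Space X] [LocallyCompactSpace X]
  {P : PartialAction (FreeGroup A) X} {hss : P.IsSemisaturated} {ho : P.IsOrthogonal}

theorem isDiagonalModule_toCrossed : IsDiagonalModule (toCrossed hss ho) := by
  intro b _ w hw ⟨C, hC⟩
  let k : C0On (P.U 1) := ⟨fun x => toCrossed hss ho b 1 x * w x, C0On.of_norm_le (B := C)
    ((toCrossed hss ho b).mem 1)
    (fun x => by rw [norm_mul]; exact mul_le_mul_of_nonneg_left (hC x) (norm_nonneg _))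
    (P.isOpen_U 1) ((((toCrossed hss ho b).mem 1).1.mul hw).continuousOn)⟩
  obtain ⟨u, hu⟩ := exists_toCrossed_eq_delta (hss := hss) (ho := ho) k
    (b.hasCompactSupport.isCompact.image continuous_r) (by rw [P.U_one]; exact subset_univ _)
    fun x hx => by
      have : toCrossed hss ho b 1 x = 0 := by
        by_contra h
        obtain ⟨hx1, e⟩ := exists_eq_of_coeff_ne_zero h
        exact hx ⟨arrow hss ho 1 x hx1, subset_tsupport _ fun h0 => h (e.trans h0), rfl⟩
      simp [k, this]
  exact ⟨u, fun g hg => by rw [hu, AlgCrossed.delta_of_ne k hg], fun x => by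
    rw [hu]; simp [AlgCrossed.delta_same, k]⟩

theorem norm_of_le_of_toCrossed_eq_delta {f : (P.toDeaconuRenault ho).ConvAlg} {g : FreeGroup A}
    {k : C0On (P.U g)} (hf : toCrossed hss ho f = AlgCrossed.delta g k) {c : ℝ} (hc0 : 0 ≤ c)
    (hc : ∀ x, ‖k.1 x‖ ≤ c) : ‖EnvelopingCStarAlgebra.of f‖ ≤ c :=
  (CStarSeminorm.Completion.norm_of _ _).trans_le
    (seminorm_le_of_eq_delta toCrossed_injective isDiagonalModule_toCrossed _ hf hc0 hc)

end PartialAction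

/-! ### Extension of *-homomorphisms from a dense *-subalgebra -/

section Extension

variable {A : Type*} [NonUnitalSeminormedRing A] [StarRing A] [NormedStarGroup A] [NormedSpace ℂ A]
  {B : Type*} [NonUnitalRing B] [StarRing B] [Module ℂ B]
  {C : Type*} [NonUnitalCStarAlgebra C]

/-- A *-homomorphism on a dense *-subalgebra of a normed *-algebra extends if it is bounded by the
norm. -/
theorem exists_starAlgHom_extend (Φ : B →⋆ₙₐ[ℂ] A) (hΦ : DenseRange Φ) (ψ : B →⋆ₙₐ[ℂ] C)
    (hψ : ∀ b, ‖ψ b‖ ≤ ‖Φ b‖) : ∃ Ψ : A →⋆ₙₐ[ℂ] C, ∀ b, Ψ (Φ b) = ψ b := by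
  let e : B →ₗ[ℂ] A :=
    { toFun := Φ, map_add' := map_add Φ, map_smul' := map_smul Φ }
  let f : B →ₗ[ℂ] C :=
    { toFun := ψ, map_add' := map_add ψ, map_smul' := map_smul ψ }
  let T : A →L[ℂ] C := f.extendOfNorm e
  have hT : ∀ b, T (Φ b) = ψ b := fun b =>
    LinearMap.extendOfNorm_eq (f := f) (e := e) hΦ ⟨1, fun b => by rw [one_mul]; exact hψ b⟩ b
  have hc := T.continuous
  refine ⟨{ toFun := T, map_smul' := map_smul T, map_zero' := map_zero T, map_add' := map_add T
            map_mul' := fun x y => ?_, map_star' := fun x => ?_ }, hT⟩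
  · refine hΦ.induction_on₂ (p := fun x y => T (x * y) = T x * T y)
      (isClosed_eq (by fun_prop) (by fun_prop)) (fun a b => ?_) x y
    rw [← map_mul, hT, hT, hT, map_mul]
  · refine hΦ.induction_on (p := fun x => T (star x) = star (T x)) x
      (isClosed_eq (by fun_prop) (by fun_prop)) fun a => ?_
    rw [← map_star, hT, hT, map_star]

/-- The C*-seminorm `b ↦ ‖ψ b‖` of a *-homomorphism into a C*-algebra. -/
def CStarSeminorm.ofStarAlgHom (ψ : B →⋆ₙₐ[ℂ] C) : CStarSeminorm B where
  toFun b := ‖ψ b‖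
  map_zero' := by simp
  add_le' a b := by rw [map_add]; exact norm_add_le _ _
  neg' a := by simp
  smul' c a := by rw [map_smul, norm_smul]
  mul_le' a b := by rw [map_mul]; exact norm_mul_le _ _
  star_mul_self' a := by rw [map_mul, map_star, CStarRing.norm_star_mul_self, sq]

theorem EnvelopingCStarAlgebra.norm_apply_le_norm_of [HasCStarEnvelope B] (ψ : B →⋆ₙₐ[ℂ] C)
    (b : B) : ‖ψ b‖ ≤ ‖EnvelopingCStarAlgebra.of b‖ :=
  have h : ‖ψ b‖ ≤ maxCStarSeminorm B b :=
    le_ciSup (HasCStarEnvelope.bddAbove b) (CStarSeminorm.ofStarAlgHom ψ)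
  h.trans_eq (CStarSeminorm.Completion.norm_of (maxCStarSeminorm B) b).symm

theorem isometry_starAlgEquiv {B C : Type*} [NonUnitalCStarAlgebra B] [NonUnitalCStarAlgebra C]
    (e : B ≃⋆ₐ[ℂ] C) : Isometry e :=
  AddMonoidHomClass.isometry_of_norm _ fun b => StarAlgEquiv.norm_map e b

end Extension

/-! ### The `ℓ¹`-norm on the algebraic crossed product -/

namespace PartialAction.AlgCrossed

variable {G : Type u} [Group G] {X : Type v} [TopologicalSpace X] {P : PartialAction G X}

/-- The supremum norm of a function; it is `0` by convention if the function is unbounded. -/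
def supNorm {Y : Type*} (f : Y → ℂ) : ℝ := ⨆ x, ‖f x‖

theorem supNorm_nonneg {Y : Type*} (f : Y → ℂ) : 0 ≤ supNorm f :=
  Real.iSup_nonneg fun _ => norm_nonneg _

theorem supNorm_le {Y : Type*} {f : Y → ℂ} {c : ℝ} (hc : 0 ≤ c) (h : ∀ x, ‖f x‖ ≤ c) :
    supNorm f ≤ c :=
  Real.iSup_le h hc

theorem norm_le_supNorm {U : Set X} {f : X → ℂ} (hf : f ∈ C0On U) (x : X) :
    ‖f x‖ ≤ supNorm f := by
  obtain ⟨c, -, hc⟩ := C0On.exists_bound hf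
  exact le_ciSup (f := fun x => ‖f x‖) ⟨c, by rintro _ ⟨x, rfl⟩; exact hc x⟩ x

@[simp] theorem supNorm_zero {Y : Type*} : supNorm (0 : Y → ℂ) = 0 := by simp [supNorm]

theorem finite_supNorm (F : P.AlgCrossed) : (Function.support fun g => supNorm (F g)).Finite :=
  F.finite.subset fun g hg h => hg (by simp [h])

/-- The `ℓ¹`-norm `∑_g ‖F_g‖_∞`. -/
def ellOne (F : P.AlgCrossed) : ℝ := ∑ᶠ g, supNorm (F g)

theorem delta_sub (g : G) (f k : C0On (P.U g)) :
    delta g (f - k) = delta g f - delta g k := by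
  rw [eq_sub_iff_add_eq]
  ext h x
  by_cases hg : h = g
  · subst hg; simp [delta_same]
  · simp [delta_of_ne _ hg]

theorem star_delta [T2Space X] {g h : G} (e : h = g⁻¹) (f : C0On (P.U g)) :
    ∃ f' : C0On (P.U h), star (delta g f) = delta h f' := by
  subst e
  refine ⟨⟨star (delta g f) g⁻¹, (star (delta g f)).mem g⁻¹⟩, ?_⟩
  ext h x
  by_cases hh : h = g⁻¹
  · subst hh; rw [delta_same]
  · rw [delta_of_ne _ hh]
    by_cases hx : x ∈ P.U h
    · rw [star_apply_of_mem _ hx, delta_of_ne _ fun e => hh (by rw [← e, inv_inv])]; simp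
    · rw [eq_zero _ hx]; rfl

theorem ellOne_delta (g : G) (f : C0On (P.U g)) : ellOne (delta g f) = supNorm f.1 := by
  rw [ellOne, finsum_eq_single _ g, delta_same]
  intro h hne
  rw [delta_of_ne f hne, supNorm_zero]

theorem ellOne_zero : ellOne (0 : P.AlgCrossed) = 0 :=
  finsum_eq_zero_of_forall_eq_zero fun _ => supNorm_zero

theorem ellOne_add_le (F H : P.AlgCrossed) : ellOne (F + H) ≤ ellOne F + ellOne H := by
  rw [ellOne, ellOne, ellOne, ← finsum_add_distrib (finite_supNorm F) (finite_supNorm H)]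
  refine finsum_le_finsum' (finite_supNorm _) (((finite_supNorm F).union (finite_supNorm H)).subset
    (Function.support_add _ _)) fun g => ?_
  refine supNorm_le (add_nonneg (supNorm_nonneg _) (supNorm_nonneg _)) fun x => ?_
  exact (norm_add_le _ _).trans (add_le_add (norm_le_supNorm (F.mem g) x)
    (norm_le_supNorm (H.mem g) x))

theorem ellOne_smul (c : ℂ) (F : P.AlgCrossed) : ellOne (c • F) = ‖c‖ * ellOne F := by
  rw [ellOne, ellOne, mul_finsum]
  refine finsum_congr fun g => ?_
  simp only [supNorm, smul_apply, norm_mul]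
  exact (Real.mul_iSup_of_nonneg (norm_nonneg c) _).symm

theorem eq_sum_delta (F : P.AlgCrossed) :
    F = ∑ g ∈ F.finite.toFinset, delta g ⟨F g, F.mem g⟩ := by
  ext h x
  have hsum : ∀ s : Finset G, (∑ g ∈ s, delta g ⟨F g, F.mem g⟩ : P.AlgCrossed) h x =
      ∑ g ∈ s, delta g ⟨F g, F.mem g⟩ h x := fun s => by
    induction s using Finset.cons_induction with
    | empty => rfl
    | cons a s ha ih => rw [Finset.sum_cons, Finset.sum_cons, add_apply, ih]
  rw [hsum, Finset.sum_eq_single h]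
  · rw [delta_same]
  · intro g _ hg
    rw [delta_of_ne _ hg.symm]; rfl
  · intro hh
    have : F h = 0 := by simpa using hh
    rw [delta_same]
    exact congrFun this x

theorem ellOne_eq_sum (F : P.AlgCrossed) : ellOne F = ∑ g ∈ F.finite.toFinset, supNorm (F g) :=
  finsum_eq_sum_of_support_subset _ fun g hg => by
    simp only [Set.Finite.coe_toFinset, mem_ofPred_eq]
    exact fun h => hg (by simp [h])

theorem ellOne_delta_mul_le (k : G) (f : C0On (P.U k)) (H : P.AlgCrossed) :
    ellOne (delta k f * H) ≤ supNorm f.1 * ellOne H := by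
  have e : ellOne H = ∑ᶠ g, supNorm (H (k⁻¹ * g)) :=
    (finsum_eq_of_bijective (fun g => k⁻¹ * g) (Group.mulLeft_bijective k⁻¹) fun g => rfl).symm
  have hfin : (Function.support fun g => supNorm (H (k⁻¹ * g))).Finite :=
    (finite_supNorm H).preimage (Group.mulLeft_bijective k⁻¹).injective.injOn
  rw [e, mul_finsum]
  refine finsum_le_finsum' (finite_supNorm _)
    (hfin.subset fun g hg => right_ne_zero_of_mul hg) fun g => ?_
  refine supNorm_le (mul_nonneg (supNorm_nonneg _) (supNorm_nonneg _)) fun x => ?_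
  rw [delta_mul_apply, norm_mul]
  exact mul_le_mul (norm_le_supNorm f.2 x) (norm_le_supNorm (H.mem _) _) (norm_nonneg _)
    (supNorm_nonneg _)

theorem ellOne_sum_le {ι : Type*} (s : Finset ι) (F : ι → P.AlgCrossed) :
    ellOne (∑ i ∈ s, F i) ≤ ∑ i ∈ s, ellOne (F i) := by
  induction s using Finset.cons_induction with
  | empty => simp [ellOne_zero]
  | cons a s ha ih =>
    rw [Finset.sum_cons, Finset.sum_cons]
    exact (ellOne_add_le _ _).trans (add_le_add le_rfl ih)

theorem ellOne_mul_le (F H : P.AlgCrossed) : ellOne (F * H) ≤ ellOne F * ellOne H := by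
  conv_lhs => rw [eq_sum_delta F]
  rw [Finset.sum_mul, ellOne_eq_sum F, Finset.sum_mul]
  exact (ellOne_sum_le _ _).trans (Finset.sum_le_sum fun g _ => ellOne_delta_mul_le g _ H)

theorem ellOne_star_le [T2Space X] (F : P.AlgCrossed) : ellOne (star F) ≤ ellOne F := by
  have e : ellOne F = ∑ᶠ g, supNorm (F g⁻¹) :=
    (finsum_eq_of_bijective (fun g => g⁻¹) inv_involutive.bijective fun g => rfl).symm
  rw [e]
  refine finsum_le_finsum' (finite_supNorm _) ((finite_supNorm F).preimage inv_injective.injOn)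
    fun g => supNorm_le (supNorm_nonneg _) fun x => ?_
  by_cases hx : x ∈ P.U g
  · rw [star_apply_of_mem _ hx, norm_star]
    exact norm_le_supNorm (F.mem _) _
  · rw [eq_zero _ hx, norm_zero]
    exact supNorm_nonneg _

variable (P) in
/-- The algebraic crossed product with the `ℓ¹`-norm, as a normed ring. -/
@[reducible] def ellOneRing : NonUnitalSeminormedRing P.AlgCrossed :=
  { AddGroupSeminorm.toSeminormedAddCommGroup
      ({ toFun := ellOne, map_zero' := ellOne_zero, add_le' := ellOne_add_le
         neg' := fun F => by rw [← neg_one_smul ℂ F, ellOne_smul]; simp } :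
        AddGroupSeminorm P.AlgCrossed),
    (inferInstance : NonUnitalRing P.AlgCrossed) with
    norm_mul_le := ellOne_mul_le }

/-- Cutting off a function in `C₀(U)` where it is small gives a uniform approximation by continuous
functions with compact support in `U`. -/
theorem exists_cutoff {U : Set X} (f : C0On U) {ε : ℝ} (hε : 0 < ε) :
    ∃ (k : C0On U) (K : Set X), IsCompact K ∧ K ⊆ U ∧ (∀ x, x ∉ K → k.1 x = 0) ∧
      ∀ x, ‖(k - f).1 x‖ ≤ 2 * ε := by
  let m : X → ℝ := fun x => min 1 (max 0 (‖f.1 x‖ / ε - 1))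
  have hm0 : ∀ x, 0 ≤ m x := fun x => le_min zero_le_one (le_max_left _ _)
  have hm1 : ∀ x, m x ≤ 1 := fun x => min_le_left _ _
  have hfc := f.2.1
  have hm : Continuous m := by fun_prop
  have hk : ∀ x, x ∉ {x | ε ≤ ‖f.1 x‖} → f.1 x * (m x : ℂ) = 0 := fun x hx => by
    have h1 : ‖f.1 x‖ / ε - 1 ≤ 0 := by
      rw [sub_nonpos, div_le_one hε]; exact (not_le.1 hx).le
    simp [m, max_eq_left h1]
  refine ⟨⟨fun x => f.1 x * (m x : ℂ), hfc.mul (Complex.continuous_ofReal.comp hm), ?_, ?_⟩,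
    {x | ε ≤ ‖f.1 x‖}, C0On.isCompact_le f.2 hε, fun x hx => ?_, hk, fun x => ?_⟩
  · refine squeeze_zero_norm (fun x => ?_) (tendsto_zero_iff_norm_tendsto_zero.1 f.2.2.1)
    rw [norm_mul, Complex.norm_real, Real.norm_of_nonneg (hm0 x)]
    exact mul_le_of_le_one_right (norm_nonneg _) (hm1 x)
  · intro x hx
    simp [f.2.2.2 x hx]
  · by_contra h
    have hx' : ε ≤ ‖f.1 x‖ := hx
    rw [f.2.2.2 x h, norm_zero] at hx'
    linarith
  · change ‖f.1 x * (m x : ℂ) - f.1 x‖ ≤ 2 * ε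
    have e : f.1 x * (m x : ℂ) - f.1 x = f.1 x * ((m x - 1 : ℝ) : ℂ) := by push_cast; ring
    rw [e, norm_mul, Complex.norm_real, Real.norm_of_nonpos (by linarith [hm1 x])]
    by_cases h : ‖f.1 x‖ ≤ 2 * ε
    · exact (mul_le_of_le_one_right (norm_nonneg _) (by linarith [hm0 x])).trans h
    · have : m x = 1 := by
        have : 2 ≤ ‖f.1 x‖ / ε := by rw [le_div_iff₀ hε]; exact (not_le.1 h).le
        exact min_eq_left (le_max_of_le_right (by linarith))
      rw [this]; simp; positivity

end PartialAction.AlgCrossed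

/-! ### The isomorphism -/

namespace PartialAction

open DeaconuRenaultSystem Groupoid AlgCrossed

section Bound

variable {G : Type u} [Group G] {X : Type v} [TopologicalSpace X] [T2Space X]
  {P : PartialAction G X}

theorem norm_delta_le_supNorm {g : G} (f : C0On (P.U g)) : ‖P.delta g f‖ ≤ supNorm f.1 :=
  norm_delta_le f (supNorm_nonneg _) (norm_le_supNorm f.2)

theorem norm_of_le_ellOne (F : P.AlgCrossed) :
    ‖(EnvelopingCStarAlgebra.of F : P.CrossedProduct)‖ ≤ ellOne F := by
  conv_lhs => rw [eq_sum_delta F]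
  rw [map_sum, ellOne_eq_sum]
  exact (norm_sum_le _ _).trans (Finset.sum_le_sum fun g _ => norm_delta_le_supNorm _)

end Bound

variable {A : Type u} {X : Type v} [TopologicalSpace X] [T2Space X] [LocallyCompactSpace X]
  {P : PartialAction (FreeGroup A) X} {hss : P.IsSemisaturated} {ho : P.IsOrthogonal}

variable (hss) in
/-- The homogeneous parts of `f` are again in `C_c(Γ)`, and `seminorm_le_of_eq_delta` applies to each
of them. -/
theorem norm_of_le_ellOne_toCrossed (f : (P.toDeaconuRenault ho).ConvAlg) :
    ‖EnvelopingCStarAlgebra.of f‖ ≤ ellOne (toCrossed hss ho f) := by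
  set F := toCrossed hss ho f with hF
  have key : ∀ g, ∃ f' : (P.toDeaconuRenault ho).ConvAlg,
      toCrossed hss ho f' = AlgCrossed.delta g ⟨F g, F.mem g⟩ := fun g => by
    refine exists_toCrossed_eq_delta _ (K := r '' (tsupport f ∩ deg hss ⁻¹' {g}))
      ((f.hasCompactSupport.isCompact.inter_right
        (isLocallyConstant_deg.isClosed_fiber g)).image continuous_r) ?_ fun x hx => ?_
    · rintro _ ⟨γ, ⟨-, hγ⟩, rfl⟩
      exact (arrow_of_deg hγ).1
    · by_contra h
      obtain ⟨hxg, e⟩ := exists_eq_of_coeff_ne_zero (f := f) (g := g) (x := x) h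
      exact hx ⟨arrow hss ho g x hxg, ⟨subset_tsupport _ fun h0 => h (e.trans h0),
        deg_arrow hxg⟩, rfl⟩
  choose f' hf' using key
  have hf : f = ∑ g ∈ F.finite.toFinset, f' g := toCrossed_injective (hss := hss) (by
    rw [map_sum, ← hF]
    simp only [hf']
    exact eq_sum_delta F)
  rw [ellOne_eq_sum]
  conv_lhs => rw [hf]
  rw [map_sum]
  exact (norm_sum_le _ _).trans (Finset.sum_le_sum fun g _ =>
    norm_of_le_of_toCrossed_eq_delta (hf' g) (supNorm_nonneg _) (norm_le_supNorm (F.mem g)))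

variable (hss ho) in
/-- `C_c(Γ)` is dense in the algebraic crossed product for the `ℓ¹`-norm. -/
theorem exists_ellOne_toCrossed_sub_lt (F : P.AlgCrossed) {ε : ℝ} (hε : 0 < ε) :
    ∃ f, ellOne (toCrossed hss ho f - F) < ε := by
  induction F using AlgCrossed.induction_delta generalizing ε with
  | h0 => exact ⟨0, by simpa [ellOne_zero] using hε⟩
  | hadd F H hF hH =>
    obtain ⟨f, hf⟩ := hF (half_pos hε)
    obtain ⟨h, hh⟩ := hH (half_pos hε)
    refine ⟨f + h, ?_⟩
    rw [map_add, add_sub_add_comm]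
    exact (ellOne_add_le _ _).trans_lt (by linarith)
  | hd g f =>
    obtain ⟨k, K, hK, hKU, hk, hkf⟩ := exists_cutoff f (ε := ε / 4) (by positivity)
    obtain ⟨f', hf'⟩ := exists_toCrossed_eq_delta (hss := hss) (ho := ho) k hK hKU hk
    refine ⟨f', ?_⟩
    rw [hf', ← delta_sub, ellOne_delta]
    exact (supNorm_le (by positivity) hkf).trans_lt (by linarith)

/-- The embedding of `C_c(Γ)` into the algebraic crossed product preserves the largest C*-seminorm:
as `C_c(Γ)` is dense for the `ℓ¹`-norm, which dominates its C*-seminorms, its canonical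
homomorphism to `C*(Γ)` extends to the algebraic crossed product. -/
theorem norm_of_toCrossed (f : (P.toDeaconuRenault ho).ConvAlg) :
    ‖(EnvelopingCStarAlgebra.of (toCrossed hss ho f) : P.CrossedProduct)‖ =
      ‖EnvelopingCStarAlgebra.of f‖ := by
  refine le_antisymm ?_ ?_
  · exact (CStarSeminorm.Completion.norm_of _ _).trans_le
      ((EnvelopingCStarAlgebra.maxCStarSeminorm_map_le (toCrossed hss ho) f).trans_eq
        (CStarSeminorm.Completion.norm_of _ _).symm)
  · let _ : NonUnitalSeminormedRing P.AlgCrossed := ellOneRing P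
    have _ : NormedStarGroup P.AlgCrossed := ⟨ellOne_star_le⟩
    let _ : NormedSpace ℂ P.AlgCrossed := ⟨fun c F => (ellOne_smul c F).le⟩
    obtain ⟨Ψ, hΨ⟩ := exists_starAlgHom_extend (toCrossed hss ho)
      (Metric.denseRange_iff.2 fun F ε hε => by
        obtain ⟨f, hf⟩ := exists_ellOne_toCrossed_sub_lt hss ho F hε
        exact ⟨f, by rw [dist_comm, dist_eq_norm]; exact hf⟩)
      (EnvelopingCStarAlgebra.of (A := (P.toDeaconuRenault ho).ConvAlg))
      (norm_of_le_ellOne_toCrossed hss)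
    rw [← hΨ]
    exact EnvelopingCStarAlgebra.norm_apply_le_norm_of Ψ _

variable (hss ho) in
/-- The *-homomorphism `C*(Γ(X, σ)) → C₀(X) ⋊ 𝔽` that extends the embedding of `C_c(Γ)`. -/
def piHom : (P.toDeaconuRenault ho).GroupoidCStarAlgebra →⋆ₙₐ[ℂ] P.CrossedProduct :=
  EnvelopingCStarAlgebra.map (toCrossed hss ho)

theorem piHom_of (f : (P.toDeaconuRenault ho).ConvAlg) :
    piHom hss ho (EnvelopingCStarAlgebra.of f) =
      EnvelopingCStarAlgebra.of (toCrossed hss ho f) := EnvelopingCStarAlgebra.map_of _ f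

theorem isometry_piHom : Isometry (piHom hss ho) := by
  refine AddMonoidHomClass.isometry_of_norm _ fun x => ?_
  have hc : Continuous (piHom hss ho) := EnvelopingCStarAlgebra.continuous_map _
  induction x using CStarSeminorm.Completion.induction_on with
  | hp => exact isClosed_eq hc.norm continuous_norm
  | h f => exact (congrArg norm (piHom_of f)).trans (norm_of_toCrossed f)

theorem denseRange_of_toCrossed : DenseRange fun f =>
    (EnvelopingCStarAlgebra.of (toCrossed hss ho f) : P.CrossedProduct) := by
  refine Metric.denseRange_iff.2 fun b ε hε => ?_
  obtain ⟨F, hF⟩ := Metric.denseRange_iff.1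
    (EnvelopingCStarAlgebra.denseRange_of (A := P.AlgCrossed)) b (ε / 2) (half_pos hε)
  obtain ⟨f, hf⟩ := exists_ellOne_toCrossed_sub_lt hss ho F (half_pos hε)
  refine ⟨f, (dist_triangle _ (EnvelopingCStarAlgebra.of F) _).trans_lt ?_⟩
  have h2 : dist (EnvelopingCStarAlgebra.of F : P.CrossedProduct)
      (EnvelopingCStarAlgebra.of (toCrossed hss ho f)) < ε / 2 := by
    rw [dist_comm, dist_eq_norm, ← map_sub]
    exact (norm_of_le_ellOne _).trans_lt hf
  linarith

theorem bijective_piHom : Function.Bijective (piHom hss ho) := by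
  refine ⟨isometry_piHom.injective, fun b => ?_⟩
  have h1 : IsClosed (range (piHom hss ho)) := isometry_piHom.isClosedEmbedding.isClosed_range
  have h2 : DenseRange (piHom hss ho) := by
    refine (denseRange_of_toCrossed (hss := hss) (ho := ho)).mono ?_
    rintro _ ⟨f, rfl⟩
    exact ⟨_, piHom_of f⟩
  have : b ∈ closure (range (piHom hss ho)) := h2 b
  rwa [h1.closure_eq] at this

variable (hss ho) in
/-- The isomorphism `C*(Γ(X, σ)) ≅ C₀(X) ⋊ 𝔽`. -/
def piEquiv : (P.toDeaconuRenault ho).GroupoidCStarAlgebra ≃⋆ₐ[ℂ] P.CrossedProduct :=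
  StarAlgEquiv.ofBijective (piHom hss ho) bijective_piHom

theorem piEquiv_of (f : (P.toDeaconuRenault ho).ConvAlg) :
    piEquiv hss ho (EnvelopingCStarAlgebra.of f) =
      EnvelopingCStarAlgebra.of (toCrossed hss ho f) := piHom_of f

theorem isometry_piEquiv : Isometry (piEquiv hss ho) := isometry_piHom

theorem toCrossed_gaugeHom (z : Circle) (f : (P.toDeaconuRenault ho).ConvAlg) :
    toCrossed hss ho (ConvAlg.gaugeHom z f) = dualHom (lengthHom A) z (toCrossed hss ho f) := by
  ext g x
  rw [dualHom_apply, toCrossed_apply, toCrossed_apply]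
  by_cases hx : x ∈ P.U g
  · rw [coeff_of_mem _ hx, coeff_of_mem _ hx, ConvAlg.gaugeHom_apply, c_arrow]
  · rw [coeff_of_notMem _ hx, coeff_of_notMem _ hx, mul_zero]

theorem piEquiv_gaugeAction (z : Circle) (b : (P.toDeaconuRenault ho).GroupoidCStarAlgebra) :
    piEquiv hss ho ((P.toDeaconuRenault ho).gaugeAction z b) =
      P.circleAction z (piEquiv hss ho b) := by
  have h1 := (isometry_starAlgEquiv ((P.toDeaconuRenault ho).gaugeAction z)).continuous
  have h2 := (isometry_starAlgEquiv (P.circleAction z)).continuous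
  have h3 := (isometry_piEquiv (hss := hss) (ho := ho)).continuous
  refine congrFun ((EnvelopingCStarAlgebra.denseRange_of).equalizer (h3.comp h1) (h2.comp h3)
    (funext fun f => ?_)) b
  simp only [Function.comp_apply]
  rw [gaugeAction_of, piEquiv_of, piEquiv_of, circleAction_of, toCrossed_gaugeHom]

end PartialAction

/-! ### The representation on `ℓ²(X)` and the diagonal -/

namespace PartialAction.AlgCrossed

variable {G : Type u} [Group G] {X : Type v} [TopologicalSpace X] {P : PartialAction G X}

/-- The action of the algebraic crossed product on functions, `(F ξ)(y) = ∑_g F_g(y) ξ(g⁻¹.y)`. -/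
def act (F : P.AlgCrossed) (ξ : X → ℂ) (y : X) : ℂ := ∑ᶠ g : G, F g y * ξ (P.φ g⁻¹ y)

theorem act_add_left (F H : P.AlgCrossed) (ξ : X → ℂ) (y : X) :
    act (F + H) ξ y = act F ξ y + act H ξ y := by
  simp only [act, add_apply, add_mul]
  exact finsum_add_distrib (finite_support F _ y) (finite_support H _ y)

theorem act_smul_left (c : ℂ) (F : P.AlgCrossed) (ξ : X → ℂ) (y : X) :
    act (c • F) ξ y = c * act F ξ y := by
  simp only [act, smul_apply, mul_assoc]
  exact (mul_finsum _ _).symm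

theorem act_zero_left (ξ : X → ℂ) (y : X) : act (0 : P.AlgCrossed) ξ y = 0 := by simp [act]

theorem act_add_right (F : P.AlgCrossed) (ξ η : X → ℂ) (y : X) :
    act F (ξ + η) y = act F ξ y + act F η y := by
  simp only [act, Pi.add_apply, mul_add]
  exact finsum_add_distrib (finite_support F _ y) (finite_support F _ y)

theorem act_smul_right (c : ℂ) (F : P.AlgCrossed) (ξ : X → ℂ) (y : X) :
    act F (c • ξ) y = c * act F ξ y := by
  simp only [act, Pi.smul_apply, smul_eq_mul, mul_left_comm _ c]
  exact (mul_finsum _ _).symm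

theorem act_delta (g : G) (f : C0On (P.U g)) (ξ : X → ℂ) (y : X) :
    act (delta g f) ξ y = f.1 y * ξ (P.φ g⁻¹ y) := by
  rw [act, finsum_eq_single _ g, delta_same]
  intro h hne
  rw [delta_of_ne f hne, Pi.zero_apply, zero_mul]

theorem act_mul (F H : P.AlgCrossed) (ξ : X → ℂ) (y : X) :
    act (F * H) ξ y = act F (act H ξ) y := by
  induction F using induction_delta with
  | h0 => rw [zero_mul, act_zero_left, act_zero_left]
  | hadd F F' h1 h2 => rw [add_mul, act_add_left, act_add_left, h1, h2]
  | hd k f =>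
    rw [act_delta, act, act, mul_finsum]
    refine (finsum_eq_of_bijective (fun l => k * l) (Group.mulLeft_bijective k) fun l => ?_).symm
    rw [delta_mul_apply, inv_mul_cancel_left, mul_assoc]
    by_cases h1 : y ∈ P.U k
    · by_cases h2 : P.φ k⁻¹ y ∈ P.U l
      · rw [mul_inv_apply h1 h2]
      · rw [H.eq_zero h2]; simp
    · rw [f.2.2.2 y h1]; simp

theorem injOn_inv (g : G) : InjOn (P.φ g⁻¹) (P.U g) := fun x hx y hy h => by
  rw [← P.apply_inv hx, h, P.apply_inv hy]

/-- The operators on `ℓ²(X)` are bounded: a summand `f δ_g` acts by an injective substitution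
followed by the multiplication with a bounded function. -/
theorem exists_lp_act (F : P.AlgCrossed) : ∃ C : ℝ, ∀ ξ : lp (fun _ : X => ℂ) 2,
    ∃ η : lp (fun _ : X => ℂ) 2, (∀ y, η y = act F ξ y) ∧ ‖η‖ ≤ C * ‖ξ‖ := by
  classical
  induction F using induction_delta with
  | h0 => exact ⟨0, fun ξ => ⟨0, fun y => by rw [act_zero_left]; rfl, by simp⟩⟩
  | hadd F H hF hH =>
    obtain ⟨a, ha⟩ := hF
    obtain ⟨b, hb⟩ := hH
    refine ⟨a + b, fun ξ => ?_⟩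
    obtain ⟨η, h1, h2⟩ := ha ξ
    obtain ⟨ζ, h3, h4⟩ := hb ξ
    refine ⟨η + ζ, fun y => by rw [act_add_left, ← h1, ← h3]; rfl, ?_⟩
    rw [add_mul]
    exact (norm_add_le _ _).trans (add_le_add h2 h4)
  | hd g f =>
    obtain ⟨c, hc0, hc⟩ := C0On.exists_bound f.2
    have hp : 0 < (2 : ENNReal).toReal := by norm_num
    have key : ∀ (ξ : lp (fun _ : X => ℂ) 2) (s : Finset X),
        ∑ y ∈ s, ‖act (delta g f) ξ y‖ ^ (2 : ENNReal).toReal ≤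
          (c * ‖ξ‖) ^ (2 : ENNReal).toReal := fun ξ s => by
      have h1 : ∑ y ∈ s, ‖act (delta g f) ξ y‖ ^ (2 : ENNReal).toReal =
          ∑ y ∈ s with y ∈ P.U g, ‖act (delta g f) ξ y‖ ^ (2 : ENNReal).toReal := by
        refine (Finset.sum_filter_of_ne fun y _ hy => ?_).symm
        by_contra h
        refine hy ?_
        rw [act_delta, f.2.2.2 y h, zero_mul, norm_zero, Real.zero_rpow hp.ne']
      have h2 : ∀ y, ‖act (delta g f) ξ y‖ ^ (2 : ENNReal).toReal ≤
          c ^ (2 : ENNReal).toReal * ‖ξ (P.φ g⁻¹ y)‖ ^ (2 : ENNReal).toReal := fun y => by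
        rw [← Real.mul_rpow hc0 (norm_nonneg _), act_delta, norm_mul]
        exact Real.rpow_le_rpow (by positivity)
          (mul_le_mul_of_nonneg_right (hc y) (norm_nonneg _)) hp.le
      have h3 : ∑ y ∈ s with y ∈ P.U g, ‖ξ (P.φ g⁻¹ y)‖ ^ (2 : ENNReal).toReal ≤
          ‖ξ‖ ^ (2 : ENNReal).toReal := by
        rw [← Finset.sum_image (s := s.filter (· ∈ P.U g)) (g := P.φ g⁻¹)
          (f := fun z => ‖ξ z‖ ^ (2 : ENNReal).toReal)
          ((injOn_inv g).mono fun y hy => (Finset.mem_filter.1 hy).2)]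
        exact lp.sum_rpow_le_norm_rpow hp ξ _
      rw [h1, Real.mul_rpow hc0 (norm_nonneg _)]
      refine (Finset.sum_le_sum fun y _ => h2 y).trans ?_
      rw [← Finset.mul_sum]
      exact mul_le_mul_of_nonneg_left h3 (Real.rpow_nonneg hc0 _)
    refine ⟨c, fun ξ => ⟨⟨fun y => act (delta g f) ξ y, memℓp_gen' (key ξ)⟩, fun y => rfl, ?_⟩⟩
    exact lp.norm_le_of_forall_sum_le hp (by positivity) (key ξ)

/-- The result of applying an element of the algebraic crossed product to a vector in `ℓ²(X)`. -/
def lpAct (F : P.AlgCrossed) (ξ : lp (fun _ : X => ℂ) 2) : lp (fun _ : X => ℂ) 2 :=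
  ((exists_lp_act F).choose_spec ξ).choose

theorem lpAct_apply (F : P.AlgCrossed) (ξ : lp (fun _ : X => ℂ) 2) (y : X) :
    lpAct F ξ y = act F ξ y := ((exists_lp_act F).choose_spec ξ).choose_spec.1 y

/-- The operator on `ℓ²(X)` given by an element of the algebraic crossed product. -/
def koopman (F : P.AlgCrossed) : lp (fun _ : X => ℂ) 2 →L[ℂ] lp (fun _ : X => ℂ) 2 :=
  LinearMap.mkContinuousOfExistsBound
    { toFun := lpAct F
      map_add' := fun ξ η => lp.ext (funext fun y => by
        rw [lp.coeFn_add, Pi.add_apply, lpAct_apply, lpAct_apply, lpAct_apply, lp.coeFn_add]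
        exact act_add_right F ξ η y)
      map_smul' := fun c ξ => lp.ext (funext fun y => by
        rw [RingHom.id_apply, lp.coeFn_smul, Pi.smul_apply, lpAct_apply, lpAct_apply,
          lp.coeFn_smul]
        exact act_smul_right c F ξ y) }
    ⟨_, fun ξ => ((exists_lp_act F).choose_spec ξ).choose_spec.2⟩

theorem koopman_apply (F : P.AlgCrossed) (ξ : lp (fun _ : X => ℂ) 2) (y : X) :
    koopman F ξ y = act F ξ y := lpAct_apply F ξ y

theorem koopman_add (F H : P.AlgCrossed) : koopman (F + H) = koopman F + koopman H := by
  ext ξ y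
  rw [koopman_apply, act_add_left, ← koopman_apply, ← koopman_apply]; rfl

theorem koopman_zero : koopman (0 : P.AlgCrossed) = 0 := by
  ext ξ y
  rw [koopman_apply, act_zero_left]; rfl

theorem mem_of_inner_ne_zero {g : G} {f : C0On (P.U g)} {ξ η : lp (fun _ : X => ℂ) 2} {x : X}
    (h : inner ℂ (ξ x) (f.1 x * η (P.φ g⁻¹ x)) ≠ 0) : x ∈ P.U g := by
  by_contra hx
  exact h (by rw [f.2.2.2 x hx]; simp)

/-- The representation on `ℓ²(X)` preserves the involution: the sum that defines the inner product is
reindexed along the bijection `g⁻¹ : U_g → U_{g⁻¹}`. -/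
theorem inner_koopman_star [T2Space X] (F : P.AlgCrossed) (ξ η : lp (fun _ : X => ℂ) 2) :
    inner ℂ (koopman (star F) ξ) η = inner ℂ ξ (koopman F η) := by
  induction F using induction_delta with
  | h0 => rw [star_zero, koopman_zero]; simp
  | hadd F H hF hH =>
    rw [star_add, koopman_add, koopman_add, _root_.add_apply,
      _root_.add_apply, inner_add_left, inner_add_right,
      hF, hH]
  | hd g f =>
    have hL : ∀ y, koopman (star (delta g f)) ξ y = star (delta g f) g⁻¹ y * ξ (P.φ g y) :=
      fun y => by
        obtain ⟨f', hf'⟩ := star_delta rfl f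
        rw [koopman_apply, hf', act_delta, inv_inv, delta_same]
    rw [lp.inner_eq_tsum, lp.inner_eq_tsum]
    simp only [hL, koopman_apply, act_delta]
    refine tsum_eq_tsum_of_ne_zero_bij (fun x => P.φ g⁻¹ x.1) ?_ ?_ ?_
    · rintro ⟨x, hx⟩ ⟨y, hy⟩ h
      exact Subtype.ext (injOn_inv g (mem_of_inner_ne_zero hx) (mem_of_inner_ne_zero hy) h)
    · intro y hy
      have hyg : y ∈ P.U g⁻¹ := by
        by_contra h
        refine hy ?_
        change inner ℂ (star (delta g f) g⁻¹ y * ξ (P.φ g y)) (η y) = 0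
        rw [eq_zero _ h]
        simp
      refine ⟨⟨P.φ g y, ?_⟩, P.inv_apply hyg⟩
      rw [Function.mem_support, P.inv_apply hyg]
      rw [Function.mem_support, star_apply_of_mem _ hyg, inv_inv, delta_same] at hy
      refine fun h0 => hy ?_
      simp only [RCLike.inner_apply, map_mul, RCLike.star_def, Complex.conj_conj] at h0 ⊢
      linear_combination h0
    · rintro ⟨x, hx⟩
      have hxg := mem_of_inner_ne_zero hx
      rw [star_apply_of_mem _ (P.map_mem' hxg), inv_inv, delta_same, P.apply_inv hxg]
      simp only [RCLike.inner_apply, map_mul, RCLike.star_def, Complex.conj_conj]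
      ring

variable (P) in
/-- The representation of the algebraic crossed product on `ℓ²(X)`. -/
def koopmanHom [T2Space X] :
    P.AlgCrossed →⋆ₙₐ[ℂ] (lp (fun _ : X => ℂ) 2 →L[ℂ] lp (fun _ : X => ℂ) 2) where
  toFun := koopman
  map_smul' c F := by
    ext ξ y
    rw [koopman_apply, act_smul_left, ← koopman_apply]; rfl
  map_zero' := koopman_zero
  map_add' := koopman_add
  map_mul' F H := by
    ext ξ y
    rw [koopman_apply, act_mul, mul_apply_eq_comp, koopman_apply]
    congr 1
    funext z
    exact (koopman_apply H ξ z).symm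
  map_star' F := by
    rw [ContinuousLinearMap.star_eq_adjoint, ContinuousLinearMap.eq_adjoint_iff]
    exact inner_koopman_star F

end PartialAction.AlgCrossed

namespace PartialAction

open AlgCrossed

variable {G : Type u} [Group G] {X : Type v} [TopologicalSpace X] [T2Space X]
  {P : PartialAction G X}

/-- `C₀(X)` embeds isometrically in the crossed product, as it acts on `ℓ²(X)` by
multiplication. -/
theorem norm_apply_le_norm_delta_one (f : C0On (P.U 1)) (x : X) : ‖f.1 x‖ ≤ ‖P.delta 1 f‖ := by
  classical
  refine le_trans ?_ (EnvelopingCStarAlgebra.norm_apply_le_norm_of (koopmanHom P) _)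
  let e : lp (fun _ : X => ℂ) 2 := lp.single 2 x (1 : ℂ)
  have he : ‖e‖ = 1 := by simp [e]
  have h1 : koopmanHom P (AlgCrossed.delta 1 f) e x = f.1 x := by
    refine (koopman_apply _ _ _).trans ?_
    rw [act_delta, inv_one, P.one_apply]
    simp [e]
  rw [← h1]
  refine (lp.norm_apply_le_norm two_ne_zero _ x).trans ?_
  simpa [he] using (koopmanHom P (AlgCrossed.delta 1 f)).le_opNorm e

/-- The diagonal is the image of the complete space `C₀(X)` under an isometry. -/
theorem isClosed_diagonal : IsClosed P.diagonal := by
  let D : C₀(X, ℂ) → P.CrossedProduct := fun F =>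
    P.delta 1 ⟨F, F.continuous, F.zero_at_infty', fun x hx => absurd (P.mem_one x) hx⟩
  have hD : Isometry D := by
    refine Isometry.of_dist_eq fun F H => ?_
    have e : D F - D H = D (F - H) := by
      refine (map_sub (EnvelopingCStarAlgebra.of (A := P.AlgCrossed)) _ _).symm.trans ?_
      rw [← AlgCrossed.delta_sub]; rfl
    rw [dist_eq_norm, dist_eq_norm, e]
    refine le_antisymm (norm_delta_le _ (norm_nonneg _) fun x => ?_) ?_
    · exact (F - H).toBCF.norm_coe_le_norm x
    · exact (BoundedContinuousFunction.norm_le (norm_nonneg _)).2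
        fun x => norm_apply_le_norm_delta_one
          (⟨F - H, (F - H).continuous, (F - H).zero_at_infty', fun x hx => absurd (P.mem_one x) hx⟩ :
            C0On (P.U 1)) x
  have hr : P.diagonal = range D := by
    refine Subset.antisymm ?_ ?_
    · rintro _ ⟨f, rfl⟩
      exact ⟨⟨⟨f.1, f.2.1⟩, f.2.2.1⟩, rfl⟩
    · rintro _ ⟨F, rfl⟩
      exact ⟨_, rfl⟩
  rw [hr]
  exact hD.isClosedEmbedding.isClosed_range

end PartialAction

namespace PartialAction

open DeaconuRenaultSystem Groupoid AlgCrossed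

variable {A : Type u} {X : Type v} [TopologicalSpace X] [T2Space X] [LocallyCompactSpace X]
  {P : PartialAction (FreeGroup A) X} {hss : P.IsSemisaturated} {ho : P.IsOrthogonal}

theorem image_diagonal :
    piEquiv hss ho '' (P.toDeaconuRenault ho).diagonal = P.diagonal := by
  have hcl : IsClosedEmbedding (piEquiv hss ho) := isometry_piEquiv.isClosedEmbedding
  rw [DeaconuRenaultSystem.diagonal, ← hcl.closure_image_eq]
  refine Subset.antisymm (closure_minimal ?_ isClosed_diagonal) ?_
  · rintro _ ⟨_, ⟨f, hf, rfl⟩, rfl⟩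
    refine ⟨⟨toCrossed hss ho f 1, (toCrossed hss ho f).mem 1⟩, ?_⟩
    rw [piEquiv_of, PartialAction.delta]
    congr 1
    ext g x
    by_cases hg : g = 1
    · subst hg; rw [delta_same]
    · rw [delta_of_ne _ hg]
      by_contra h
      obtain ⟨hx, e⟩ := exists_eq_of_coeff_ne_zero (Ne.symm h)
      refine h ((e.trans (hf _ fun hu => hg ?_)).symm)
      rw [← deg_arrow (hss := hss) (ho := ho) hx]
      exact mem_units_iff_deg.1 hu
  · rintro _ ⟨f, rfl⟩
    refine Metric.mem_closure_iff.2 fun ε hε => ?_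
    obtain ⟨k, K, hK, hKU, hk, hkf⟩ := exists_cutoff f (ε := ε / 4) (by positivity)
    obtain ⟨f', hf'⟩ := exists_toCrossed_eq_delta (hss := hss) (ho := ho) k hK hKU hk
    refine ⟨_, ⟨_, ⟨f', fun γ hγ => ?_, rfl⟩, rfl⟩, ?_⟩
    · rw [← toCrossed_deg (hss := hss) f', hf',
        delta_of_ne _ fun h => hγ (mem_units_iff_deg.2 h)]
      rfl
    · rw [piEquiv_of, hf', dist_comm, dist_eq_norm, PartialAction.delta, ← map_sub, ← delta_sub]
      exact (norm_delta_le (k - f) (by positivity) hkf).trans_lt (by linarith)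

end PartialAction

/-! ### The circle action -/

namespace PartialAction

open AlgCrossed

section General

variable {G : Type u} [Group G] {X : Type v} [TopologicalSpace X] [T2Space X]
  {P : PartialAction G X}

theorem continuous_starAlgEquiv (e : P.CrossedProduct ≃⋆ₐ[ℂ] P.CrossedProduct) : Continuous e :=
  (isometry_starAlgEquiv e).continuous

theorem continuous_smul_const (c : ℂ) : Continuous fun b : P.CrossedProduct => c • b :=
  CStarSeminorm.Completion.continuous_smul_aux _ c

end General

variable {A : Type u} {X : Type v} [TopologicalSpace X] [T2Space X]
  {P : PartialAction (FreeGroup A) X}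

theorem circleAction_delta (z : Circle) (g : FreeGroup A) (f : C0On (P.U g)) :
    P.circleAction z (P.delta g f) =
      ((z ^ (lengthHom A g).toAdd : Circle) : ℂ) • P.delta g f := by
  rw [PartialAction.delta, circleAction_of, ← map_smul]
  congr 1
  ext h x
  rw [dualHom_apply, AlgCrossed.smul_apply]
  by_cases hg : h = g
  · rw [hg]
  · rw [delta_of_ne _ hg, Pi.zero_apply, mul_zero, mul_zero]

theorem continuous_circleAction (b : P.CrossedProduct) :
    Continuous fun z => P.circleAction z b := by
  refine continuous_of_uniform_approx_of_continuous fun u hu => ?_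
  obtain ⟨ε, hε, hεu⟩ := Metric.mem_uniformity_dist.1 hu
  obtain ⟨F, hF⟩ := Metric.denseRange_iff.1
    (EnvelopingCStarAlgebra.denseRange_of (A := P.AlgCrossed)) b ε hε
  refine ⟨fun z => P.circleAction z (EnvelopingCStarAlgebra.of F), ?_, fun z => hεu ?_⟩
  · clear hF
    induction F using AlgCrossed.induction_delta with
    | h0 => simpa only [map_zero] using continuous_const
    | hadd F H hF hH =>
      simp only [map_add]
      exact hF.add hH
    | hd g f =>
      have h := fun z => circleAction_delta z g f
      rw [PartialAction.delta] at h
      simp only [h]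
      have : Continuous fun z : Circle => ((z ^ (lengthHom A g).toAdd : Circle) : ℂ) :=
        continuous_subtype_val.comp (continuous_zpow _)
      exact this.smul continuous_const
  · rw [(isometry_starAlgEquiv (P.circleAction z)).dist_eq]
    exact hF

variable (P) in
theorem isCircleAction_circleAction : P.IsCircleAction P.circleAction where
  continuous := continuous_circleAction
  generator z a f := by rw [circleAction_delta, lengthHom_of, zpow_one]
  one z f := by rw [circleAction_delta, map_one, toAdd_one, zpow_zero, Circle.coe_one, one_smul]

/-- `ρ_z` acts on the component of `g` as the circle action does. -/
def IsHomogeneousAt (ρ : P.CrossedProduct ≃⋆ₐ[ℂ] P.CrossedProduct) (z : Circle)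
    (g : FreeGroup A) : Prop :=
  ∀ f : C0On (P.U g), ρ (P.delta g f) = ((z ^ (lengthHom A g).toAdd : Circle) : ℂ) • P.delta g f

/-- By density it suffices to consider coefficients with compact support. -/
theorem IsHomogeneousAt.of_isCompact {ρ : P.CrossedProduct ≃⋆ₐ[ℂ] P.CrossedProduct} {z : Circle}
    {g : FreeGroup A} (h : ∀ (f : C0On (P.U g)) (K : Set X), IsCompact K → K ⊆ P.U g →
      (∀ x, x ∉ K → f.1 x = 0) →
      ρ (P.delta g f) = ((z ^ (lengthHom A g).toAdd : Circle) : ℂ) • P.delta g f) :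
    IsHomogeneousAt ρ z g := by
  intro f
  have hcl : IsClosed {b | ρ b = ((z ^ (lengthHom A g).toAdd : Circle) : ℂ) • b} :=
    isClosed_eq (continuous_starAlgEquiv ρ) (continuous_smul_const _)
  let S : Set P.CrossedProduct := {b | ∃ (k : C0On (P.U g)) (K : Set X), IsCompact K ∧
    K ⊆ P.U g ∧ (∀ x, x ∉ K → k.1 x = 0) ∧ P.delta g k = b}
  have hf : P.delta g f ∈ closure S := by
    refine Metric.mem_closure_iff.2 fun ε hε => ?_
    obtain ⟨k, K, hK, hKU, hk, hkf⟩ := exists_cutoff f (ε := ε / 4) (by positivity)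
    refine ⟨_, ⟨k, K, hK, hKU, hk, rfl⟩, ?_⟩
    rw [dist_comm, dist_eq_norm, PartialAction.delta, PartialAction.delta, ← map_sub, ← delta_sub]
    exact (norm_delta_le (k - f) (by positivity) hkf).trans_lt (by linarith)
  refine closure_minimal ?_ hcl hf
  rintro _ ⟨k, K, hK, hKU, hk, rfl⟩
  exact h k K hK hKU hk

open Classical in
/-- If there is no cancellation in the product `gh`, then a function `k δ_{gh}` whose coefficient
has compact support factors as `(k δ_g) (k' δ_h)`, with `k' = 1` on the image of the support. -/
theorem IsSemisaturated.isHomogeneousAt_mul [LocallyCompactSpace X] (hss : P.IsSemisaturated)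
    {ρ : P.CrossedProduct ≃⋆ₐ[ℂ] P.CrossedProduct} {z : Circle} {g h : FreeGroup A}
    (hn : (g * h).norm = g.norm + h.norm) (hg : IsHomogeneousAt ρ z g)
    (hh : IsHomogeneousAt ρ z h) : IsHomogeneousAt ρ z (g * h) := by
  refine .of_isCompact fun k K hK hKU hk => ?_
  let k₁ : C0On (P.U g) := ⟨k.1, k.2.1, k.2.2.1, fun x hx => k.2.2.2 x fun h => hx (hss.mem hn h).1⟩
  have hK' : IsCompact (P.φ g⁻¹ '' K) :=
    hK.image_of_continuousOn ((P.continuousOn g).mono fun x hx => (hss.mem hn (hKU hx)).1)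
  obtain ⟨L, hL, hKL, hLU⟩ := exists_compact_between hK' (P.isOpen_U h) (by
    rintro _ ⟨x, hx, rfl⟩
    exact (hss.mem hn (hKU hx)).2)
  obtain ⟨b, hb1, hb0, -, -⟩ := exists_continuous_one_zero_of_isCompact hK'
    (isOpen_interior (s := L)).isClosed_compl (disjoint_compl_right_iff_subset.2 hKL)
  have hbL : ∀ x, x ∉ L → (b x : ℂ) = 0 := fun x hx => by
    rw [hb0 fun hx' => hx (interior_subset hx')]; simp
  let k₂ : C0On (P.U h) := ⟨fun x => (b x : ℂ), by fun_prop, by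
      refine tendsto_const_nhds.congr' ?_
      filter_upwards [hL.compl_mem_cocompact] with x hx
      exact (hbL x hx).symm, fun x hx => hbL x fun h => hx (hLU h)⟩
  have e : P.delta (g * h) k = P.delta g k₁ * P.delta h k₂ := by
    rw [PartialAction.delta, PartialAction.delta, PartialAction.delta, ← map_mul]
    congr 1
    ext l x
    rw [delta_mul_apply]
    by_cases hl : l = g * h
    · subst hl
      rw [delta_same, inv_mul_cancel_left, delta_same]
      by_cases hx : x ∈ K
      · have : b (P.φ g⁻¹ x) = 1 := hb1 ⟨x, hx, rfl⟩
        simp [k₁, k₂, this]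
      · simp [k₁, hk x hx]
    · rw [delta_of_ne _ hl, delta_of_ne _ fun e => hl (by rw [← e, mul_inv_cancel_left])]
      simp
  rw [e, map_mul, hg, hh, smul_mul_smul_comm, map_mul, toAdd_mul, zpow_add, Circle.coe_mul]

theorem IsHomogeneousAt.inv {ρ : P.CrossedProduct ≃⋆ₐ[ℂ] P.CrossedProduct} {z : Circle}
    {g : FreeGroup A} (hg : IsHomogeneousAt ρ z g) : IsHomogeneousAt ρ z g⁻¹ := by
  intro f
  obtain ⟨f', hf'⟩ := star_delta (inv_inv g).symm f
  have e : P.delta g⁻¹ f = star (P.delta g f') := by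
    rw [PartialAction.delta, PartialAction.delta, ← hf', ← map_star, star_star]
  rw [e, map_star, hg, star_smul, map_inv, toAdd_inv, zpow_neg, Circle.coe_inv_eq_conj]
  rfl

theorem IsCircleAction.eq [LocallyCompactSpace X] (hss : P.IsSemisaturated)
    {ρ : Circle →* (P.CrossedProduct ≃⋆ₐ[ℂ] P.CrossedProduct)} (hρ : P.IsCircleAction ρ) :
    ρ = P.circleAction := by
  have hof : ∀ z a, IsHomogeneousAt (ρ z) z (FreeGroup.of a) := fun z a f => by
    rw [hρ.generator, lengthHom_of, zpow_one]
  have key : ∀ z g, IsHomogeneousAt (ρ z) z g := fun z g => by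
    induction g using FreeGroup.induction_reduced with
    | h1 =>
      intro f
      rw [hρ.one, map_one, toAdd_one, zpow_zero, Circle.coe_one, one_smul]
    | hof a h hn ih => exact hss.isHomogeneousAt_mul hn (hof z a) ih
    | hinv a h hn ih => exact hss.isHomogeneousAt_mul hn (hof z a).inv ih
  ext z b
  refine congrFun ((EnvelopingCStarAlgebra.denseRange_of (A := P.AlgCrossed)).equalizer
    (continuous_starAlgEquiv (ρ z)) (continuous_starAlgEquiv (P.circleAction z))
    (funext fun F => ?_)) b
  simp only [Function.comp_apply]
  induction F using AlgCrossed.induction_delta with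
  | h0 => simp only [map_zero]
  | hadd F H hF hH => simp only [map_add, hF, hH]
  | hd g f => exact (key z g f).trans (circleAction_delta z g f).symm

end PartialAction

end

theorem lemma4p6 {A : Type*} [Countable A] {X : Type*} [TopologicalSpace X]
    [LocallyCompactSpace X] [T2Space X] [SecondCountableTopology X]
    (P : PartialAction (FreeGroup A) X) (hss : P.IsSemisaturated) (ho : P.IsOrthogonal) :
    (P.IsCircleAction P.circleAction ∧ ∀ ρ, P.IsCircleAction ρ → ρ = P.circleAction) ∧
    ∃ PiX : (P.toDeaconuRenault ho).GroupoidCStarAlgebra ≃⋆ₐ[ℂ] P.CrossedProduct,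
      PiX '' (P.toDeaconuRenault ho).diagonal = P.diagonal ∧
      (∀ (z : Circle) (b : (P.toDeaconuRenault ho).GroupoidCStarAlgebra),
        PiX ((P.toDeaconuRenault ho).gaugeAction z b) = P.circleAction z (PiX b)) ∧
      PiX.symm '' P.diagonal = (P.toDeaconuRenault ho).diagonal ∧
      (∀ (z : Circle) (b : P.CrossedProduct),
        (P.toDeaconuRenault ho).gaugeAction z (PiX.symm b) = PiX.symm (P.circleAction z b)) := by
  refine ⟨⟨P.isCircleAction_circleAction, fun ρ hρ => hρ.eq hss⟩, PartialAction.piEquiv hss ho,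
    PartialAction.image_diagonal, PartialAction.piEquiv_gaugeAction, ?_, fun z b => ?_⟩
  · rw [← PartialAction.image_diagonal (hss := hss) (ho := ho), image_image]
    simp only [StarAlgEquiv.symm_apply_apply, image_id']
  · refine (PartialAction.isometry_piEquiv (hss := hss) (ho := ho)).injective ?_
    rw [PartialAction.piEquiv_gaugeAction, StarAlgEquiv.apply_symm_apply,
      StarAlgEquiv.apply_symm_apply]
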